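/- **Setting.** There are $K\ge 1$ arms, $\mathcal A=\{1,\dots,K\}$, and rounds $t=1,\dots,T$. In round $t$ a non-oblivious adversary, knowing everything that happened before (past arms, past losses and its own internal randomization), draws a loss vector $\ell_t\in\mathbb R^K$, possibly at random; independently of this draw given the past, the learner samples an arm $a_t\sim p_t$, where the distribution $p_t$ depends only on the past observations $a_1,\ell_{1,a_1},\dots,a_{t-1},\ell_{t-1,a_{t-1}}$, and then observes $\ell_{t,a_t}$. The regret is $\operatorname{Reg}_T=\max_{a}\mathbb E\big[\sum_{t=1}^T\ell_{t,a_t}-\sum_{t=1}^T\ell_{t,a}\big]$. The losses are heavy-tailed with known parameters $\varepsilon\in(1,2]$ and $\sigma>0$: in every round $t\le T$, given any past, the loss of every arm $a$ satisfies $\mathbb E[|\ell_{t,a}|^{\varepsilon}]\le\sigma$. No truncated non-negativity is assumed. For $C\ge0$ and $\Delta\in\mathbb R_{\ge0}^K$, the environment is in the adversarial regime with a $(\Delta,C,T)$-self-bounding constraint if for every algorithm $\operatorname{Reg}_T\ge\mathbb E\big[\sum_{t=1}^T\Delta_{a_t}\big]-C$. **Algorithm.** Put $\alpha=1/\varepsilon$,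 $\psi(q)=-\frac1\alpha\sum_{a}(q_a^\alpha-q_a)$ and $\beta_t=\sigma^{1/\varepsilon}\max\{8\varepsilon K^{(\varepsilon-1)/\varepsilon}/(\varepsilon-1),\,t^{1/\varepsilon}\}$. In round $t$: 1. $q_t\in\arg\min_{q}\big\{\big\langle\sum_{s<t}(\hat\ell_s-b_s),q\big\rangle+\beta_t\psi(q)\big\}$ over the probability simplex in $\mathbb R^K$; 2. $q_{t*}=\min\{\|q_t\|_\infty,1-\|q_t\|_\infty\}$, $\tilde q_{t,a}=\min\{q_{t,a},q_{t*}\}$, $s_{t,a}=(1-\alpha)\tilde q_{t,a}^{\alpha-1}\beta_t/8$; 3. $p_t=(1-\gamma_t)q_t+\gamma_t p_0$, where $p_0$ is the uniform distribution, $\gamma_t=\sigma^{1/(\varepsilon-1)}K\,s_{t,\tilde a_t}^{\varepsilon/(1-\varepsilon)}$ and $\tilde a_t\in\arg\max_a q_{t,a}$; 4. sample $a_t\sim p_t$, observe $\ell_{t,a_t}$, and set $\tilde\ell_{t,a}=\ell_{t,a}\mathbf 1\{a_t=a\}/p_{t,a}$, $\hat\ell_{t,a}=\tilde\ell_{t,a}\mathbf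 1\{|\tilde\ell_{t,a}|\le s_{t,a}\}$, $b_{t,a}=\sigma p_{t,a}^{1-\varepsilon}s_{t,a}^{1-\varepsilon}$. (For $K=1$ the algorithm always plays the only arm.) **Theorem.** Let $\kappa=8\varepsilon^2\sigma^{1/\varepsilon}K^{2(\varepsilon-1)/\varepsilon}/(\varepsilon-1)$, and let $\iota(\varepsilon)=\log T$ if $\varepsilon=2$ and $\iota(\varepsilon)=\big(\frac{8\varepsilon}{\varepsilon-1}\big)^{\varepsilon/(\varepsilon-1)}\frac{\varepsilon-1}{2-\varepsilon}$ if $\varepsilon\in(1,2)$. There are an absolute constant $c>0$ and, for every $\varepsilon\in(1,2]$, a constant $c_\varepsilon>0$ that depends only on $\varepsilon$, such that for all $\sigma>0$, $K$, $T$ and all heavy-tailed environments as above the algorithm satisfies the following. (i) Adversarial regime: $$\operatorname{Reg}_T\le c\left(\sigma^{\frac1\varepsilon}K^{\frac{\varepsilon-1}{\varepsilon}}T^{\frac1\varepsilon}+\sigma^{\frac1\varepsilon}K\,\iota(\varepsilon)+\kappa\right).$$ (ii) If the environment is in the adversarial regime with a $(\Delta,C,T)$-self-bounding constraint, $a^*\in\arg\min_a\mathbb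 E[\sum_{t=1}^T\ell_{t,a}]$ is an optimal arm when the algorithm is run, and $\Delta_a>0$ for all $a\ne a^*$, then with $\omega(\Delta)=\big(\sum_{a\ne a^*}\Delta_a^{1/(1-\varepsilon)}\big)^{(\varepsilon-1)/\varepsilon}$, $$\operatorname{Reg}_T\le c_\varepsilon\left(\tfrac{2\sigma}{\varepsilon}\right)^{\frac1{\varepsilon-1}}\omega(\Delta)^{\frac{\varepsilon}{\varepsilon-1}}\log T+c\left(\omega(\Delta)(\log T)^{1-\frac1\varepsilon}\left(\tfrac{2\sigma}{\varepsilon}\right)^{\frac1\varepsilon}C^{\frac1\varepsilon}+\sigma^{\frac1\varepsilon}K\,\iota(\varepsilon)+\kappa\right).$$ -/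

import Mathlib

open MeasureTheory ProbabilityTheory

universe u

namespace HTBandit

noncomputable section

/-! ### The bandit protocol

Rounds are indexed by `t = 0, 1, 2, …`; index `t` stands for round `t + 1`. -/

/-- What happens in one round: the internal randomization `z` of the adversary, the loss vector
`ℓ`, and the arm chosen by the learner, as `((z, ℓ), a)`. -/
abbrev Round (Z : Type u) (K : ℕ) : Type u := (Z × (Fin K → ℝ)) × Fin K

/-- What the learner sees of one round: its arm and the loss of that arm. -/
abbrev Obs (K : ℕ) : Type := Fin K × ℝ

/-- A non-oblivious adversary with `K` arms: given everything that happened before (in particular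
the past arms and its own past internal randomization), it draws internal randomness and a loss
vector for the current round. -/
structure Environment (Z : Type u) [MeasurableSpace Z] (K : ℕ) where
  kernel : (t : ℕ) → Kernel (Fin t → Round Z K) (Z × (Fin K → ℝ))
  markov : ∀ t, IsMarkovKernel (kernel t)

/-- A learning algorithm: given the observations of the past rounds, it picks the distribution from
which the current arm is sampled. -/
structure Policy (K : ℕ) where
  kernel : (t : ℕ) → Kernel (Fin t → Obs K) (Fin K)
  markov : ∀ t, IsMarkovKernel (kernel t)

attribute [instance] Environment.markov Policy.markov

variable {Z : Type u} [MeasurableSpace Z] {K : ℕ}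

/-- The observations contained in a history. -/
def observed (t : ℕ) (h : Fin t → Round Z K) : Fin t → Obs K :=
  fun s => ((h s).2, (h s).1.2 (h s).2)

theorem measurable_observed (t : ℕ) : Measurable (observed (Z := Z) (K := K) t) := by
  refine measurable_pi_lambda _ fun s => ?_
  have h1 : Measurable (fun r : Round Z K => ((r.2, r.1.2 r.2) : Obs K)) := by
    refine measurable_snd.prodMk ?_
    refine measurable_from_prod_countable_left fun a => ?_
    exact (measurable_pi_apply a).comp measurable_snd
  exact h1.comp (measurable_pi_apply s)

/-- Given the history, the environment's draw and the learner's arm of the current round are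
independent. -/
def stepKernel (env : Environment Z K) (π : Policy K) (t : ℕ) :
    Kernel (Fin t → Round Z K) (Round Z K) :=
  env.kernel t ×ₖ (π.kernel t).comap (observed t) (measurable_observed t)

/-- The joint law of the first `t` rounds of the interaction. -/
def law (env : Environment Z K) (π : Policy K) : (t : ℕ) → Measure (Fin t → Round Z K)
  | 0 => Measure.dirac Fin.elim0
  | t + 1 => (law env π t ⊗ₘ stepKernel env π t).map
      fun x => Fin.snoc (α := fun _ => Round Z K) x.1 x.2

instance isProbabilityMeasure_law (env : Environment Z K) (π : Policy K) (t : ℕ) :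
    IsProbabilityMeasure (law env π t) := by
  induction t with
  | zero => unfold law; infer_instance
  | succ t ih =>
    unfold law stepKernel
    refine Measure.isProbabilityMeasure_map (Measurable.aemeasurable ?_)
    refine measurable_pi_lambda _ fun i => ?_
    refine Fin.lastCases ?_ (fun j => ?_) i
    · simpa using measurable_snd
    · simp only [Fin.snoc_castSucc]
      exact (measurable_pi_apply j).comp measurable_fst

/-- `E[∑ₜ ℓ_{t,a}]`, the expected cumulative loss of the fixed arm `a` when `π` is run. -/
def armLoss (env : Environment Z K) (π : Policy K) (T : ℕ) (a : Fin K) : ℝ :=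
  ∫ h, ∑ t, (h t).1.2 a ∂(law env π T)

/-- The pseudo-regret `max_a E[∑ₜ ℓ_{t,a_t} - ∑ₜ ℓ_{t,a}]`. -/
def regret (env : Environment Z K) (π : Policy K) (T : ℕ) : ℝ :=
  ⨆ a : Fin K, ∫ h, (∑ t, (h t).1.2 (h t).2 - ∑ t, (h t).1.2 a) ∂(law env π T)

/-- Heavy-tailed losses: in each of the first `T` rounds, whatever happened before, the loss of
each arm has `ε`-th raw absolute moment at most `σ`. -/
def HeavyTailed (env : Environment Z K) (T : ℕ) (ε σ : ℝ) : Prop :=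
  ∀ t < T, ∀ (h : Fin t → Round Z K) (a : Fin K),
    ∫⁻ x, ENNReal.ofReal (|x.2 a| ^ ε) ∂(env.kernel t h) ≤ ENNReal.ofReal σ

/-- The adversarial regime with a `(Δ, C, T)`-self-bounding constraint. -/
def SelfBounding (env : Environment Z K) (Δ : Fin K → ℝ) (C : ℝ) (T : ℕ) : Prop :=
  ∀ π : Policy K, (∫ h, ∑ t, Δ (h t).2 ∂(law env π T)) - C ≤ regret env π T

/-- `a` is an optimal arm in expectation in hindsight when `π` is run. -/
def IsOptimalArm (env : Environment Z K) (π : Policy K) (T : ℕ) (a : Fin K) : Prop :=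
  ∀ a' : Fin K, armLoss env π T a ≤ armLoss env π T a'

/-! ### The algorithm -/

/-- The `α`-Tsallis entropy regularizer. -/
def tsallis (α : ℝ) (q : Fin K → ℝ) : ℝ := -(1 / α) * ∑ a, (q a ^ α - q a)

/-- The inverse learning rate of round `t + 1`. -/
def invRate (K : ℕ) (ε σ : ℝ) (t : ℕ) : ℝ :=
  σ ^ (1 / ε) * max (8 * ε * (K : ℝ) ^ ((ε - 1) / ε) / (ε - 1)) (((t : ℝ) + 1) ^ (1 / ε))

/-- `q_* = min {‖q‖_∞, 1 - ‖q‖_∞}`. -/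
def qStar (q : Fin K → ℝ) : ℝ := min ‖q‖ (1 - ‖q‖)

/-- The clipping threshold `s_{t,a}`, for the FTRL iterate `q`. -/
def clipLevel (α ε σ : ℝ) (t : ℕ) (q : Fin K → ℝ) (a : Fin K) : ℝ :=
  (1 - α) * (min (q a) (qStar q)) ^ (α - 1) * invRate K ε σ t / 8

/-- The exploration strength `γ_t`, for the FTRL iterate `q` with most likely arm `m`. -/
def exploration (α ε σ : ℝ) (t : ℕ) (q : Fin K → ℝ) (m : Fin K) : ℝ :=
  σ ^ (1 / (ε - 1)) * K * (clipLevel α ε σ t q m) ^ (ε / (1 - ε))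

/-- The sampling distribution `p_t`. -/
def samplingDist (α ε σ : ℝ) (t : ℕ) (q : Fin K → ℝ) (m : Fin K) (a : Fin K) : ℝ :=
  (1 - exploration α ε σ t q m) * q a + exploration α ε σ t q m * (1 / K)

/-- The importance-weighted loss estimate `tilde ℓ_{t,a}`, from the observation `o`. -/
def iwEstimate (α ε σ : ℝ) (t : ℕ) (q : Fin K → ℝ) (m : Fin K) (o : Obs K) (a : Fin K) : ℝ :=
  if o.1 = a then o.2 / samplingDist α ε σ t q m a else 0

/-- The clipped loss estimate `hat ℓ_{t,a}`. -/
def clippedEstimate (α ε σ : ℝ) (t : ℕ) (q : Fin K → ℝ) (m : Fin K) (o : Obs K)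
    (a : Fin K) : ℝ :=
  if |iwEstimate α ε σ t q m o a| ≤ clipLevel α ε σ t q a then iwEstimate α ε σ t q m o a else 0

/-- The bonus `b_{t,a}`. -/
def bonus (α ε σ : ℝ) (t : ℕ) (q : Fin K → ℝ) (m : Fin K) (a : Fin K) : ℝ :=
  σ * samplingDist α ε σ t q m a ^ (1 - ε) * clipLevel α ε σ t q a ^ (1 - ε)

/-- The first `s` rounds of a longer list of observations. -/
def restrictObs {t : ℕ} (h : Fin t → Obs K) (s : Fin t) : Fin s → Obs K :=
  fun i => h (Fin.castLE s.isLt.le i)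

/-- The FTRL objective of round `t + 1` after the observations `h`, where `q` and `m` give the
iterates and their most likely arms in the earlier rounds. -/
def ftrlObjective (α ε σ : ℝ) (q : (t : ℕ) → (Fin t → Obs K) → Fin K → ℝ)
    (m : (t : ℕ) → (Fin t → Obs K) → Fin K) (t : ℕ) (h : Fin t → Obs K) (x : Fin K → ℝ) : ℝ :=
  (∑ a, (∑ s : Fin t,
      (clippedEstimate α ε σ s (q s (restrictObs h s)) (m s (restrictObs h s)) (h s) a
        - bonus α ε σ s (q s (restrictObs h s)) (m s (restrictObs h s)) a)) * x a)
    + invRate K ε σ t * tsallis α x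

/-- `π` runs the bonus-shifted FTRL algorithm with parameters `α`, `ε`, `σ` for `T` rounds. -/
def IsBonusFTRL (α ε σ : ℝ) (T : ℕ) (π : Policy K) : Prop :=
  ∃ (q : (t : ℕ) → (Fin t → Obs K) → Fin K → ℝ) (m : (t : ℕ) → (Fin t → Obs K) → Fin K),
    ∀ t < T, ∀ h : Fin t → Obs K,
      q t h ∈ stdSimplex ℝ (Fin K) ∧
      IsMinOn (ftrlObjective α ε σ q m t h) (stdSimplex ℝ (Fin K)) (q t h) ∧
      (∀ a, q t h a ≤ q t h (m t h)) ∧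
      ∀ a, π.kernel t h {a} = ENNReal.ofReal (samplingDist α ε σ t (q t h) (m t h) a)

/-! ### The algorithm is well defined

Nothing below is used in the statement, except the quantities in the last section; the theorem
`exists_isBonusFTRL` shows that a policy as above exists. -/

theorem continuous_tsallis {α : ℝ} (h0 : 0 < α) : Continuous (tsallis (K := K) α) := by
  unfold tsallis
  refine continuous_const.mul (continuous_finsetSum _ fun a _ => ?_)
  exact ((continuous_apply a).rpow_const fun _ => Or.inr h0.le).sub (continuous_apply a)

theorem strictConvexOn_tsallis {α : ℝ} (h0 : 0 < α) (h1 : α < 1) :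
    StrictConvexOn ℝ (stdSimplex ℝ (Fin K)) (tsallis (K := K) α) := by
  refine ⟨convex_stdSimplex ℝ _, fun x hx y hy hxy s r hs hr hsr => ?_⟩
  have hsc := Real.strictConcaveOn_rpow h0 h1
  obtain ⟨b, hb⟩ := Function.ne_iff.mp hxy
  have key : ∑ a, (s * x a ^ α + r * y a ^ α) < ∑ a, (s * x a + r * y a) ^ α := by
    refine Finset.sum_lt_sum (fun a _ => ?_) ⟨b, Finset.mem_univ b, ?_⟩
    · exact hsc.concaveOn.2 (hx.1 a) (hy.1 a) hs.le hr.le hsr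
    · exact hsc.2 (hx.1 b) (hy.1 b) hb hs hr hsr
  have hα : 0 < 1 / α := by positivity
  simp only [tsallis, Pi.add_apply, Pi.smul_apply, smul_eq_mul, Finset.sum_sub_distrib,
    Finset.sum_add_distrib, ← Finset.mul_sum] at key ⊢
  nlinarith

/-- The objective with cumulative estimate `L`. -/
def linObjective (α β : ℝ) (L x : Fin K → ℝ) : ℝ := (∑ a, L a * x a) + β * tsallis α x

theorem continuous_linObjective {α : ℝ} (β : ℝ) (h0 : 0 < α) :
    Continuous fun p : (Fin K → ℝ) × (Fin K → ℝ) => linObjective α β p.1 p.2 := by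
  unfold linObjective
  have := (continuous_tsallis (K := K) h0).comp (continuous_snd (X := Fin K → ℝ))
  refine Continuous.add (continuous_finsetSum _ fun a _ => ?_) (continuous_const.mul this)
  exact ((continuous_apply a).comp continuous_fst).mul ((continuous_apply a).comp continuous_snd)

theorem exists_min (hK : 1 ≤ K) {α : ℝ} (β : ℝ) (h0 : 0 < α) (L : Fin K → ℝ) :
    ∃ q ∈ stdSimplex ℝ (Fin K), IsMinOn (linObjective α β L) (stdSimplex ℝ (Fin K)) q := by
  have : Nonempty (Fin K) := ⟨⟨0, hK⟩⟩
  refine (isCompact_stdSimplex ℝ (Fin K)).exists_isMinOn ?_ ?_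
  · exact ⟨_, single_mem_stdSimplex ℝ (⟨0, hK⟩ : Fin K)⟩
  · exact ((continuous_linObjective β h0).comp (by fun_prop : Continuous fun x => (L, x))).continuousOn

theorem min_unique {α β : ℝ} (h0 : 0 < α) (h1 : α < 1) (hβ : 0 < β) (L x y : Fin K → ℝ)
    (hx : x ∈ stdSimplex ℝ (Fin K)) (hy : y ∈ stdSimplex ℝ (Fin K))
    (hmx : IsMinOn (linObjective α β L) (stdSimplex ℝ (Fin K)) x)
    (hmy : IsMinOn (linObjective α β L) (stdSimplex ℝ (Fin K)) y) : x = y := by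
  have : StrictConvexOn ℝ (stdSimplex ℝ (Fin K)) (linObjective α β L) := by
    refine ⟨convex_stdSimplex ℝ _, fun u hu v hv huv s r hs hr hsr => ?_⟩
    have := (strictConvexOn_tsallis h0 h1).2 hu hv huv hs hr hsr
    have e : ∑ a, L a * (s * u a + r * v a) = s * ∑ a, L a * u a + r * ∑ a, L a * v a := by
      rw [Finset.mul_sum, Finset.mul_sum, ← Finset.sum_add_distrib]
      exact Finset.sum_congr rfl fun a _ => by ring
    simp only [linObjective, Pi.add_apply, Pi.smul_apply, smul_eq_mul] at this ⊢
    rw [e]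
    nlinarith
  exact this.eq_of_isMinOn hmx hmy hx hy

/-- The FTRL map. -/
def ftrlMap (hK : 1 ≤ K) {α : ℝ} (β : ℝ) (h0 : 0 < α) (L : Fin K → ℝ) : Fin K → ℝ :=
  (exists_min hK β h0 L).choose

theorem continuous_ftrlMap (hK : 1 ≤ K) {α β : ℝ} (h0 : 0 < α) (h1 : α < 1) (hβ : 0 < β) :
    Continuous (ftrlMap hK β h0) := by
  have hmem : ∀ L, ftrlMap hK β h0 L ∈ stdSimplex ℝ (Fin K) :=
    fun L => (exists_min hK β h0 L).choose_spec.1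
  have hmin : ∀ L, IsMinOn (linObjective α β L) (stdSimplex ℝ (Fin K)) (ftrlMap hK β h0 L) :=
    fun L => (exists_min hK β h0 L).choose_spec.2
  rw [continuous_iff_seqContinuous]
  intro u L hu
  refine Filter.tendsto_of_subseq_tendsto fun ns hns => ?_
  obtain ⟨q, hq, φ, hφ, hlim⟩ := (isCompact_stdSimplex ℝ (Fin K)).tendsto_subseq
    (x := fun n => ftrlMap hK β h0 (u (ns n))) fun n => hmem _
  refine ⟨φ, ?_⟩
  have hu' : Filter.Tendsto (fun n => u (ns (φ n))) Filter.atTop (nhds L) :=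
    hu.comp (hns.comp hφ.tendsto_atTop)
  have : q = ftrlMap hK β h0 L := by
    refine min_unique h0 h1 hβ L _ _ hq (hmem L) (fun x hx => ?_) (hmin L)
    refine le_of_tendsto_of_tendsto'
      (((continuous_linObjective β h0).tendsto (L, q)).comp (hu'.prodMk_nhds hlim))
      (((continuous_linObjective β h0).tendsto (L, x)).comp (hu'.prodMk_nhds tendsto_const_nhds))
      fun n => ?_
    exact hmin _ hx
  rw [← this]
  exact hlim

theorem invRate_pos {ε σ : ℝ} (hσ : 0 < σ) (t : ℕ) :
    0 < invRate K ε σ t := by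
  unfold invRate
  have : (0 : ℝ) < ((t : ℝ) + 1) ^ (1 / ε) := by positivity
  have := this.trans_le (le_max_right (8 * ε * (K : ℝ) ^ ((ε - 1) / ε) / (ε - 1)) _)
  positivity

theorem exists_argmax (hK : 1 ≤ K) (q : Fin K → ℝ) : ∃ m, ∀ a, q a ≤ q m := by
  have : Nonempty (Fin K) := ⟨⟨0, hK⟩⟩
  exact Finite.exists_max q

/-- A most likely arm. -/
def argmaxArm (hK : 1 ≤ K) (q : Fin K → ℝ) : Fin K := (exists_argmax hK q).choose

theorem norm_eq_of_argmax {q : Fin K → ℝ} (hq : q ∈ stdSimplex ℝ (Fin K)) {m : Fin K}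
    (hm : ∀ a, q a ≤ q m) : ‖q‖ = q m := by
  refine le_antisymm ?_ ?_
  · rw [pi_norm_le_iff_of_nonneg (hq.1 m)]
    intro a
    rw [Real.norm_of_nonneg (hq.1 a)]
    exact hm a
  · exact (le_abs_self _).trans (norm_le_pi_norm q m)

theorem exploration_eq {α ε σ : ℝ} {t : ℕ} {q : Fin K → ℝ} (hq : q ∈ stdSimplex ℝ (Fin K))
    {m : Fin K} (hm : ∀ a, q a ≤ q m) :
    exploration α ε σ t q m = σ ^ (1 / (ε - 1)) * K *
      ((1 - α) * qStar q ^ (α - 1) * invRate K ε σ t / 8) ^ (ε / (1 - ε)) := by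
  have : min (q m) (qStar q) = qStar q := by
    rw [← norm_eq_of_argmax hq hm]
    exact min_eq_right (min_le_left _ _)
  rw [exploration, clipLevel, this]

theorem exploration_mem (hK : 1 ≤ K) {ε σ : ℝ} (h1 : 1 < ε) (hσ : 0 < σ)
    {t : ℕ} {q : Fin K → ℝ} (hq : q ∈ stdSimplex ℝ (Fin K))
    {m : Fin K} (hm : ∀ a, q a ≤ q m) :
    0 ≤ exploration (1 / ε) ε σ t q m ∧ exploration (1 / ε) ε σ t q m ≤ 1 / 2 := by
  rw [exploration_eq hq hm]
  have hn : ‖q‖ ≤ 1 := by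
    rw [norm_eq_of_argmax hq hm, ← hq.2]
    exact Finset.single_le_sum (fun a _ => hq.1 a) (Finset.mem_univ m)
  have hs0 : 0 ≤ qStar q := le_min (norm_nonneg q) (by linarith)
  have hs2 : qStar q ≤ 1 / 2 := by
    unfold qStar
    rcases le_total ‖q‖ (1 / 2) with h | h
    · exact (min_le_left _ _).trans h
    · exact (min_le_right _ _).trans (by linarith)
  have hβ := invRate_pos (K := K) (ε := ε) hσ t
  have hε : 0 < ε := by linarith
  have hα : 0 < 1 - 1 / ε := by
    rw [sub_pos, div_lt_one hε]; exact h1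
  have hK' : (0 : ℝ) < K := by exact_mod_cast hK
  refine ⟨by positivity, ?_⟩
  rcases hs0.eq_or_lt with h0 | h0
  · have hne : (1 / ε - 1) ≠ 0 := by linarith
    have hne' : ε / (1 - ε) ≠ 0 := div_ne_zero hε.ne' (by linarith)
    rw [← h0, Real.zero_rpow hne]
    simp [Real.zero_rpow hne']
  · set s0 : ℝ := σ ^ (1 / ε) * (K : ℝ) ^ ((ε - 1) / ε) * qStar q ^ (1 / ε - 1) with hs0'
    have hs0p : 0 < s0 := by positivity
    have hle : s0 ≤ (1 - 1 / ε) * qStar q ^ (1 / ε - 1) * invRate K ε σ t / 8 := by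
      have : σ ^ (1 / ε) * (8 * ε * (K : ℝ) ^ ((ε - 1) / ε) / (ε - 1)) ≤ invRate K ε σ t := by
        unfold invRate
        gcongr
        exact le_max_left _ _
      have h2 : s0 = (1 - 1 / ε) * qStar q ^ (1 / ε - 1) *
          (σ ^ (1 / ε) * (8 * ε * (K : ℝ) ^ ((ε - 1) / ε) / (ε - 1))) / 8 := by
        rw [hs0']
        have : ε - 1 ≠ 0 := by linarith
        field_simp
      rw [h2]
      gcongr
    have hneg : ε / (1 - ε) ≤ 0 := div_nonpos_of_nonneg_of_nonpos hε.le (by linarith)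
    have h3 := Real.rpow_le_rpow_of_nonpos hs0p hle hneg
    have h4 : s0 ^ (ε / (1 - ε)) = σ ^ (-(1 / (ε - 1))) * (K : ℝ)⁻¹ * qStar q := by
      have e1 : 1 - ε ≠ 0 := by linarith
      have e2 : ε - 1 ≠ 0 := by linarith
      rw [hs0', Real.mul_rpow (by positivity) (by positivity),
        Real.mul_rpow (by positivity) (by positivity), ← Real.rpow_mul hσ.le,
        ← Real.rpow_mul hK'.le, ← Real.rpow_mul h0.le]
      have a1 : 1 / ε * (ε / (1 - ε)) = -(1 / (ε - 1)) := by
        rw [← neg_sub ε 1]; field_simp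
      have a2 : (ε - 1) / ε * (ε / (1 - ε)) = -1 := by
        rw [← neg_sub ε 1]; field_simp
      have a3 : (1 / ε - 1) * (ε / (1 - ε)) = 1 := by field_simp
      rw [a1, a2, a3, Real.rpow_neg_one, Real.rpow_one]
    calc _ ≤ σ ^ (1 / (ε - 1)) * K * (s0 ^ (ε / (1 - ε))) := by gcongr
      _ = qStar q := by
        rw [h4, Real.rpow_neg hσ.le]
        have : 0 < σ ^ (1 / (ε - 1)) := by positivity
        field_simp
      _ ≤ 1 / 2 := hs2

/-- The cumulative shifted estimates. -/
def cumEst (hK : 1 ≤ K) {α : ℝ} (ε σ : ℝ) (h0 : 0 < α) : (t : ℕ) → (Fin t → Obs K) → Fin K → ℝ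
  | 0, _ => 0
  | t + 1, h => fun a =>
    let L := cumEst hK ε σ h0 t (fun i => h i.castSucc)
    let q := ftrlMap hK (invRate K ε σ t) h0 L
    L a + (clippedEstimate α ε σ t q (argmaxArm hK q) (h (Fin.last t)) a
      - bonus α ε σ t q (argmaxArm hK q) a)

theorem cumEst_eq (hK : 1 ≤ K) {α : ℝ} (ε σ : ℝ) (h0 : 0 < α) (t : ℕ) (h : Fin t → Obs K)
    (a : Fin K) :
    cumEst hK ε σ h0 t h a = ∑ s : Fin t,
      (clippedEstimate α ε σ s (ftrlMap hK (invRate K ε σ s) h0 (cumEst hK ε σ h0 s (restrictObs h s)))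
          (argmaxArm hK (ftrlMap hK (invRate K ε σ s) h0 (cumEst hK ε σ h0 s (restrictObs h s))))
          (h s) a
        - bonus α ε σ s (ftrlMap hK (invRate K ε σ s) h0 (cumEst hK ε σ h0 s (restrictObs h s)))
          (argmaxArm hK (ftrlMap hK (invRate K ε σ s) h0 (cumEst hK ε σ h0 s (restrictObs h s)))) a) := by
  induction t with
  | zero => simp [cumEst]
  | succ t ih =>
    rw [Fin.sum_univ_castSucc]
    exact congrArg (· + _) (ih (fun i => h i.castSucc))

section
variable {Y : Type*} [MeasurableSpace Y] {q : Y → Fin K → ℝ} {m : Y → Fin K} {ε σ α : ℝ}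

theorem measurable_qStar (hqm : Measurable q) : Measurable fun y => qStar (q y) :=
  hqm.norm.min (measurable_const.sub hqm.norm)

theorem measurable_clipLevel (hqm : Measurable q) (t : ℕ) (a : Fin K) :
    Measurable fun y => clipLevel α ε σ t (q y) a := by
  unfold clipLevel
  have := measurable_qStar hqm
  have h2 : Measurable fun y => q y a := (measurable_pi_apply a).comp hqm
  exact ((measurable_const.mul ((h2.min this).pow_const _)).mul_const _).div_const _

theorem measurable_exploration (hqm : Measurable q) (hq : ∀ y, q y ∈ stdSimplex ℝ (Fin K))
    (hm : ∀ y a, q y a ≤ q y (m y)) (t : ℕ) :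
    Measurable fun y => exploration α ε σ t (q y) (m y) := by
  simp only [fun y => exploration_eq (α := α) (ε := ε) (σ := σ) (t := t) (hq y) (hm y)]
  have := measurable_qStar hqm
  exact measurable_const.mul
    ((((measurable_const.mul (this.pow_const _)).mul_const _).div_const _).pow_const _)

theorem measurable_samplingDist (hqm : Measurable q) (hq : ∀ y, q y ∈ stdSimplex ℝ (Fin K))
    (hm : ∀ y a, q y a ≤ q y (m y)) (t : ℕ) (a : Fin K) :
    Measurable fun y => samplingDist α ε σ t (q y) (m y) a := by
  unfold samplingDist
  have := measurable_exploration (ε := ε) (σ := σ) (α := α) hqm hq hm t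
  have h2 : Measurable fun y => q y a := (measurable_pi_apply a).comp hqm
  exact ((measurable_const.sub this).mul h2).add (this.mul_const _)

theorem measurable_bonus (hqm : Measurable q) (hq : ∀ y, q y ∈ stdSimplex ℝ (Fin K))
    (hm : ∀ y a, q y a ≤ q y (m y)) (t : ℕ) (a : Fin K) :
    Measurable fun y => bonus α ε σ t (q y) (m y) a := by
  unfold bonus
  exact (measurable_const.mul ((measurable_samplingDist hqm hq hm t a).pow_const _)).mul
    ((measurable_clipLevel hqm t a).pow_const _)

theorem measurable_clippedEstimate (hqm : Measurable q) (hq : ∀ y, q y ∈ stdSimplex ℝ (Fin K))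
    (hm : ∀ y a, q y a ≤ q y (m y)) (t : ℕ) (a : Fin K) {o : Y → Obs K} (ho : Measurable o) :
    Measurable fun y => clippedEstimate α ε σ t (q y) (m y) (o y) a := by
  have h1 : Measurable fun y => iwEstimate α ε σ t (q y) (m y) (o y) a := by
    unfold iwEstimate
    refine Measurable.ite ?_ (ho.snd.div (measurable_samplingDist hqm hq hm t a)) measurable_const
    exact ho.fst (measurableSet_singleton a)
  unfold clippedEstimate
  exact Measurable.ite (measurableSet_le h1.abs (measurable_clipLevel hqm t a)) h1 measurable_const

end

/-- The algorithm is well defined. -/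
theorem exists_isBonusFTRL (hK : 1 ≤ K) {ε σ : ℝ} (h1 : 1 < ε) (hσ : 0 < σ) (T : ℕ) :
    ∃ π : Policy K, IsBonusFTRL (1 / ε) ε σ T π := by
  have h0 : 0 < 1 / ε := by positivity
  have h0' : 1 / ε < 1 := by rw [div_lt_one (by linarith)]; exact h1
  set q : (t : ℕ) → (Fin t → Obs K) → Fin K → ℝ :=
    fun t h => ftrlMap hK (invRate K ε σ t) h0 (cumEst hK ε σ h0 t h) with hqdef
  set m : (t : ℕ) → (Fin t → Obs K) → Fin K := fun t h => argmaxArm hK (q t h) with hmdef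
  have hq : ∀ t h, q t h ∈ stdSimplex ℝ (Fin K) :=
    fun t h => (exists_min hK (invRate K ε σ t) h0 (cumEst hK ε σ h0 t h)).choose_spec.1
  have hm : ∀ t h a, q t h a ≤ q t h (m t h) := fun t h => (exists_argmax hK (q t h)).choose_spec
  have hLm : ∀ t, Measurable (cumEst hK ε σ h0 t) ∧ Measurable (q t) := by
    intro t
    have step : Measurable (cumEst hK ε σ h0 t) → Measurable (q t) := fun h =>
      (continuous_ftrlMap hK h0 h0' (invRate_pos hσ t)).measurable.comp h
    induction t with
    | zero => exact ⟨measurable_const, step measurable_const⟩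
    | succ t ih =>
      have ih := ih fun h =>
        (continuous_ftrlMap hK h0 h0' (invRate_pos hσ t)).measurable.comp h
      suffices Measurable (cumEst hK ε σ h0 (t + 1)) from ⟨this, step this⟩
      have hres : Measurable fun (h : Fin (t + 1) → Obs K) (i : Fin t) => h i.castSucc :=
        measurable_pi_lambda _ fun i => measurable_pi_apply _
      have hqm := ih.2.comp hres
      refine measurable_pi_lambda _ fun a => ?_
      exact ((measurable_pi_apply a).comp (ih.1.comp hres)).add
        ((measurable_clippedEstimate hqm (fun h => hq t _) (fun h => hm t _) t a
          (measurable_pi_apply (Fin.last t))).sub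
          (measurable_bonus hqm (fun h => hq t _) (fun h => hm t _) t a))
  have hKr : (0 : ℝ) < K := by exact_mod_cast hK
  have hp0 : ∀ t h a, 0 ≤ samplingDist (1 / ε) ε σ t (q t h) (m t h) a := by
    intro t h a
    obtain ⟨g0, g1⟩ := exploration_mem hK h1 hσ (t := t) (hq t h) (hm t h)
    have := (hq t h).1 a
    unfold samplingDist
    have : 0 ≤ 1 - exploration (1 / ε) ε σ t (q t h) (m t h) := by linarith
    positivity
  have hp1 : ∀ t h, ∑ a, samplingDist (1 / ε) ε σ t (q t h) (m t h) a = 1 := by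
    intro t h
    simp only [samplingDist, Finset.sum_add_distrib, ← Finset.mul_sum, (hq t h).2]
    simp
    field_simp
    ring
  let κ : (t : ℕ) → Kernel (Fin t → Obs K) (Fin K) := fun t =>
    { toFun := fun h => ∑ a, ENNReal.ofReal (samplingDist (1 / ε) ε σ t (q t h) (m t h) a) •
        Measure.dirac a
      measurable' := by
        refine Measure.measurable_of_measurable_coe _ fun s hs => ?_
        simp only [Measure.finsetSum_apply, Measure.smul_apply, smul_eq_mul]
        refine Finset.measurable_sum _ fun a _ => Measurable.mul_const ?_ _
        exact (measurable_samplingDist (hLm t).2 (hq t) (hm t) t a).ennreal_ofReal }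
  have hκ : ∀ t h, κ t h = ∑ a, ENNReal.ofReal (samplingDist (1 / ε) ε σ t (q t h) (m t h) a) •
        Measure.dirac a := fun _ _ => rfl
  refine ⟨⟨κ, fun t => ⟨fun h => ⟨?_⟩⟩⟩, q, m, fun t _ h => ⟨hq t h, ?_, hm t h, fun a => ?_⟩⟩
  · rw [hκ]
    simp only [Measure.finsetSum_apply, Measure.smul_apply, smul_eq_mul, measure_univ, mul_one]
    rw [← ENNReal.ofReal_sum_of_nonneg fun a _ => hp0 t h a, hp1, ENNReal.ofReal_one]
  · have := (exists_min hK (invRate K ε σ t) h0 (cumEst hK ε σ h0 t h)).choose_spec.2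
    have e : ftrlObjective (1 / ε) ε σ q m t h
        = linObjective (1 / ε) (invRate K ε σ t) (cumEst hK ε σ h0 t h) := by
      funext x
      simp only [ftrlObjective, linObjective, cumEst_eq]
      rfl
    rw [e]
    exact this
  · change κ t h {a} = _
    rw [hκ]
    simp only [Measure.finsetSum_apply, Measure.smul_apply, smul_eq_mul]
    rw [Finset.sum_eq_single a]
    · simp
    · intro b _ hb
      simp [hb]
    · simp

/-! ### The quantities in the bounds -/

/-- `ι(ε)`. -/
def iota (ε : ℝ) (T : ℕ) : ℝ :=
  if ε = 2 then Real.log T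
  else (8 * ε / (ε - 1)) ^ (ε / (ε - 1)) * ((ε - 1) / (2 - ε))

/-- `κ`. -/
def kappa (K : ℕ) (ε σ : ℝ) : ℝ :=
  8 * ε ^ 2 * σ ^ (1 / ε) * (K : ℝ) ^ (2 * (ε - 1) / ε) / (ε - 1)

/-- `ω(Δ)`, with optimal arm `a₀`. -/
def omegaGap (ε : ℝ) (Δ : Fin K → ℝ) (a₀ : Fin K) : ℝ :=
  (∑ a ∈ Finset.univ.erase a₀, Δ a ^ (1 / (1 - ε))) ^ ((ε - 1) / ε)

end

end HTBandit

namespace HTBandit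

noncomputable section

variable {K : ℕ}

/-! ### Elementary inequalities for real powers -/

/-! Fix a comparator `a₀`. Along every sequence of observations, FTRL on the shifted estimates has
regret at most penalty plus stability (`ftrl_regret`, `IsRun.regret_shifted_le`). What separates
this from the true regret is collected round by round in `roundGap`: the cost of exploration, the
bias created by clipping, the bonus, and the stability term.

The bonus is what makes the sign of the losses irrelevant. On arm `b` the clipping bias is at most
`bonus * |ℓ b| ^ ε / σ` (`abs_sub_playedEstimate_le`), hence at most the bonus in conditional
expectation. The bias enters with weight `|q b - vertex a₀ b|` and the bonus with the signed weight
`q b - vertex a₀ b`. On `a₀` the two cancel, and on every other arm they add up to at most `2 * q b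
* bonus`. The remaining parameters serve the same scheme: exploration keeps the bonus below the
clipping threshold (`bonus_le_clipLevel`), so the estimates are small enough for a local stability
bound (`stability_simplex`), and the threshold is scaled so that the expected stability is again of
the order of weight times bonus (`stability_coefficient`).

The truncated weights `min (q b) (qStar q)` let even the contribution of `a₀` be charged to the
other arms (`sum_min_rpow_le`). Hence every term except the initial penalty and the exploration is
at most a constant times `σ ^ (1/ε) * (t+1) ^ (1/ε - 1) * suboptPower ε q a₀`. Summation gives the
central bound `IsRun.expected_regret_le`, from which both regimes follow. In the adversarial regime
`suboptPower` is at most `K ^ ((ε-1)/ε)`. Under self-bounding, Young's inequality compares it with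
the expected gap, which is at most regret plus `C` (`IsRun.sum_suboptPower_le`), and the resulting
inequality for the regret is solved in `self_bounding_solve`. -/

theorem rpow_tangent_le {α x y : ℝ} (h0 : 0 ≤ α) (h1 : α ≤ 1) (hx : 0 ≤ x) (hy : 0 < y) :
    x ^ α ≤ y ^ α + α * y ^ (α - 1) * (x - y) := by
  have hb := rpow_one_add_le_one_add_mul_self (s := x / y - 1) (p := α)
    (by have : 0 ≤ x / y := by positivity
        linarith) h0 h1
  rw [add_sub_cancel, Real.div_rpow hx hy.le] at hb
  have hyα : 0 < y ^ α := by positivity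
  rw [div_le_iff₀ hyα] at hb
  refine hb.trans (le_of_eq ?_)
  rw [Real.rpow_sub_one hy.ne']
  field_simp

/-- The convex conjugate of the normalized Bregman divergence of the Tsallis entropy. -/
theorem tsallis_conj_le {α v y : ℝ} (h0 : 1 / 2 ≤ α) (h1 : α < 1) (hv : |v| ≤ (1 - α) / 2)
    (hy : 0 ≤ y) :
    v * (1 - y) - ((1 - y ^ α) / α + y - 1) ≤ 2 * v ^ 2 / (1 - α) := by
  obtain ⟨hv1, hv2⟩ := abs_le.mp hv
  have hα : 0 < α := by linarith
  have hc : 0 < 1 - α := by linarith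
  have hw : 3 / 4 ≤ 1 + v := by linarith
  have hw0 : 0 < 1 + v := by linarith
  -- Stationary point in `y` of the left side: the derivative vanishes when `y ^ (α - 1) = 1 + v`.
  -- By concavity of the power, the tangent at `y0` shows that it is the maximizer.
  set y0 : ℝ := (1 + v) ^ (-1 / (1 - α)) with hy0
  have hy0p : 0 < y0 := by positivity
  have e1 : y0 ^ (α - 1) = 1 + v := by
    rw [hy0, ← Real.rpow_mul hw0.le]
    have : -1 / (1 - α) * (α - 1) = 1 := by field_simp; ring
    rw [this, Real.rpow_one]
  have e2 : y0 ^ α = (1 + v) * y0 := by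
    rw [← e1, Real.rpow_sub_one hy0p.ne']; field_simp
  set r : ℝ := α / (1 - α) with hr
  have hrp : 0 < r := by positivity
  have ht := rpow_tangent_le hα.le h1.le hy hy0p
  rw [e1] at ht
  set z : ℝ := r * (-v / (1 + v)) with hz
  have hzle : |z| ≤ 1 := by
    rw [hz, abs_mul, abs_of_pos hrp, abs_div, abs_neg, abs_of_pos hw0, mul_div_assoc',
      div_le_one hw0]
    have h2 : r * |v| ≤ r * ((1 - α) / 2) := by gcongr
    have h3 : r * ((1 - α) / 2) = α / 2 := by rw [hr]; field_simp
    linarith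
  have hexp : y0 ^ α ≤ 1 + z + z ^ 2 := by
    have h2 : y0 ^ α = Real.exp (-(r * Real.log (1 + v))) := by
      rw [hy0, ← Real.rpow_mul hw0.le, Real.rpow_def_of_pos hw0]
      congr 1
      rw [hr]; field_simp
    have h3 : 1 - (1 + v)⁻¹ ≤ Real.log (1 + v) := Real.one_sub_inv_le_log_of_pos hw0
    have h4 : -(r * Real.log (1 + v)) ≤ z := by
      have : z = -(r * (1 - (1 + v)⁻¹)) := by rw [hz]; field_simp; ring
      rw [this]
      have := mul_le_mul_of_nonneg_left h3 hrp.le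
      linarith
    have h5 := Real.abs_exp_sub_one_sub_id_le hzle
    have h6 := (abs_le.mp h5).2
    rw [h2]
    have := Real.exp_le_exp.mpr h4
    linarith
  have hmain : v * (1 - y) - ((1 - y ^ α) / α + y - 1) ≤ v - (1 - y0 ^ α) / r := by
    have h2 : (y ^ α) / α ≤ y0 ^ α / α + (1 + v) * (y - y0) := by
      rw [div_le_iff₀ hα]
      have : (y0 ^ α / α + (1 + v) * (y - y0)) * α = y0 ^ α + α * (1 + v) * (y - y0) := by
        field_simp
      linarith
    have h3 : (1 - y0 ^ α) / r = (1 - y0 ^ α) / α - (1 - y0 ^ α) := by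
      rw [hr]; field_simp
    rw [h3, sub_div, sub_div]
    rw [e2] at h2 ⊢
    nlinarith
  refine hmain.trans ?_
  have h2 : -(1 - y0 ^ α) / r ≤ (z + z ^ 2) / r := by gcongr; linarith
  have h3 : (z + z ^ 2) / r = -v / (1 + v) + r * (v ^ 2 / (1 + v) ^ 2) := by
    rw [hz]; field_simp
  -- The first-order terms cancel, so only quadratic remainders are left; `1 + v ≥ 3/4` bounds each
  -- of the two fractions by `2 * v ^ 2`.
  have h4 : v + -v / (1 + v) = v ^ 2 / (1 + v) := by field_simp; ring
  have h5 : v ^ 2 / (1 + v) ≤ v ^ 2 * 2 := by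
    rw [div_le_iff₀ hw0]; nlinarith [sq_nonneg v]
  have h6 : v ^ 2 / (1 + v) ^ 2 ≤ v ^ 2 * 2 := by
    rw [div_le_iff₀ (by positivity)]
    have : 1 ≤ 2 * (1 + v) ^ 2 := by nlinarith
    nlinarith [sq_nonneg v]
  have h7 : 2 * v ^ 2 / (1 - α) = v ^ 2 * 2 + r * (v ^ 2 * 2) := by
    rw [hr]; field_simp; ring
  have h8 := mul_le_mul_of_nonneg_left h6 hrp.le
  rw [neg_div] at h2
  linarith

/-- The Bregman divergence of the Tsallis entropy. -/
def breg (α : ℝ) (x q : Fin K → ℝ) : ℝ :=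
  ∑ a, ((q a ^ α - x a ^ α) / α + q a ^ (α - 1) * (x a - q a))

theorem breg_term_nonneg {α x q : ℝ} (h0 : 0 < α) (h1 : α < 1) (hx : 0 ≤ x) (hq : 0 < q) :
    0 ≤ (q ^ α - x ^ α) / α + q ^ (α - 1) * (x - q) := by
  have := rpow_tangent_le h0.le h1.le hx hq
  have h2 : -(q ^ (α - 1) * (x - q)) ≤ (q ^ α - x ^ α) / α := by
    rw [le_div_iff₀ h0]; linarith
  linarith

/-- By homogeneity this is `tsallis_conj_le` with `y = x / q` and `v = u / (β * q ^ (α - 1))`,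
multiplied by `β * q ^ α`. -/
theorem stability_coord {α β u q x : ℝ} (h0 : 1 / 2 ≤ α) (h1 : α < 1) (hβ : 0 < β) (hq : 0 < q)
    (hx : 0 ≤ x) (hu : |u| ≤ (1 - α) * q ^ (α - 1) * β / 2) :
    u * (q - x) - β * ((q ^ α - x ^ α) / α + q ^ (α - 1) * (x - q))
      ≤ 2 / (β * (1 - α)) * (u ^ 2 * q ^ (2 - α)) := by
  have hα : 0 < α := by linarith
  have hc : 0 < 1 - α := by linarith
  set w : ℝ := β * q ^ (α - 1) with hw
  have hwp : 0 < w := by positivity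
  have hqα : q ^ (α - 1) * q = q ^ α := by
    rw [Real.rpow_sub_one hq.ne']; field_simp
  have hq2 : q ^ (2 - α) * q ^ (α - 1) = q := by
    rw [← Real.rpow_add hq]; norm_num
  have h := tsallis_conj_le (v := u / w) (y := x / q) h0 h1
    (by rw [abs_div, abs_of_pos hwp, div_le_iff₀ hwp, hw]; linarith) (by positivity)
  have h' := mul_le_mul_of_nonneg_left h (show 0 ≤ β * q ^ α by positivity)
  rw [Real.div_rpow hx hq.le] at h'
  have e1 : β * q ^ α * (u / w * (1 - x / q) - ((1 - x ^ α / q ^ α) / α + x / q - 1))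
      = u * (q - x) - β * ((q ^ α - x ^ α) / α + q ^ (α - 1) * (x - q)) := by
    have hp : 0 < q ^ α := by positivity
    have hp' : 0 < q ^ (α - 1) := by positivity
    rw [hw]
    have : q ^ (α - 1) * (x - q) = q ^ α * (x / q - 1) := by
      rw [← hqα]; field_simp
    rw [this]
    have h3 : u / (β * q ^ (α - 1)) = u * q / (β * q ^ α) := by
      rw [← hqα]; field_simp
    rw [h3]
    field_simp
    ring
  have e2 : β * q ^ α * (2 * (u / w) ^ 2 / (1 - α))
      = 2 / (β * (1 - α)) * (u ^ 2 * q ^ (2 - α)) := by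
    have hp' : 0 < q ^ (α - 1) := by positivity
    have : q ^ α = q ^ (2 - α) * (q ^ (α - 1)) ^ 2 := by
      rw [pow_two, ← mul_assoc, hq2, mul_comm, hqα]
    rw [hw, this]
    field_simp
  rw [e1, e2] at h'
  exact h'

theorem rpow_sum_le {ι : Type*} {s : Finset ι} {f : ι → ℝ} {α : ℝ} (hf : ∀ i ∈ s, 0 < f i)
    (h1 : α ≤ 1) (h0 : 0 < α) : (∑ i ∈ s, f i) ^ α ≤ ∑ i ∈ s, f i ^ α := by
  rcases s.eq_empty_or_nonempty with rfl | hs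
  · simp [Real.zero_rpow h0.ne']
  have hS : 0 < ∑ i ∈ s, f i := Finset.sum_pos hf hs
  have : (∑ i ∈ s, f i) ^ α = ∑ i ∈ s, f i * (∑ i ∈ s, f i) ^ (α - 1) := by
    rw [← Finset.sum_mul, mul_comm, Real.rpow_sub_one hS.ne']; field_simp
  rw [this]
  refine Finset.sum_le_sum fun i hi => ?_
  have hi0 := hf i hi
  have e : f i ^ α = f i * f i ^ (α - 1) := by
    rw [Real.rpow_sub_one hi0.ne']; field_simp
  rw [e]
  refine mul_le_mul_of_nonneg_left ?_ hi0.le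
  exact Real.rpow_le_rpow_of_nonpos hi0
    (Finset.single_le_sum (fun j hj => (hf j hj).le) hi) (by linarith)

theorem sum_rpow_two_sub_le {ι : Type*} {s : Finset ι} {f : ι → ℝ} {α : ℝ}
    (hf : ∀ i ∈ s, 0 < f i) (h1 : α ≤ 1) (hs : s.Nonempty) :
    ∑ i ∈ s, f i ^ (2 - α) ≤ (∑ i ∈ s, f i) ^ (2 - α) := by
  have hS : 0 < ∑ i ∈ s, f i := Finset.sum_pos hf hs
  have key : ∀ y : ℝ, 0 < y → y ^ (2 - α) = y * y ^ (1 - α) := fun y hy => by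
    rw [show (2 - α) = 1 + (1 - α) by ring, Real.rpow_add hy, Real.rpow_one]
  rw [key _ hS, Finset.sum_mul]
  refine Finset.sum_le_sum fun i hi => ?_
  rw [key _ (hf i hi)]
  refine mul_le_mul_of_nonneg_left ?_ (hf i hi).le
  exact Real.rpow_le_rpow (hf i hi).le
    (Finset.single_le_sum (fun j hj => (hf j hj).le) hi) (by linarith)

/-! ### The truncated weights `min (q a) (qStar q)` -/

section
variable {q : Fin K → ℝ} {m : Fin K}

theorem sum_erase_simplex (hq : q ∈ stdSimplex ℝ (Fin K)) (a : Fin K) :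
    ∑ b ∈ Finset.univ.erase a, q b = 1 - q a := by
  have := Finset.add_sum_erase Finset.univ q (Finset.mem_univ a)
  rw [hq.2] at this
  linarith

theorem simplex_add_le_one (hq : q ∈ stdSimplex ℝ (Fin K)) {a b : Fin K} (hab : a ≠ b) :
    q a + q b ≤ 1 := by
  have := sum_erase_simplex hq b
  have h2 := Finset.single_le_sum (f := q) (fun c _ => hq.1 c)
    (Finset.mem_erase.mpr ⟨hab, Finset.mem_univ a⟩)
  linarith

theorem simplex_le_one (hq : q ∈ stdSimplex ℝ (Fin K)) (a : Fin K) : q a ≤ 1 := by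
  rw [← hq.2]
  exact Finset.single_le_sum (fun a _ => hq.1 a) (Finset.mem_univ a)

theorem qStar_eq (hq : q ∈ stdSimplex ℝ (Fin K)) (hm : ∀ a, q a ≤ q m) :
    qStar q = min (q m) (1 - q m) := by
  rw [qStar, norm_eq_of_argmax hq hm]

theorem le_qStar_of_ne (hq : q ∈ stdSimplex ℝ (Fin K)) (hm : ∀ a, q a ≤ q m) {a : Fin K}
    (ha : a ≠ m) : q a ≤ qStar q := by
  rw [qStar_eq hq hm]
  exact le_min (hm a) (by linarith [simplex_add_le_one hq ha])

theorem min_qStar_of_ne (hq : q ∈ stdSimplex ℝ (Fin K)) (hm : ∀ a, q a ≤ q m) {a : Fin K}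
    (ha : a ≠ m) : min (q a) (qStar q) = q a :=
  min_eq_left (le_qStar_of_ne hq hm ha)

theorem min_qStar_argmax (hq : q ∈ stdSimplex ℝ (Fin K)) (hm : ∀ a, q a ≤ q m) :
    min (q m) (qStar q) = qStar q := by
  rw [qStar_eq hq hm]
  exact min_eq_right (min_le_left _ _)

theorem exists_ne_of_two_le (hK : 2 ≤ K) (m : Fin K) : ∃ a, a ≠ m := by
  have : Nontrivial (Fin K) := Fin.nontrivial_iff_two_le.mpr hK
  exact exists_ne m

theorem qStar_pos (hK : 2 ≤ K) (hq : q ∈ stdSimplex ℝ (Fin K)) (hm : ∀ a, q a ≤ q m)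
    (hpos : ∀ a, 0 < q a) : 0 < qStar q := by
  obtain ⟨a, ha⟩ := exists_ne_of_two_le hK m
  exact (hpos a).trans_le (le_qStar_of_ne hq hm ha)

theorem qStar_le_half (hq : q ∈ stdSimplex ℝ (Fin K)) (hm : ∀ a, q a ≤ q m) :
    qStar q ≤ 1 / 2 := by
  rw [qStar_eq hq hm]
  rcases le_total (q m) (1 / 2) with h | h
  · exact (min_le_left _ _).trans h
  · exact (min_le_right _ _).trans (by linarith)

/-- Stability of one FTRL step, with the shift by the coordinate of the most likely arm. -/
theorem stability_simplex {α β : ℝ} {g x : Fin K → ℝ} (hK : 2 ≤ K) (h0 : 1 / 2 ≤ α) (h1 : α < 1)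
    (hβ : 0 < β) (hq : q ∈ stdSimplex ℝ (Fin K)) (hm : ∀ a, q a ≤ q m) (hpos : ∀ a, 0 < q a)
    (hg : ∀ a, |g a| ≤ (1 - α) * min (q a) (qStar q) ^ (α - 1) * β / 4)
    (hx : x ∈ stdSimplex ℝ (Fin K)) :
    ∑ a, g a * (q a - x a) - β * breg α x q
      ≤ 4 / (β * (1 - α)) * ∑ a, g a ^ 2 * min (q a) (qStar q) ^ (2 - α) := by
  have hα : 0 < α := by linarith
  have hc : 0 < 1 - α := by linarith
  have hqs := qStar_pos hK hq hm hpos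
  have hcoef : 0 < 2 / (β * (1 - α)) := by positivity
  -- If no arm has mass `1/2`, truncation changes nothing and the coordinatewise bound is enough.
  -- Otherwise the dominant arm must be treated through its complement `1 - q m`.
  rcases lt_or_ge (q m) (1 / 2) with hlt | hge
  · have htq : ∀ a, min (q a) (qStar q) = q a := fun a => by
      refine min_eq_left ?_
      rw [qStar_eq hq hm]
      exact le_min (hm a) (by linarith [hm a])
    simp only [htq] at hg ⊢
    have hsum : ∑ a, g a * (q a - x a) - β * breg α x q
        ≤ ∑ a, 2 / (β * (1 - α)) * (g a ^ 2 * q a ^ (2 - α)) := by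
      rw [breg, Finset.mul_sum, ← Finset.sum_sub_distrib]
      refine Finset.sum_le_sum fun a _ => stability_coord h0 h1 hβ (hpos a) (hx.1 a) ?_
      refine (hg a).trans ?_
      have := hpos a
      have : 0 ≤ (1 - α) * q a ^ (α - 1) * β := by positivity
      linarith
    refine hsum.trans ?_
    rw [← Finset.mul_sum]
    refine mul_le_mul_of_nonneg_right ?_ ?_
    · gcongr; norm_num
    · exact Finset.sum_nonneg fun a _ => by have := hpos a; positivity
  · have hstar : qStar q = 1 - q m := by
      rw [qStar_eq hq hm]; exact min_eq_right (by linarith)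
    -- Adding a constant to the losses is harmless because `q - x` sums to zero. This removes the
    -- loss of the dominant arm. The price is a doubled range, allowed by the `β / 4` in the
    -- hypothesis, and a factor 2 from `(g a - g m) ^ 2 ≤ 2 * g a ^ 2 + 2 * g m ^ 2`.
    have hshift : ∑ a, g a * (q a - x a) = ∑ a, (g a - g m) * (q a - x a) := by
      simp only [sub_mul, Finset.sum_sub_distrib, ← Finset.mul_sum, hq.2, hx.2]
      ring
    have hne : (Finset.univ.erase m).Nonempty := by
      obtain ⟨a, ha⟩ := exists_ne_of_two_le hK m
      exact ⟨a, Finset.mem_erase.mpr ⟨ha, Finset.mem_univ a⟩⟩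
    have hsum : ∑ a, g a * (q a - x a) - β * breg α x q
        ≤ ∑ a ∈ Finset.univ.erase m, 2 / (β * (1 - α)) * ((g a - g m) ^ 2 * q a ^ (2 - α)) := by
      rw [hshift, breg, Finset.mul_sum, ← Finset.sum_sub_distrib,
        ← Finset.add_sum_erase _ _ (Finset.mem_univ m)]
      have hterm := mul_nonneg hβ.le (breg_term_nonneg hα h1 (hx.1 m) (hpos m))
      have : ∀ A B C : ℝ, 0 ≤ B → A ≤ C → (g m - g m) * (q m - x m) - B + A ≤ C := by
        intro A B C hB hA; rw [sub_self, zero_mul]; linarith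
      refine this _ _ _ hterm (Finset.sum_le_sum fun a ha => ?_)
      have ham := (Finset.mem_erase.mp ha).1
      refine stability_coord h0 h1 hβ (hpos a) (hx.1 a) ?_
      have hga := hg a
      have hgm := hg m
      rw [min_qStar_of_ne hq hm ham] at hga
      rw [min_qStar_argmax hq hm] at hgm
      have hmono : qStar q ^ (α - 1) ≤ q a ^ (α - 1) :=
        Real.rpow_le_rpow_of_nonpos (hpos a) (le_qStar_of_ne hq hm ham) (by linarith)
      have h3 : (1 - α) * qStar q ^ (α - 1) * β / 4 ≤ (1 - α) * q a ^ (α - 1) * β / 4 := by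
        gcongr
      have h4 := abs_sub (g a) (g m)
      linarith
    refine hsum.trans ?_
    rw [← Finset.mul_sum]
    have e4 : 4 / (β * (1 - α)) = 2 / (β * (1 - α)) * 2 := by ring
    rw [e4, mul_assoc]
    refine mul_le_mul_of_nonneg_left ?_ hcoef.le
    rw [← Finset.add_sum_erase _ (fun a => g a ^ 2 * min (q a) (qStar q) ^ (2 - α))
      (Finset.mem_univ m), min_qStar_argmax hq hm]
    -- The squares of `g m` appear once per other arm; superadditivity of `y ^ (2 - α)` collapses
    -- them into the single truncated weight of `m`.
    have hb : ∑ a ∈ Finset.univ.erase m, q a ^ (2 - α) ≤ qStar q ^ (2 - α) := by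
      rw [hstar, ← sum_erase_simplex hq m]
      exact sum_rpow_two_sub_le (fun a _ => hpos a) h1.le hne
    have hc2 : ∑ a ∈ Finset.univ.erase m, (g a - g m) ^ 2 * q a ^ (2 - α)
        ≤ ∑ a ∈ Finset.univ.erase m,
          (2 * (g a ^ 2 * min (q a) (qStar q) ^ (2 - α)) + 2 * g m ^ 2 * q a ^ (2 - α)) := by
      refine Finset.sum_le_sum fun a ha => ?_
      rw [min_qStar_of_ne hq hm (Finset.mem_erase.mp ha).1]
      have hp : 0 ≤ q a ^ (2 - α) := by have := hpos a; positivity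
      nlinarith [mul_nonneg hp (sq_nonneg (g a + g m))]
    refine hc2.trans ?_
    rw [Finset.sum_add_distrib, ← Finset.mul_sum, ← Finset.mul_sum]
    have := mul_le_mul_of_nonneg_left hb (show 0 ≤ 2 * g m ^ 2 by positivity)
    linarith

end

/-! ### First-order optimality -/

theorem sum_update_two {f : Fin K → ℝ → ℝ} {q : Fin K → ℝ} {a b : Fin K} (hab : a ≠ b) (u v : ℝ) :
    ∑ c, f c (Function.update (Function.update q a u) b v c)
      = ∑ c, f c (q c) + (f a u - f a (q a)) + (f b v - f b (q b)) := by
  have h : ∀ c, f c (Function.update (Function.update q a u) b v c)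
      = f c (q c) + (if c = a then f a u - f a (q a) else 0)
        + (if c = b then f b v - f b (q b) else 0) := by
    intro c
    rcases eq_or_ne c b with rfl | hb
    · simp [hab.symm]
    · rcases eq_or_ne c a with rfl | ha
      · simp [hb]
      · simp [hb, ha]
  simp [h, Finset.sum_add_distrib]

theorem linObjective_eq_sum (α β : ℝ) (L x : Fin K → ℝ) :
    linObjective α β L x = ∑ a, (L a * x a - β / α * (x a ^ α - x a)) := by
  rw [linObjective, tsallis, Finset.sum_sub_distrib (fun a => L a * x a), ← Finset.mul_sum]
  ring

theorem exchange_nonneg {α β : ℝ} {L q : Fin K → ℝ} (hq : q ∈ stdSimplex ℝ (Fin K))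
    (hmin : IsMinOn (linObjective α β L) (stdSimplex ℝ (Fin K)) q) {a b : Fin K} (hab : a ≠ b)
    {δ : ℝ} (h1 : -q a ≤ δ) (h2 : δ ≤ q b) :
    0 ≤ (L a - L b) * δ - β / α * (((q a + δ) ^ α - q a ^ α) + ((q b - δ) ^ α - q b ^ α)) := by
  set z := Function.update (Function.update q a (q a + δ)) b (q b - δ) with hz
  have hzmem : z ∈ stdSimplex ℝ (Fin K) := by
    refine ⟨fun c => ?_, ?_⟩
    · rcases eq_or_ne c b with rfl | hb
      · simp [hz]; linarith
      · rcases eq_or_ne c a with rfl | ha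
        · simp [hz, hb]; linarith
        · simp [hz, ha, hb, hq.1 c]
    · have := sum_update_two (f := fun _ y => y) (q := q) hab (q a + δ) (q b - δ)
      rw [hz, this, hq.2]; ring
  have h := isMinOn_iff.mp hmin z hzmem
  rw [linObjective_eq_sum, linObjective_eq_sum, hz,
    sum_update_two (f := fun c y => L c * y - β / α * (y ^ α - y)) hab] at h
  linarith

/-- The entropy has infinite slope at zero: moving mass `δ` to an empty arm gains order `δ ^ α`,
while everything else costs only order `δ`. -/
theorem minimizer_pos {α β : ℝ} (h0 : 0 < α) (h1 : α < 1) (hβ : 0 < β) {L q : Fin K → ℝ}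
    (hq : q ∈ stdSimplex ℝ (Fin K))
    (hmin : IsMinOn (linObjective α β L) (stdSimplex ℝ (Fin K)) q) (a : Fin K) : 0 < q a := by
  refine lt_of_le_of_ne (hq.1 a) fun ha0 => ?_
  obtain ⟨b, -, hb⟩ : ∃ b ∈ Finset.univ, q b ≠ 0 := by
    apply Finset.exists_ne_zero_of_sum_ne_zero
    rw [hq.2]; exact one_ne_zero
  have hb : 0 < q b := lt_of_le_of_ne (hq.1 b) hb.symm
  have hab : a ≠ b := by rintro rfl; exact hb.ne ha0
  set N : ℝ := L a - L b + β / α * q b ^ (α - 1) with hN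
  have hB : 0 < (|N| + 1) * α / β := by positivity
  -- Chosen so that for `δ ≤ δ₁` the entropy gain is at least `δ * (|N| + 1)`, strictly more than
  -- the linear cost `δ * N`.
  set δ₁ : ℝ := ((|N| + 1) * α / β) ^ (1 / (α - 1)) with hδ1
  have hδ1p : 0 < δ₁ := by positivity
  have hδ1e : δ₁ ^ (α - 1) = (|N| + 1) * α / β := by
    rw [hδ1, ← Real.rpow_mul hB.le, one_div_mul_cancel (by linarith), Real.rpow_one]
  set δ := min (q b) δ₁ with hδ
  have hδp : 0 < δ := lt_min hb hδ1p
  have hex := exchange_nonneg hq hmin hab (δ := δ) (by linarith) (min_le_left _ _)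
  rw [← ha0, zero_add, Real.zero_rpow h0.ne', sub_zero] at hex
  have hbδ : q b ^ α - δ * q b ^ (α - 1) ≤ (q b - δ) ^ α := by
    have hx0 : 0 ≤ 1 - δ / q b := by
      rw [sub_nonneg, div_le_one hb]; exact min_le_left _ _
    have hx1 : 1 - δ / q b ≤ 1 := by have : 0 ≤ δ / q b := by positivity
                                     linarith
    have h3 : 1 - δ / q b ≤ (1 - δ / q b) ^ α := by
      rcases hx0.eq_or_lt with h | h
      · rw [← h]; exact Real.rpow_nonneg le_rfl _
      · simpa using Real.rpow_le_rpow_of_exponent_ge h hx1 h1.le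
    have h4 : q b - δ = q b * (1 - δ / q b) := by field_simp
    rw [h4, Real.mul_rpow hb.le hx0]
    have h5 : q b ^ α - δ * q b ^ (α - 1) = q b ^ α * (1 - δ / q b) := by
      rw [Real.rpow_sub_one hb.ne']; field_simp
    rw [h5]
    gcongr
  have hδα : (|N| + 1) * α / β ≤ δ ^ (α - 1) := by
    rw [← hδ1e]
    exact Real.rpow_le_rpow_of_nonpos hδp (min_le_right _ _) (by linarith)
  have hδα2 : δ ^ α = δ * δ ^ (α - 1) := by rw [Real.rpow_sub_one hδp.ne']; field_simp
  have h6 : δ * (|N| + 1) ≤ β / α * δ ^ α := by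
    have : δ * (|N| + 1) = β / α * (δ * ((|N| + 1) * α / β)) := by field_simp
    rw [this, hδα2]
    gcongr
  have h7 := mul_le_mul_of_nonneg_left hbδ (show 0 ≤ β / α by positivity)
  have h8 : δ * N ≤ δ * |N| := mul_le_mul_of_nonneg_left (le_abs_self N) hδp.le
  have h9 : δ * N = (L a - L b) * δ + β / α * (δ * q b ^ (α - 1)) := by rw [hN]; ring
  linarith

/-- Stationarity under exchange of mass between two arms. Positivity of both makes `δ = 0` an
interior point of the admissible range, so the derivative vanishes there. -/
theorem minimizer_gradient_eq {α β : ℝ} (h0 : 0 < α) (h1 : α < 1) (hβ : 0 < β)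
    {L q : Fin K → ℝ} (hq : q ∈ stdSimplex ℝ (Fin K))
    (hmin : IsMinOn (linObjective α β L) (stdSimplex ℝ (Fin K)) q) (a b : Fin K) :
    L a - β * q a ^ (α - 1) = L b - β * q b ^ (α - 1) := by
  rcases eq_or_ne a b with rfl | hab
  · rfl
  have ha := minimizer_pos h0 h1 hβ hq hmin a
  have hb := minimizer_pos h0 h1 hβ hq hmin b
  set φ : ℝ → ℝ := fun δ =>
    (L a - L b) * δ - β / α * (((q a + δ) ^ α - q a ^ α) + ((q b - δ) ^ α - q b ^ α)) with hφ
  have hloc : IsLocalMin φ 0 := by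
    have : Set.Ioo (-q a) (q b) ∈ nhds (0 : ℝ) := Ioo_mem_nhds (by linarith) hb
    filter_upwards [this] with δ hδ
    have h2 : φ 0 = 0 := by simp [hφ]
    rw [h2]
    exact exchange_nonneg hq hmin hab hδ.1.le hδ.2.le
  have d1 : HasDerivAt (fun δ : ℝ => (q a + δ) ^ α) (1 * α * (q a + 0) ^ (α - 1)) 0 :=
    ((hasDerivAt_id (0 : ℝ)).const_add (q a)).rpow_const (Or.inl (by simpa using ha.ne'))
  have d2 : HasDerivAt (fun δ : ℝ => (q b - δ) ^ α) (-1 * α * (q b - 0) ^ (α - 1)) 0 :=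
    ((hasDerivAt_id (0 : ℝ)).const_sub (q b)).rpow_const (Or.inl (by simpa using hb.ne'))
  have d3 : HasDerivAt φ ((L a - L b) * 1
      - β / α * ((1 * α * (q a + 0) ^ (α - 1)) + (-1 * α * (q b - 0) ^ (α - 1)))) 0 :=
    ((hasDerivAt_id (0 : ℝ)).const_mul (L a - L b)).sub
      (((d1.sub_const _).add (d2.sub_const _)).const_mul _)
  have h2 := hloc.hasDerivAt_eq_zero d3
  have h3 : (L a - L b) * 1
      - β / α * ((1 * α * (q a + 0) ^ (α - 1)) + (-1 * α * (q b - 0) ^ (α - 1)))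
      = (L a - β * q a ^ (α - 1)) - (L b - β * q b ^ (α - 1)) := by
    rw [add_zero, sub_zero]; field_simp; ring
  linarith

/-- At the minimizer the gradient is constant across arms, so its linear part vanishes on
differences of simplex points and only the Bregman divergence remains. The identity is exact. -/
theorem linObjective_sub_minimizer {α β : ℝ} (h0 : 0 < α) (h1 : α < 1) (hβ : 0 < β)
    {L q x : Fin K → ℝ} (hK : 1 ≤ K) (hq : q ∈ stdSimplex ℝ (Fin K))
    (hmin : IsMinOn (linObjective α β L) (stdSimplex ℝ (Fin K)) q)
    (hx : x ∈ stdSimplex ℝ (Fin K)) :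
    linObjective α β L x = linObjective α β L q + β * breg α x q := by
  set b : Fin K := ⟨0, hK⟩
  set lam : ℝ := L b - β * q b ^ (α - 1) with hlam
  have hg : ∀ a, L a = lam + β * q a ^ (α - 1) := fun a => by
    have := minimizer_gradient_eq h0 h1 hβ hq hmin a b
    linarith
  have key : ∀ a, (L a * x a - β / α * (x a ^ α - x a))
      = (L a * q a - β / α * (q a ^ α - q a))
        + β * ((q a ^ α - x a ^ α) / α + q a ^ (α - 1) * (x a - q a))
        + (lam + β / α) * (x a - q a) := by
    intro a
    rw [hg a]
    ring
  rw [linObjective_eq_sum, linObjective_eq_sum, breg, Finset.mul_sum, ← Finset.sum_add_distrib,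
    Finset.sum_congr rfl fun a _ => key a, Finset.sum_add_distrib (g := fun a => _ * (x a - q a)),
    ← Finset.mul_sum, Finset.sum_sub_distrib, hx.2, hq.2]
  ring

/-- Iterates of an FTRL run are bounded away from zero in terms of the cumulative losses. -/
theorem minimizer_rpow_le {α β R : ℝ} (h0 : 0 < α) (h1 : α < 1) (hβ : 0 < β)
    {L q : Fin K → ℝ} (hq : q ∈ stdSimplex ℝ (Fin K))
    (hmin : IsMinOn (linObjective α β L) (stdSimplex ℝ (Fin K)) q) (hL : ∀ a, |L a| ≤ R)
    (hK : 1 ≤ K) (a : Fin K) :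
    q a ^ (α - 1) ≤ 2 * R / β + (1 / (K : ℝ)) ^ (α - 1) := by
  obtain ⟨m, hm⟩ := exists_argmax hK q
  have hK' : (0 : ℝ) < K := by exact_mod_cast hK
  have hmK : 1 / (K : ℝ) ≤ q m := by
    rw [div_le_iff₀ hK', ← hq.2]
    calc ∑ a, q a ≤ ∑ _a : Fin K, q m := Finset.sum_le_sum fun a _ => hm a
      _ = q m * K := by simp [mul_comm]
  have h2 : q m ^ (α - 1) ≤ (1 / (K : ℝ)) ^ (α - 1) :=
    Real.rpow_le_rpow_of_nonpos (by positivity) hmK (by linarith)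
  have h3 := minimizer_gradient_eq h0 h1 hβ hq hmin a m
  have h4 := abs_le.mp (hL a)
  have h5 := abs_le.mp (hL m)
  have h6 : q a ^ (α - 1) = (L a - L m) / β + q m ^ (α - 1) := by
    field_simp; linarith
  rw [h6]
  gcongr
  linarith

/-! ### The regret of FTRL -/

/-- Regret of FTRL with increasing inverse learning rates along a fixed sequence of losses. -/
theorem ftrl_regret {α : ℝ} (h0 : 0 < α) (h1 : α < 1) (hK : 1 ≤ K) {β : ℕ → ℝ}
    (hβ : ∀ t, 0 < β t) {g q : ℕ → Fin K → ℝ} {S : ℕ → ℝ} (T : ℕ)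
    (hq : ∀ t ≤ T, q t ∈ stdSimplex ℝ (Fin K))
    (hmin : ∀ t ≤ T, IsMinOn (linObjective α (β t) (fun a => ∑ s ∈ Finset.range t, g s a))
      (stdSimplex ℝ (Fin K)) (q t))
    (hS : ∀ t ≤ T, ∀ x ∈ stdSimplex ℝ (Fin K),
      ∑ a, g t a * (q t a - x a) - β t * breg α x (q t) ≤ S t) (a₀ : Fin K) :
    ∑ t ∈ Finset.range (T + 1), (∑ a, g t a * q t a - g t a₀)
      ≤ β 0 * -tsallis α (q 0)
        + ∑ t ∈ Finset.range T, (β (t + 1) - β t) * -tsallis α (q (t + 1))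
        + ∑ t ∈ Finset.range (T + 1), S t := by
  set L : ℕ → Fin K → ℝ := fun t a => ∑ s ∈ Finset.range t, g s a with hL
  -- With the learning rate frozen, adding one loss raises the minimal value by at least the loss of
  -- `q t` minus `S t`. The change of rate is booked separately in `hind`.
  have hstep : ∀ t ≤ T, ∀ x ∈ stdSimplex ℝ (Fin K),
      linObjective α (β t) (L t) (q t) + ∑ a, g t a * q t a - S t
        ≤ linObjective α (β t) (L (t + 1)) x := by
    intro t ht x hx
    have e1 := linObjective_sub_minimizer h0 h1 (hβ t) hK (hq t ht) (hmin t ht) hx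
    have e2 := hS t ht x hx
    have e3 : linObjective α (β t) (L (t + 1)) x
        = linObjective α (β t) (L t) x + ∑ a, g t a * x a := by
      simp only [linObjective, hL, Finset.sum_range_succ, add_mul, Finset.sum_add_distrib]
      ring
    simp only [mul_sub, Finset.sum_sub_distrib] at e2
    change linObjective α (β t) (L t) x = linObjective α (β t) (L t) (q t) + _ at e1
    linarith
  have hind : ∀ n ≤ T, ∑ t ∈ Finset.range n, (∑ a, g t a * q t a) - β 0 * -tsallis α (q 0)
        - ∑ t ∈ Finset.range n, (β (t + 1) - β t) * -tsallis α (q (t + 1))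
        - ∑ t ∈ Finset.range n, S t ≤ linObjective α (β n) (L n) (q n) := by
    intro n
    induction n with
    | zero => intro _; simp [linObjective, hL]
    | succ n ih =>
      intro hn
      have h3 := ih (by omega)
      have h4 := hstep n (by omega) (q (n + 1)) (hq _ hn)
      have h5 : linObjective α (β (n + 1)) (L (n + 1)) (q (n + 1))
          = linObjective α (β n) (L (n + 1)) (q (n + 1))
            + (β (n + 1) - β n) * tsallis α (q (n + 1)) := by
        simp only [linObjective]; ring
      simp only [Finset.sum_range_succ]
      linarith
  have h3 := hind T le_rfl
  -- The comparator is used with the last rate `β T`; its entropy vanishes at a vertex, so no final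
  -- penalty appears and no rate beyond round `T` is needed.
  have h4 := hstep T le_rfl _ (single_mem_stdSimplex ℝ a₀)
  have h5 : linObjective α (β T) (L (T + 1)) (Pi.single a₀ 1)
      = ∑ t ∈ Finset.range (T + 1), g t a₀ := by
    have h6 : tsallis α (Pi.single a₀ (1 : ℝ)) = 0 := by
      rw [tsallis, Finset.sum_eq_zero, mul_zero]
      intro a _
      rcases eq_or_ne a a₀ with rfl | ha
      · simp
      · simp [ha, Real.zero_rpow h0.ne']
    rw [linObjective, h6, mul_zero, add_zero, Finset.sum_eq_single a₀]
    · simp [hL]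
    · intro b _ hb; simp [hb]
    · simp
  rw [h5] at h4
  rw [Finset.sum_sub_distrib]
  simp only [Finset.sum_range_succ] at h3 h4 ⊢
  linarith

/-! ### One round of the algorithm -/

/-- A point in the interior of the simplex, together with a largest coordinate. -/
structure InteriorPoint (q : Fin K → ℝ) (m : Fin K) : Prop where
  two_le : 2 ≤ K
  mem : q ∈ stdSimplex ℝ (Fin K)
  argmax : ∀ a, q a ≤ q m
  pos : ∀ a, 0 < q a

/-- The shifted loss estimate fed to FTRL. -/
def shiftedEstimate (ε σ : ℝ) (t : ℕ) (q : Fin K → ℝ) (m : Fin K) (o : Obs K) (b : Fin K) : ℝ :=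
  clippedEstimate (1 / ε) ε σ t q m o b - bonus (1 / ε) ε σ t q m b

/-- The bound on the stability of the FTRL step. -/
def stabilityTerm (ε σ : ℝ) (t : ℕ) (q : Fin K → ℝ) (m : Fin K) (o : Obs K) : ℝ :=
  4 / (invRate K ε σ t * (1 - 1 / ε)) *
    ∑ b, shiftedEstimate ε σ t q m o b ^ 2 * min (q b) (qStar q) ^ (2 - 1 / ε)

/-- The part of the instantaneous regret against `a₀` that is not controlled by the regret of
FTRL on the shifted estimates, plus the stability term. -/
def roundGap (ε σ : ℝ) (t : ℕ) (q : Fin K → ℝ) (m a₀ : Fin K) (ℓ : Fin K → ℝ) (a : Fin K) : ℝ :=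
  ℓ a - ℓ a₀ - (∑ b, shiftedEstimate ε σ t q m (a, ℓ a) b * q b
    - shiftedEstimate ε σ t q m (a, ℓ a) a₀) + stabilityTerm ε σ t q m (a, ℓ a)

/-- The indicator of the arm `a₀`. -/
def vertex (a₀ b : Fin K) : ℝ := if b = a₀ then 1 else 0

/-- The contribution of arm `b` to the bound on the conditional expectation of `roundGap`, where
`v` stands for the normalized moment `|ℓ b| ^ ε / σ`. -/
def armBound (ε σ : ℝ) (t : ℕ) (q : Fin K → ℝ) (m a₀ b : Fin K) (v : ℝ) : ℝ :=
  exploration (1 / ε) ε σ t q m * (1 / K + q b) * σ ^ (1 / ε) * (1 + v)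
    + |q b - vertex a₀ b| * bonus (1 / ε) ε σ t q m b * v
    + (q b - vertex a₀ b) * bonus (1 / ε) ε σ t q m b
    + min (q b) (qStar q) * bonus (1 / ε) ε σ t q m b * (v + 1)

section
variable {ε σ : ℝ} {t : ℕ} {q : Fin K → ℝ} {m : Fin K}

theorem one_sub_inv_pos (h1 : 1 < ε) : 0 < 1 - 1 / ε := by
  rw [sub_pos, div_lt_one (by linarith)]; exact h1

theorem min_qStar_pos (hi : InteriorPoint q m) (a : Fin K) : 0 < min (q a) (qStar q) :=
  lt_min (hi.pos a) (qStar_pos hi.two_le hi.mem hi.argmax hi.pos)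

theorem clipLevel_pos (h1 : 1 < ε) (hσ : 0 < σ) (hi : InteriorPoint q m) (a : Fin K) :
    0 < clipLevel (1 / ε) ε σ t q a := by
  unfold clipLevel
  have := min_qStar_pos hi a
  have := one_sub_inv_pos h1
  have := invRate_pos (K := K) (ε := ε) hσ t
  positivity

/-- The most likely arm has the largest truncated weight, namely `qStar q`, and the threshold
decreases in that weight. Hence an exploration strength tuned to `m` is adequate for all arms. -/
theorem clipLevel_argmax_le (h1 : 1 < ε) (hσ : 0 < σ) (hi : InteriorPoint q m) (a : Fin K) :
    clipLevel (1 / ε) ε σ t q m ≤ clipLevel (1 / ε) ε σ t q a := by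
  unfold clipLevel
  rw [min_qStar_argmax hi.mem hi.argmax]
  have h2 := one_sub_inv_pos h1
  have h3 := invRate_pos (K := K) (ε := ε) hσ t
  have h4 := min_qStar_pos hi a
  have : qStar q ^ (1 / ε - 1) ≤ min (q a) (qStar q) ^ (1 / ε - 1) :=
    Real.rpow_le_rpow_of_nonpos h4 (min_le_right _ _) (by linarith)
  gcongr

theorem exploration_bounds (h1 : 1 < ε) (hσ : 0 < σ) (hi : InteriorPoint q m) :
    0 ≤ exploration (1 / ε) ε σ t q m ∧ exploration (1 / ε) ε σ t q m ≤ 1 / 2 :=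
  exploration_mem (by have := hi.two_le; omega) h1 hσ hi.mem hi.argmax

theorem half_le_samplingDist (h1 : 1 < ε) (hσ : 0 < σ) (hi : InteriorPoint q m) (a : Fin K) :
    q a / 2 ≤ samplingDist (1 / ε) ε σ t q m a := by
  obtain ⟨g0, g1⟩ := exploration_bounds (t := t) h1 hσ hi
  have h2 := hi.pos a
  unfold samplingDist
  have : 0 ≤ exploration (1 / ε) ε σ t q m * (1 / K) := by positivity
  nlinarith

theorem samplingDist_pos (h1 : 1 < ε) (hσ : 0 < σ) (hi : InteriorPoint q m) (a : Fin K) :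
    0 < samplingDist (1 / ε) ε σ t q m a :=
  (half_pos (hi.pos a)).trans_le (half_le_samplingDist h1 hσ hi a)

theorem sum_samplingDist (hi : InteriorPoint q m) : ∑ a, samplingDist (1 / ε) ε σ t q m a = 1 := by
  have hKr : (0 : ℝ) < K := by have := hi.two_le; exact_mod_cast (by omega : 0 < K)
  simp only [samplingDist, Finset.sum_add_distrib, ← Finset.mul_sum, hi.mem.2]
  simp
  field_simp
  ring

theorem bonus_nonneg (h1 : 1 < ε) (hσ : 0 < σ) (hi : InteriorPoint q m) (a : Fin K) :
    0 ≤ bonus (1 / ε) ε σ t q m a := by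
  unfold bonus
  have := samplingDist_pos (t := t) h1 hσ hi a
  have := clipLevel_pos (t := t) h1 hσ hi a
  positivity

/-- This is the purpose of exploration: `p a` is at least `γ / K = σ ^ (1/(ε-1)) * s_m ^ (ε/(1-ε))`,
which gives `σ * p a ^ (1-ε) ≤ s_m ^ ε ≤ s_a ^ ε`. Multiplying by `s_a ^ (1-ε)` leaves `s_a`. -/
theorem bonus_le_clipLevel (h1 : 1 < ε) (hσ : 0 < σ) (hi : InteriorPoint q m) (a : Fin K) :
    bonus (1 / ε) ε σ t q m a ≤ clipLevel (1 / ε) ε σ t q a := by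
  have hsm := clipLevel_pos (t := t) h1 hσ hi m
  have hsa := clipLevel_pos (t := t) h1 hσ hi a
  have hle := clipLevel_argmax_le (t := t) h1 hσ hi a
  have hKr : (0 : ℝ) < K := by have := hi.two_le; exact_mod_cast (by omega : 0 < K)
  have hne : ε - 1 ≠ 0 := by linarith
  have hne' : 1 - ε ≠ 0 := by linarith
  set y : ℝ := σ ^ (1 / (ε - 1)) * clipLevel (1 / ε) ε σ t q m ^ (ε / (1 - ε)) with hy
  have hyp : 0 < y := by positivity
  have hp : y ≤ samplingDist (1 / ε) ε σ t q m a := by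
    obtain ⟨g0, g1⟩ := exploration_bounds (t := t) h1 hσ hi
    have h2 := hi.pos a
    have e : exploration (1 / ε) ε σ t q m * (1 / K) = y := by
      unfold exploration; rw [hy]; field_simp
    unfold samplingDist
    rw [e]
    nlinarith
  have h3 : samplingDist (1 / ε) ε σ t q m a ^ (1 - ε) ≤ σ⁻¹ * clipLevel (1 / ε) ε σ t q m ^ ε := by
    refine (Real.rpow_le_rpow_of_nonpos hyp hp (by linarith)).trans (le_of_eq ?_)
    rw [hy, Real.mul_rpow (by positivity) (by positivity), ← Real.rpow_mul hσ.le,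
      ← Real.rpow_mul hsm.le, div_mul_cancel₀ _ hne']
    have : 1 / (ε - 1) * (1 - ε) = -1 := by field_simp; ring
    rw [this, Real.rpow_neg_one]
  have h4 : clipLevel (1 / ε) ε σ t q m ^ ε ≤ clipLevel (1 / ε) ε σ t q a ^ ε :=
    Real.rpow_le_rpow hsm.le hle (by linarith)
  unfold bonus
  calc _ ≤ σ * (σ⁻¹ * clipLevel (1 / ε) ε σ t q a ^ ε) * clipLevel (1 / ε) ε σ t q a ^ (1 - ε) := by
        gcongr
        exact h3.trans (by gcongr)
    _ = clipLevel (1 / ε) ε σ t q a ^ ε * clipLevel (1 / ε) ε σ t q a ^ (1 - ε) := by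
        field_simp
    _ = clipLevel (1 / ε) ε σ t q a := by
        rw [← Real.rpow_add hsa]; norm_num

theorem abs_clippedEstimate_le (h1 : 1 < ε) (hσ : 0 < σ) (hi : InteriorPoint q m) (o : Obs K)
    (a : Fin K) : |clippedEstimate (1 / ε) ε σ t q m o a| ≤ clipLevel (1 / ε) ε σ t q a := by
  unfold clippedEstimate
  split_ifs with h
  · exact h
  · simpa using (clipLevel_pos h1 hσ hi a).le

theorem abs_shiftedEstimate_le (h1 : 1 < ε) (hσ : 0 < σ) (hi : InteriorPoint q m) (o : Obs K)
    (a : Fin K) : |shiftedEstimate ε σ t q m o a| ≤ 2 * clipLevel (1 / ε) ε σ t q a := by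
  have h2 := abs_clippedEstimate_le (t := t) h1 hσ hi o a
  have h3 := bonus_le_clipLevel (t := t) h1 hσ hi a
  have h4 := bonus_nonneg (t := t) h1 hσ hi a
  unfold shiftedEstimate
  have := abs_sub (clippedEstimate (1 / ε) ε σ t q m o a) (bonus (1 / ε) ε σ t q m a)
  rw [abs_of_nonneg h4] at this
  linarith

/-- Estimate and bonus are each at most the threshold, so the shifted estimate is at most twice it.
The `8` in the threshold then yields exactly the `4` required by `stability_simplex`. -/
theorem stability_round (h1 : 1 < ε) (h2 : ε ≤ 2) (hσ : 0 < σ) (hi : InteriorPoint q m)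
    (o : Obs K) {x : Fin K → ℝ} (hx : x ∈ stdSimplex ℝ (Fin K)) :
    ∑ a, shiftedEstimate ε σ t q m o a * (q a - x a) - invRate K ε σ t * breg (1 / ε) x q
      ≤ stabilityTerm ε σ t q m o := by
  refine stability_simplex hi.two_le ?_ ?_ (invRate_pos hσ t) hi.mem hi.argmax hi.pos ?_ hx
  · exact one_div_le_one_div_of_le (by linarith) h2
  · linarith [one_sub_inv_pos h1]
  · intro a
    have := abs_shiftedEstimate_le (t := t) h1 hσ hi o a
    unfold clipLevel at this
    linarith

/-! ### Bias and second moment of the clipped estimates -/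

/-- The value of the clipped estimate of arm `b` when `b` is played. -/
def playedEstimate (ε σ : ℝ) (t : ℕ) (q : Fin K → ℝ) (m : Fin K) (ℓ : Fin K → ℝ) (b : Fin K) : ℝ :=
  clippedEstimate (1 / ε) ε σ t q m (b, ℓ b) b

theorem clippedEstimate_eq_ite (ℓ : Fin K → ℝ)
    (a b : Fin K) : clippedEstimate (1 / ε) ε σ t q m (a, ℓ a) b
      = if a = b then playedEstimate ε σ t q m ℓ b else 0 := by
  split_ifs with h
  · subst h; rfl
  · unfold clippedEstimate iwEstimate
    simp [h]

/-- There is an error only when clipping occurs, and then `|ℓ b| > s * p`. Writing `|ℓ b| = |ℓ b| ^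
ε * |ℓ b| ^ (1-ε)` and bounding the negative power by `(s * p) ^ (1-ε)` produces the bonus. -/
theorem abs_sub_playedEstimate_le (h1 : 1 < ε) (hσ : 0 < σ) (hi : InteriorPoint q m)
    (ℓ : Fin K → ℝ) (b : Fin K) :
    |ℓ b - samplingDist (1 / ε) ε σ t q m b * playedEstimate ε σ t q m ℓ b|
      ≤ |ℓ b| ^ ε / σ * bonus (1 / ε) ε σ t q m b := by
  have hp := samplingDist_pos (t := t) h1 hσ hi b
  have hs := clipLevel_pos (t := t) h1 hσ hi b
  have hb := bonus_nonneg (t := t) h1 hσ hi b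
  unfold playedEstimate clippedEstimate iwEstimate
  simp only [if_true]
  split_ifs with h
  · rw [mul_div_cancel₀ _ hp.ne', sub_self, abs_zero]
    positivity
  · rw [mul_zero, sub_zero]
    rw [not_le, abs_div, abs_of_pos hp, lt_div_iff₀ hp] at h
    have hl : 0 < |ℓ b| := lt_trans (by positivity) h
    have h3 : |ℓ b| = |ℓ b| ^ ε * |ℓ b| ^ (1 - ε) := by
      rw [← Real.rpow_add hl]; norm_num
    have h4 : |ℓ b| ^ (1 - ε) ≤
        (clipLevel (1 / ε) ε σ t q b * samplingDist (1 / ε) ε σ t q m b) ^ (1 - ε) :=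
      Real.rpow_le_rpow_of_nonpos (by positivity) h.le (by linarith)
    rw [Real.mul_rpow hs.le hp.le] at h4
    calc |ℓ b| = |ℓ b| ^ ε * |ℓ b| ^ (1 - ε) := h3
      _ ≤ |ℓ b| ^ ε * (clipLevel (1 / ε) ε σ t q b ^ (1 - ε)
            * samplingDist (1 / ε) ε σ t q m b ^ (1 - ε)) := by gcongr
      _ = _ := by unfold bonus; field_simp

/-- The estimate is nonzero only if `|ℓ b| ≤ s * p`, and then all but `ε` of the two powers of `|ℓ
b|` are traded for `s * p`. The leftover exponent `2 - ε` is nonnegative because `ε ≤ 2`. -/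
theorem samplingDist_mul_playedEstimate_sq_le (h1 : 1 < ε) (h2 : ε ≤ 2) (hσ : 0 < σ)
    (hi : InteriorPoint q m) (ℓ : Fin K → ℝ) (b : Fin K) :
    samplingDist (1 / ε) ε σ t q m b * playedEstimate ε σ t q m ℓ b ^ 2
      ≤ |ℓ b| ^ ε / σ * bonus (1 / ε) ε σ t q m b * clipLevel (1 / ε) ε σ t q b := by
  have hp := samplingDist_pos (t := t) h1 hσ hi b
  have hs := clipLevel_pos (t := t) h1 hσ hi b
  have hb := bonus_nonneg (t := t) h1 hσ hi b
  unfold playedEstimate clippedEstimate iwEstimate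
  simp only [if_true]
  split_ifs with h
  · rw [abs_div, abs_of_pos hp, div_le_iff₀ hp] at h
    have h3 : ℓ b ^ 2 = |ℓ b| ^ ε * |ℓ b| ^ (2 - ε) := by
      rw [← Real.rpow_add_of_nonneg (abs_nonneg _) (by linarith) (by linarith)]
      norm_num
    have h4 : |ℓ b| ^ (2 - ε) ≤
        (clipLevel (1 / ε) ε σ t q b * samplingDist (1 / ε) ε σ t q m b) ^ (2 - ε) :=
      Real.rpow_le_rpow (abs_nonneg _) h (by linarith)
    have e : ∀ y : ℝ, 0 < y → y ^ (2 - ε) = y ^ (1 - ε) * y := fun y hy => by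
      rw [← Real.rpow_add_one hy.ne']; congr 1; ring
    rw [Real.mul_rpow hs.le hp.le, e _ hs, e _ hp] at h4
    calc samplingDist (1 / ε) ε σ t q m b * (ℓ b / samplingDist (1 / ε) ε σ t q m b) ^ 2
        = ℓ b ^ 2 / samplingDist (1 / ε) ε σ t q m b := by field_simp
      _ ≤ |ℓ b| ^ ε * (clipLevel (1 / ε) ε σ t q b ^ (1 - ε) * clipLevel (1 / ε) ε σ t q b
            * (samplingDist (1 / ε) ε σ t q m b ^ (1 - ε) * samplingDist (1 / ε) ε σ t q m b))
            / samplingDist (1 / ε) ε σ t q m b := by rw [h3]; gcongr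
      _ = _ := by unfold bonus; field_simp
  · rw [zero_pow two_ne_zero, mul_zero]
    positivity

theorem abs_le_rpow_mul (h1 : 1 < ε) (hσ : 0 < σ) (y : ℝ) :
    |y| ≤ σ ^ (1 / ε) * (1 + |y| ^ ε / σ) := by
  have hc : 0 < σ ^ (1 / ε) := by positivity
  have he : (σ ^ (1 / ε)) ^ ε = σ := by
    rw [← Real.rpow_mul hσ.le, one_div_mul_cancel (by linarith), Real.rpow_one]
  have h2 : |y| ^ ε / σ = (|y| / σ ^ (1 / ε)) ^ ε := by
    rw [Real.div_rpow (abs_nonneg _) hc.le, he]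
  have h3 : |y| / σ ^ (1 / ε) ≤ 1 + (|y| / σ ^ (1 / ε)) ^ ε := by
    have h0 : 0 ≤ |y| / σ ^ (1 / ε) := by positivity
    rcases le_total (|y| / σ ^ (1 / ε)) 1 with h | h
    · have : 0 ≤ (|y| / σ ^ (1 / ε)) ^ ε := by positivity
      linarith
    · have := Real.rpow_le_rpow_of_exponent_le h h1.le
      rw [Real.rpow_one] at this
      linarith
  rw [h2, mul_comm]
  exact (div_le_iff₀ hc).mp h3

/-- The prefactor of the stability term is cancelled exactly by the scale of the threshold, so a
second moment of order bonus times threshold costs only truncated weight times bonus. -/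
theorem stability_coefficient (h1 : 1 < ε) (hσ : 0 < σ) (hi : InteriorPoint q m) (b : Fin K) :
    4 / (invRate K ε σ t * (1 - 1 / ε)) * (min (q b) (qStar q) ^ (2 - 1 / ε)
      * (2 * clipLevel (1 / ε) ε σ t q b)) = min (q b) (qStar q) := by
  have h2 := one_sub_inv_pos h1
  have h3 := invRate_pos (K := K) (ε := ε) hσ t
  have h4 := min_qStar_pos hi b
  have e : min (q b) (qStar q) ^ (2 - 1 / ε) * min (q b) (qStar q) ^ (1 / ε - 1)
      = min (q b) (qStar q) := by
    rw [← Real.rpow_add h4]; norm_num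
  unfold clipLevel
  have e' : ∀ A B X Y : ℝ, A ≠ 0 → B ≠ 0 →
      4 / (A * B) * (X * (2 * (B * Y * A / 8))) = X * Y := by
    intro A B X Y hA hB; field_simp; ring
  rw [e' _ _ _ _ h3.ne' h2.ne', e]

/-- The conditional expectation of `roundGap` over the arm, for a fixed loss vector. -/
theorem sum_samplingDist_mul_roundGap_le (h1 : 1 < ε) (h2 : ε ≤ 2) (hσ : 0 < σ)
    (hi : InteriorPoint q m) (a₀ : Fin K) (ℓ : Fin K → ℝ) :
    ∑ a, samplingDist (1 / ε) ε σ t q m a * roundGap ε σ t q m a₀ ℓ a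
      ≤ ∑ b, armBound ε σ t q m a₀ b (|ℓ b| ^ ε / σ) := by
  set p : Fin K → ℝ := samplingDist (1 / ε) ε σ t q m with hp
  set B : Fin K → ℝ := bonus (1 / ε) ε σ t q m with hB
  set c : Fin K → ℝ := playedEstimate ε σ t q m ℓ with hc
  set s : Fin K → ℝ := clipLevel (1 / ε) ε σ t q with hs
  set w : Fin K → ℝ := fun b => min (q b) (qStar q) ^ (2 - 1 / ε) with hw
  set A : ℝ := 4 / (invRate K ε σ t * (1 - 1 / ε)) with hA
  have hpsum : ∑ a, p a = 1 := sum_samplingDist hi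
  have hp0 : ∀ a, 0 < p a := samplingDist_pos h1 hσ hi
  have hB0 : ∀ a, 0 ≤ B a := bonus_nonneg h1 hσ hi
  have hBs : ∀ a, B a ≤ s a := bonus_le_clipLevel h1 hσ hi
  have hA0 : 0 < A := by
    have := one_sub_inv_pos h1
    have := invRate_pos (K := K) (ε := ε) hσ t
    positivity
  have hw0 : ∀ b, 0 < w b := fun b => Real.rpow_pos_of_pos (min_qStar_pos hi b) _
  have hest : ∀ a b, shiftedEstimate ε σ t q m (a, ℓ a) b = (if a = b then c b else 0) - B b :=
    fun a b => by rw [shiftedEstimate, clippedEstimate_eq_ite]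
  have hlin : ∀ b, ∑ a, p a * ((if a = b then c b else 0) - B b) = p b * c b - B b := by
    intro b
    simp only [mul_sub, Finset.sum_sub_distrib, ← Finset.sum_mul, hpsum]
    simp
  have hsq : ∀ b, ∑ a, p a * ((if a = b then c b else 0) - B b) ^ 2
      ≤ 2 * (p b * c b ^ 2) + 2 * B b ^ 2 := by
    intro b
    have : ∀ a, p a * ((if a = b then c b else 0) - B b) ^ 2
        ≤ 2 * (if a = b then p b * c b ^ 2 else 0) + 2 * B b ^ 2 * p a := by
      intro a
      have := hp0 a
      split_ifs with h
      · subst h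
        nlinarith [mul_nonneg (hp0 a).le (sq_nonneg (c a + B a))]
      · nlinarith [mul_nonneg (hp0 a).le (sq_nonneg (B b))]
    refine (Finset.sum_le_sum fun a _ => this a).trans (le_of_eq ?_)
    rw [Finset.sum_add_distrib, ← Finset.mul_sum, ← Finset.mul_sum, hpsum]
    simp
  have hexp : ∑ a, p a * roundGap ε σ t q m a₀ ℓ a
      = ∑ b, p b * ℓ b - ℓ a₀ - (∑ b, (p b * c b - B b) * q b - (p a₀ * c a₀ - B a₀))
        + A * ∑ b, (∑ a, p a * ((if a = b then c b else 0) - B b) ^ 2) * w b := by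
    have hX : ∀ a, p a * roundGap ε σ t q m a₀ ℓ a
        = p a * ℓ a - p a * ℓ a₀
          - (∑ b, p a * ((if a = b then c b else 0) - B b) * q b
            - p a * ((if a = a₀ then c a₀ else 0) - B a₀))
          + A * ∑ b, p a * ((if a = b then c b else 0) - B b) ^ 2 * w b := by
      intro a
      simp only [roundGap, stabilityTerm, hest]
      simp only [mul_assoc (p a), ← Finset.mul_sum]
      ring
    simp only [hX, Finset.sum_add_distrib, Finset.sum_sub_distrib, ← Finset.mul_sum, hlin,
      ← Finset.sum_mul, hpsum, one_mul]
    rw [Finset.sum_comm, Finset.sum_comm (f := fun a b =>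
      p a * ((if a = b then c b else 0) - B b) ^ 2 * w b)]
    simp only [← Finset.sum_mul, hlin]
  have hδ : ∀ f : Fin K → ℝ, ∑ b, vertex a₀ b * f b = f a₀ := by
    intro f
    rw [Finset.sum_eq_single a₀]
    · simp [vertex]
    · intro b _ hb; simp [vertex, hb]
    · simp
  -- Per arm, the three summands are the exploration cost (`p` instead of `q`), the clipping bias,
  -- and the bonus.
  have hre : ∑ b, p b * ℓ b - ℓ a₀ - (∑ b, (p b * c b - B b) * q b - (p a₀ * c a₀ - B a₀))
      = ∑ b, ((p b - q b) * ℓ b + (q b - vertex a₀ b) * (ℓ b - p b * c b)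
          + (q b - vertex a₀ b) * B b) := by
    have h3 := hδ ℓ
    have h4 := hδ fun b => p b * c b - B b
    have e : ∀ b, (p b - q b) * ℓ b + (q b - vertex a₀ b) * (ℓ b - p b * c b)
          + (q b - vertex a₀ b) * B b
        = p b * ℓ b - vertex a₀ b * ℓ b
          - ((p b * c b - B b) * q b - vertex a₀ b * (p b * c b - B b)) := by
      intro b; ring
    simp only [e, Finset.sum_sub_distrib, h3, h4]
  rw [hexp, hre, Finset.mul_sum, ← Finset.sum_add_distrib]
  refine Finset.sum_le_sum fun b _ => ?_
  set V : ℝ := |ℓ b| ^ ε / σ with hV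
  have hV0 : 0 ≤ V := by positivity
  set d : ℝ := q b - vertex a₀ b with hd
  have b1 : (p b - q b) * ℓ b
      ≤ exploration (1 / ε) ε σ t q m * (1 / K + q b) * σ ^ (1 / ε) * (1 + V) := by
    obtain ⟨g0, -⟩ := exploration_bounds (t := t) h1 hσ hi
    have e : p b - q b = exploration (1 / ε) ε σ t q m * (1 / K - q b) := by
      rw [hp, samplingDist]; ring
    have hq0 := hi.pos b
    have hle : (1 / (K : ℝ) - q b) * ℓ b ≤ (1 / K + q b) * |ℓ b| := by
      rw [sub_mul, add_mul]
      have e1 : 1 / (K : ℝ) * ℓ b ≤ 1 / K * |ℓ b| := by gcongr; exact le_abs_self _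
      have e2 : q b * -ℓ b ≤ q b * |ℓ b| := by gcongr; exact neg_le_abs _
      linarith
    calc (p b - q b) * ℓ b = exploration (1 / ε) ε σ t q m * ((1 / (K : ℝ) - q b) * ℓ b) := by
          rw [e]; ring
      _ ≤ exploration (1 / ε) ε σ t q m * ((1 / K + q b) * (σ ^ (1 / ε) * (1 + V))) := by
          refine mul_le_mul_of_nonneg_left (hle.trans ?_) g0
          gcongr
          exact abs_le_rpow_mul h1 hσ _
      _ = _ := by ring
  have b2 : d * (ℓ b - p b * c b) ≤ |d| * B b * V := by
    calc d * (ℓ b - p b * c b) ≤ |d * (ℓ b - p b * c b)| := le_abs_self _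
      _ = |d| * |ℓ b - p b * c b| := abs_mul _ _
      _ ≤ |d| * (V * B b) := by
          gcongr
          exact abs_sub_playedEstimate_le h1 hσ hi ℓ b
      _ = _ := by ring
  have b3 : A * ((∑ a, p a * ((if a = b then c b else 0) - B b) ^ 2) * w b)
      ≤ min (q b) (qStar q) * B b * (V + 1) := by
    have e1 := samplingDist_mul_playedEstimate_sq_le (t := t) h1 h2 hσ hi ℓ b
    have e2 : B b ^ 2 ≤ B b * s b := by
      rw [pow_two]; exact mul_le_mul_of_nonneg_left (hBs b) (hB0 b)
    have e3 := stability_coefficient (t := t) h1 hσ hi b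
    calc A * ((∑ a, p a * ((if a = b then c b else 0) - B b) ^ 2) * w b)
        ≤ A * ((2 * (V * B b * s b) + 2 * (B b * s b)) * w b) := by
          have := hw0 b
          gcongr
          exact (hsq b).trans (by linarith)
      _ = A * (w b * (2 * s b)) * B b * (V + 1) := by ring
      _ = _ := by rw [e3]
  change _ ≤ exploration (1 / ε) ε σ t q m * (1 / K + q b) * σ ^ (1 / ε) * (1 + V)
    + |d| * B b * V + d * B b + min (q b) (qStar q) * B b * (V + 1)
  linarith

end

/-! ### Bounds in terms of the mass of the suboptimal arms -/

/-- `∑_{b ≠ a₀} q_b^{1/ε}`. -/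
def suboptPower (ε : ℝ) (q : Fin K → ℝ) (a₀ : Fin K) : ℝ :=
  ∑ b ∈ Finset.univ.erase a₀, q b ^ (1 / ε)

section
variable {ε σ : ℝ} {t : ℕ} {q : Fin K → ℝ} {m : Fin K}

theorem rpow_half_le {y : ℝ} (h2 : ε ≤ 2) (hy : 0 < y) :
    (y / 2) ^ (1 - ε) ≤ 2 * y ^ (1 - ε) := by
  rw [Real.div_rpow hy.le (by norm_num), div_le_iff₀ (by positivity)]
  have : (1 / 2 : ℝ) ≤ 2 ^ (1 - ε) := by
    have := Real.rpow_le_rpow_of_exponent_le (x := 2) (by norm_num) (show -1 ≤ 1 - ε by linarith)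
    rw [Real.rpow_neg_one] at this
    linarith
  have hp : 0 < y ^ (1 - ε) := by positivity
  nlinarith

theorem clipLevel_rpow (h1 : 1 < ε) (hσ : 0 < σ) (hi : InteriorPoint q m) (b : Fin K) :
    clipLevel (1 / ε) ε σ t q b ^ (1 - ε)
      = ((1 - 1 / ε) * invRate K ε σ t / 8) ^ (1 - ε)
        * min (q b) (qStar q) ^ ((1 / ε - 1) * (1 - ε)) := by
  have h2 := one_sub_inv_pos h1
  have h3 := invRate_pos (K := K) (ε := ε) hσ t
  have h4 := min_qStar_pos hi b
  rw [Real.rpow_mul h4.le, ← Real.mul_rpow (by positivity) (by positivity), clipLevel]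
  congr 1
  ring

/-- Since `p b ≥ q b / 2`, the truncated weight can replace `p b` at the price of a factor 2, and
the exponents add up: `1 + (1-ε) + (1/ε-1)*(1-ε) = 1/ε`. -/
theorem min_mul_bonus_le (h1 : 1 < ε) (h2 : ε ≤ 2) (hσ : 0 < σ) (hi : InteriorPoint q m)
    (b : Fin K) :
    min (q b) (qStar q) * bonus (1 / ε) ε σ t q m b
      ≤ 2 * (σ * ((1 - 1 / ε) * invRate K ε σ t / 8) ^ (1 - ε))
        * min (q b) (qStar q) ^ (1 / ε) := by
  have h3 := one_sub_inv_pos h1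
  have h4 := invRate_pos (K := K) (ε := ε) hσ t
  have h5 := min_qStar_pos hi b
  set z := min (q b) (qStar q) with hz
  have hp : z / 2 ≤ samplingDist (1 / ε) ε σ t q m b :=
    le_trans (by have := min_le_left (q b) (qStar q); linarith) (half_le_samplingDist h1 hσ hi b)
  have hp2 : samplingDist (1 / ε) ε σ t q m b ^ (1 - ε) ≤ 2 * z ^ (1 - ε) :=
    (Real.rpow_le_rpow_of_nonpos (by positivity) hp (by linarith)).trans (rpow_half_le h2 h5)
  have hexp : z * z ^ (1 - ε) * z ^ ((1 / ε - 1) * (1 - ε)) = z ^ (1 / ε) := by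
    nth_rw 1 [← Real.rpow_one z]
    rw [← Real.rpow_add h5, ← Real.rpow_add h5]
    congr 1
    field_simp
    ring
  rw [bonus, clipLevel_rpow h1 hσ hi, ← hz]
  set X := ((1 - 1 / ε) * invRate K ε σ t / 8) ^ (1 - ε) with hX
  have hX0 : 0 < X := by positivity
  calc z * (σ * samplingDist (1 / ε) ε σ t q m b ^ (1 - ε) * (X * z ^ ((1 / ε - 1) * (1 - ε))))
      ≤ z * (σ * (2 * z ^ (1 - ε)) * (X * z ^ ((1 / ε - 1) * (1 - ε)))) := by gcongr
    _ = 2 * (σ * X) * (z * z ^ (1 - ε) * z ^ ((1 / ε - 1) * (1 - ε))) := by ring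
    _ = _ := by rw [hexp]

/-- Truncation matters only for an arm of mass at least `1/2`. That arm is sampled with probability
at least `1/4`, so its bonus is bounded outright, and `q b ≤ q b ^ (1/ε)`. -/
theorem mul_bonus_le (h1 : 1 < ε) (h2 : ε ≤ 2) (hσ : 0 < σ) (hi : InteriorPoint q m)
    (b : Fin K) :
    q b * bonus (1 / ε) ε σ t q m b
      ≤ 4 * (σ * ((1 - 1 / ε) * invRate K ε σ t / 8) ^ (1 - ε)) * q b ^ (1 / ε) := by
  have h3 := one_sub_inv_pos h1
  have h4 := invRate_pos (K := K) (ε := ε) hσ t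
  have h5 := hi.pos b
  rcases le_or_gt (q b) (qStar q) with hle | hgt
  · have := min_mul_bonus_le (t := t) h1 h2 hσ hi b
    rw [min_eq_left hle] at this
    refine this.trans ?_
    gcongr
    norm_num
  · have hbm : b = m := by
      by_contra h
      exact absurd (le_qStar_of_ne hi.mem hi.argmax h) (not_le.mpr hgt)
    subst hbm
    have hhalf : 1 / 2 ≤ q b := by
      by_contra h
      rw [qStar_eq hi.mem hi.argmax, min_lt_iff] at hgt
      rcases hgt with h' | h'
      · exact lt_irrefl _ h'
      · linarith
    have hz := min_qStar_pos hi b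
    have hz1 : min (q b) (qStar q) ^ ((1 / ε - 1) * (1 - ε)) ≤ 1 := by
      refine Real.rpow_le_one hz.le ((min_le_left _ _).trans (simplex_le_one hi.mem b)) ?_
      exact mul_nonneg_of_nonpos_of_nonpos (by linarith) (by linarith)
    have hp : (1 / 2) / 2 ≤ samplingDist (1 / ε) ε σ t q b b :=
      le_trans (by linarith) (half_le_samplingDist h1 hσ hi b)
    have hp2 : samplingDist (1 / ε) ε σ t q b b ^ (1 - ε) ≤ 4 := by
      refine (Real.rpow_le_rpow_of_nonpos (by norm_num) hp (by linarith)).trans ?_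
      refine (rpow_half_le h2 (by norm_num)).trans ?_
      have := rpow_half_le (y := 1) h2 one_pos
      rw [Real.one_rpow] at this
      linarith
    have hq1 : q b ≤ q b ^ (1 / ε) := by
      have := Real.rpow_le_rpow_of_exponent_ge h5 (simplex_le_one hi.mem b)
        (show 1 / ε ≤ 1 by linarith)
      rwa [Real.rpow_one] at this
    rw [bonus, clipLevel_rpow h1 hσ hi]
    set X := ((1 - 1 / ε) * invRate K ε σ t / 8) ^ (1 - ε) with hX
    have hX0 : 0 < X := by positivity
    calc q b * (σ * samplingDist (1 / ε) ε σ t q b b ^ (1 - ε)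
          * (X * min (q b) (qStar q) ^ ((1 / ε - 1) * (1 - ε))))
        ≤ q b ^ (1 / ε) * (σ * 4 * (X * 1)) := by gcongr
      _ = _ := by ring

/-- The reason for truncating the weights: that of `a₀` is at most `1 - q a₀`, the mass of the other
arms, and subadditivity of the power distributes it over them. -/
theorem sum_min_rpow_le (h1 : 1 < ε) (hi : InteriorPoint q m) (a₀ : Fin K) :
    ∑ b, min (q b) (qStar q) ^ (1 / ε) ≤ 2 * suboptPower ε q a₀ := by
  have h3 := one_sub_inv_pos h1
  have hα : 0 < 1 / ε := by positivity
  have hstar := qStar_pos hi.two_le hi.mem hi.argmax hi.pos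
  have hfirst : min (q a₀) (qStar q) ^ (1 / ε) ≤ suboptPower ε q a₀ := by
    have hle : min (q a₀) (qStar q) ≤ 1 - q a₀ := by
      rcases eq_or_ne a₀ m with rfl | h
      · rw [qStar_eq hi.mem hi.argmax]
        exact (min_le_right _ _).trans (min_le_right _ _)
      · refine (min_le_left _ _).trans ?_
        have := simplex_add_le_one hi.mem h
        have := hi.argmax a₀
        linarith
    rw [← sum_erase_simplex hi.mem a₀] at hle
    refine (Real.rpow_le_rpow (min_qStar_pos hi a₀).le hle hα.le).trans ?_
    exact rpow_sum_le (fun b _ => hi.pos b) (by linarith) hα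
  have hrest : ∑ b ∈ Finset.univ.erase a₀, min (q b) (qStar q) ^ (1 / ε) ≤ suboptPower ε q a₀ :=
    Finset.sum_le_sum fun b _ =>
      Real.rpow_le_rpow (min_qStar_pos hi b).le (min_le_left _ _) hα.le
  rw [← Finset.add_sum_erase _ _ (Finset.mem_univ a₀)]
  linarith

theorem suboptPower_nonneg (hq : q ∈ stdSimplex ℝ (Fin K)) (a₀ : Fin K) :
    0 ≤ suboptPower ε q a₀ :=
  Finset.sum_nonneg fun b _ => Real.rpow_nonneg (hq.1 b) _

/-- Uses the time-dependent branch of the inverse rate. The factor is `(8ε/(ε-1)) ^ (ε-1)`, which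
stays bounded as `ε` tends to 1: `(8ε) ^ (ε-1) ≤ 16`, and Bernoulli gives `(1/(ε-1)) ^ (ε-1) ≤ 2`.
This keeps the constant absolute. -/
theorem rate_factor_le (h1 : 1 < ε) (h2 : ε ≤ 2) (hσ : 0 < σ) (t : ℕ) :
    σ * ((1 - 1 / ε) * invRate K ε σ t / 8) ^ (1 - ε)
      ≤ 32 * (σ ^ (1 / ε) * ((t : ℝ) + 1) ^ (1 / ε - 1)) := by
  have h3 := one_sub_inv_pos h1
  have hε : 0 < ε := by linarith
  have hn : (0 : ℝ) < (t : ℝ) + 1 := by positivity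
  have hle : (1 - 1 / ε) / 8 * (σ ^ (1 / ε) * ((t : ℝ) + 1) ^ (1 / ε))
      ≤ (1 - 1 / ε) * invRate K ε σ t / 8 := by
    have : σ ^ (1 / ε) * ((t : ℝ) + 1) ^ (1 / ε) ≤ invRate K ε σ t := by
      unfold invRate
      gcongr
      exact le_max_right _ _
    have := mul_le_mul_of_nonneg_left this h3.le
    linarith
  have hexp : 1 / ε * (1 - ε) = 1 / ε - 1 := by field_simp
  have hc : ((1 - 1 / ε) / 8) ^ (1 - ε) ≤ 32 := by
    have e1 : ((1 - 1 / ε) / 8) = (8 * ε / (ε - 1))⁻¹ := by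
      have : ε - 1 ≠ 0 := by linarith
      field_simp
    have hpos : 0 < 8 * ε / (ε - 1) := by
      have : 0 < ε - 1 := by linarith
      positivity
    rw [e1, Real.inv_rpow hpos.le, ← Real.rpow_neg hpos.le, neg_sub, div_eq_mul_one_div,
      Real.mul_rpow (by positivity) (by rw [one_div_nonneg]; linarith)]
    have a1 : (8 * ε) ^ (ε - 1) ≤ 16 := by
      calc (8 * ε) ^ (ε - 1) ≤ (8 * ε) ^ (1 : ℝ) :=
            Real.rpow_le_rpow_of_exponent_le (by linarith) (by linarith)
        _ ≤ 16 := by rw [Real.rpow_one]; linarith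
    have a2 : (1 / (ε - 1)) ^ (ε - 1) ≤ 2 := by
      have hd : 0 < ε - 1 := by linarith
      have := rpow_one_add_le_one_add_mul_self (s := 1 / (ε - 1) - 1) (p := ε - 1)
        (by have : 0 < 1 / (ε - 1) := by positivity
            linarith) hd.le (by linarith)
      rw [add_sub_cancel] at this
      refine this.trans ?_
      have e : (ε - 1) * (1 / (ε - 1) - 1) = 1 - (ε - 1) := by field_simp
      rw [e]; linarith
    have a3 : 0 ≤ (1 / (ε - 1)) ^ (ε - 1) := Real.rpow_nonneg (by rw [one_div_nonneg]; linarith) _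
    nlinarith
  calc σ * ((1 - 1 / ε) * invRate K ε σ t / 8) ^ (1 - ε)
      ≤ σ * ((1 - 1 / ε) / 8 * (σ ^ (1 / ε) * ((t : ℝ) + 1) ^ (1 / ε))) ^ (1 - ε) := by
        refine mul_le_mul_of_nonneg_left ?_ hσ.le
        exact Real.rpow_le_rpow_of_nonpos (by positivity) hle (by linarith)
    _ = ((1 - 1 / ε) / 8) ^ (1 - ε) * ((σ * σ ^ (1 / ε - 1)) * ((t : ℝ) + 1) ^ (1 / ε - 1)) := by
        rw [Real.mul_rpow (by positivity) (by positivity),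
          Real.mul_rpow (by positivity) (by positivity), ← Real.rpow_mul hσ.le,
          ← Real.rpow_mul hn.le, hexp]
        ring
    _ = ((1 - 1 / ε) / 8) ^ (1 - ε) * (σ ^ (1 / ε) * ((t : ℝ) + 1) ^ (1 / ε - 1)) := by
        rw [Real.rpow_sub_one hσ.ne']; field_simp
    _ ≤ _ := by gcongr

theorem sum_armBound_one_le (h1 : 1 < ε) (h2 : ε ≤ 2) (hσ : 0 < σ) (hi : InteriorPoint q m)
    (a₀ : Fin K) :
    ∑ b, armBound ε σ t q m a₀ b 1
      ≤ 4 * σ ^ (1 / ε) * exploration (1 / ε) ε σ t q m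
        + 512 * (σ ^ (1 / ε) * ((t : ℝ) + 1) ^ (1 / ε - 1)) * suboptPower ε q a₀ := by
  have hKr : (0 : ℝ) < K := by have := hi.two_le; exact_mod_cast (by omega : 0 < K)
  set B : Fin K → ℝ := bonus (1 / ε) ε σ t q m with hB
  set X := σ * ((1 - 1 / ε) * invRate K ε σ t / 8) ^ (1 - ε) with hX
  have hX32 : X ≤ _ := rate_factor_le (K := K) h1 h2 hσ t
  have e1 : ∑ b, exploration (1 / ε) ε σ t q m * (1 / K + q b) * σ ^ (1 / ε) * (1 + 1)
      = 4 * σ ^ (1 / ε) * exploration (1 / ε) ε σ t q m := by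
    simp only [← Finset.sum_mul, ← Finset.mul_sum, Finset.sum_add_distrib, hi.mem.2]
    simp
    field_simp
    ring
  have e2 : ∑ b, (|q b - vertex a₀ b| * B b * 1 + (q b - vertex a₀ b) * B b)
      ≤ 8 * X * suboptPower ε q a₀ := by
    rw [← Finset.add_sum_erase _ _ (Finset.mem_univ a₀), suboptPower, Finset.mul_sum]
    -- The decisive cancellation: `q a₀ - 1 ≤ 0`, so on the comparator the negative bonus offsets
    -- the bias bound exactly.
    have h3 : |q a₀ - vertex a₀ a₀| * B a₀ * 1 + (q a₀ - vertex a₀ a₀) * B a₀ = 0 := by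
      have := simplex_le_one hi.mem a₀
      have hv : vertex a₀ a₀ = 1 := by simp [vertex]
      rw [hv, abs_of_nonpos (by linarith)]
      ring
    rw [h3, zero_add]
    refine Finset.sum_le_sum fun b hb => ?_
    have hv : vertex a₀ b = 0 := by simp [vertex, (Finset.mem_erase.mp hb).1]
    rw [hv, sub_zero, abs_of_pos (hi.pos b)]
    have := mul_bonus_le (t := t) h1 h2 hσ hi b
    linarith
  have e3 : ∑ b, min (q b) (qStar q) * B b * (1 + 1) ≤ 8 * X * suboptPower ε q a₀ := by
    calc ∑ b, min (q b) (qStar q) * B b * (1 + 1)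
        ≤ ∑ b, 4 * X * min (q b) (qStar q) ^ (1 / ε) := by
          refine Finset.sum_le_sum fun b _ => ?_
          have := min_mul_bonus_le (t := t) h1 h2 hσ hi b
          linarith
      _ = 4 * X * ∑ b, min (q b) (qStar q) ^ (1 / ε) := by rw [Finset.mul_sum]
      _ ≤ 4 * X * (2 * suboptPower ε q a₀) := by
          have h3 := one_sub_inv_pos h1
          have h4 := invRate_pos (K := K) (ε := ε) hσ t
          have : 0 ≤ X := by positivity
          gcongr
          exact sum_min_rpow_le h1 hi a₀
      _ = _ := by ring
  have e4 : ∑ b, armBound ε σ t q m a₀ b 1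
      = ∑ b, exploration (1 / ε) ε σ t q m * (1 / K + q b) * σ ^ (1 / ε) * (1 + 1)
        + ∑ b, (|q b - vertex a₀ b| * B b * 1 + (q b - vertex a₀ b) * B b)
        + ∑ b, min (q b) (qStar q) * B b * (1 + 1) := by
    rw [← Finset.sum_add_distrib, ← Finset.sum_add_distrib]
    refine Finset.sum_congr rfl fun b _ => ?_
    rw [armBound]; ring
  rw [e4, e1]
  have := mul_le_mul_of_nonneg_right hX32 (suboptPower_nonneg (ε := ε) hi.mem a₀)
  refine (add_le_add (add_le_add le_rfl e2) e3).trans ?_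
  linarith

/-! ### Entropy, learning rates and exploration strength -/

theorem neg_tsallis_le (h1 : 1 < ε) (h2 : ε ≤ 2) (hq : q ∈ stdSimplex ℝ (Fin K)) (a₀ : Fin K) :
    -tsallis (1 / ε) q ≤ 2 * suboptPower ε q a₀ := by
  have h3 := one_sub_inv_pos h1
  have hQ := suboptPower_nonneg (ε := ε) hq a₀
  have e : -tsallis (1 / ε) q = ε * (∑ b, q b ^ (1 / ε) - 1) := by
    rw [tsallis, Finset.sum_sub_distrib, hq.2, one_div_one_div]; ring
  rw [e, ← Finset.add_sum_erase _ _ (Finset.mem_univ a₀)]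
  have h4 : q a₀ ^ (1 / ε) ≤ 1 :=
    Real.rpow_le_one (hq.1 a₀) (simplex_le_one hq a₀) (by positivity)
  change ε * (q a₀ ^ (1 / ε) + suboptPower ε q a₀ - 1) ≤ _
  nlinarith

/-- Tangent of the concave power at `1/K`; the linear terms cancel because both distributions have
total mass one. -/
theorem sum_rpow_simplex_le (hK : 1 ≤ K) (h1 : 1 < ε) (hq : q ∈ stdSimplex ℝ (Fin K)) :
    ∑ b, q b ^ (1 / ε) ≤ (K : ℝ) ^ ((ε - 1) / ε) := by
  have h3 := one_sub_inv_pos h1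
  have hα : 0 < 1 / ε := by positivity
  have hKr : (0 : ℝ) < K := by exact_mod_cast hK
  have h4 : ∀ b, q b ^ (1 / ε) ≤ (1 / (K : ℝ)) ^ (1 / ε)
      + 1 / ε * (1 / (K : ℝ)) ^ (1 / ε - 1) * (q b - 1 / K) := fun b =>
    rpow_tangent_le hα.le (by linarith) (hq.1 b) (by positivity)
  refine (Finset.sum_le_sum fun b _ => h4 b).trans (le_of_eq ?_)
  rw [Finset.sum_add_distrib, ← Finset.mul_sum, Finset.sum_sub_distrib, hq.2]
  simp only [Finset.sum_const, Finset.card_univ, Fintype.card_fin, nsmul_eq_mul]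
  rw [mul_one_div_cancel hKr.ne', sub_self, mul_zero, add_zero, one_div (K : ℝ),
    Real.inv_rpow hKr.le, ← Real.rpow_neg hKr.le]
  nth_rw 1 [← Real.rpow_one (K : ℝ)]
  rw [← Real.rpow_add hKr]
  congr 1
  field_simp
  ring

theorem suboptPower_le (hK : 1 ≤ K) (h1 : 1 < ε) (hq : q ∈ stdSimplex ℝ (Fin K)) (a₀ : Fin K) :
    suboptPower ε q a₀ ≤ (K : ℝ) ^ ((ε - 1) / ε) :=
  (Finset.sum_le_sum_of_subset_of_nonneg (Finset.erase_subset _ _)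
    fun b _ _ => Real.rpow_nonneg (hq.1 b) _).trans (sum_rpow_simplex_le hK h1 hq)

theorem one_le_initial_rate (hK : 1 ≤ K) (h1 : 1 < ε) :
    1 ≤ 8 * ε * (K : ℝ) ^ ((ε - 1) / ε) / (ε - 1) := by
  have hd : 0 < ε - 1 := by linarith
  have hKr : (1 : ℝ) ≤ K := by exact_mod_cast hK
  have := Real.one_le_rpow hKr (show 0 ≤ (ε - 1) / ε by positivity)
  rw [le_div_iff₀ hd]
  nlinarith

theorem initial_penalty_le (hK : 1 ≤ K) (h1 : 1 < ε) (hσ : 0 < σ)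
    (hq : q ∈ stdSimplex ℝ (Fin K)) :
    invRate K ε σ 0 * -tsallis (1 / ε) q ≤ kappa K ε σ := by
  have hd : 0 < ε - 1 := by linarith
  have hKr : (0 : ℝ) < K := by exact_mod_cast hK
  have e : -tsallis (1 / ε) q = ε * (∑ b, q b ^ (1 / ε) - 1) := by
    rw [tsallis, Finset.sum_sub_distrib, hq.2, one_div_one_div]; ring
  have hr : invRate K ε σ 0 = σ ^ (1 / ε) * (8 * ε * (K : ℝ) ^ ((ε - 1) / ε) / (ε - 1)) := by
    unfold invRate
    rw [max_eq_left]
    simpa using one_le_initial_rate hK h1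
  have h4 := sum_rpow_simplex_le hK h1 hq
  have hb := invRate_pos (K := K) (ε := ε) hσ 0
  calc invRate K ε σ 0 * -tsallis (1 / ε) q
      ≤ invRate K ε σ 0 * (ε * (K : ℝ) ^ ((ε - 1) / ε)) := by
        rw [e]; gcongr; linarith
    _ = kappa K ε σ := by
        have : (K : ℝ) ^ (2 * (ε - 1) / ε) = (K : ℝ) ^ ((ε - 1) / ε) * (K : ℝ) ^ ((ε - 1) / ε) := by
          rw [← Real.rpow_add hKr]; congr 1; ring
        rw [hr, kappa, this]; ring

theorem le_kappa (hK : 1 ≤ K) (h1 : 1 < ε) (hσ : 0 < σ) :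
    8 * (σ ^ (1 / ε) * (K : ℝ) ^ ((ε - 1) / ε)) ≤ kappa K ε σ ∧ 8 * σ ^ (1 / ε) ≤ kappa K ε σ := by
  have hd : 0 < ε - 1 := by linarith
  have hKr : (1 : ℝ) ≤ K := by exact_mod_cast hK
  have hy := Real.one_le_rpow hKr (show 0 ≤ (ε - 1) / ε by positivity)
  have h3 : (K : ℝ) ^ (2 * (ε - 1) / ε) = (K : ℝ) ^ ((ε - 1) / ε) * (K : ℝ) ^ ((ε - 1) / ε) := by
    rw [← Real.rpow_add (by linarith)]; congr 1; ring
  have hs : 0 < σ ^ (1 / ε) := by positivity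
  have h4 : 1 ≤ ε ^ 2 / (ε - 1) := by
    rw [le_div_iff₀ hd]; nlinarith
  have e : kappa K ε σ = 8 * (σ ^ (1 / ε) * (K : ℝ) ^ ((ε - 1) / ε))
      * ((K : ℝ) ^ ((ε - 1) / ε) * (ε ^ 2 / (ε - 1))) := by
    rw [kappa, h3]; ring
  have h5 : 1 ≤ (K : ℝ) ^ ((ε - 1) / ε) * (ε ^ 2 / (ε - 1)) := by nlinarith
  have h6 : 8 * (σ ^ (1 / ε) * (K : ℝ) ^ ((ε - 1) / ε)) ≤ kappa K ε σ := by
    rw [e]; exact le_mul_of_one_le_right (by positivity) h5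
  refine ⟨h6, le_trans ?_ h6⟩
  nlinarith

/-- The maximum with a constant increases no faster than its varying argument, and `(1 - 1/n) ^
(1/ε) ≥ 1 - 1/n` bounds the increment of the power. -/
theorem invRate_succ_sub (h1 : 1 < ε) (hσ : 0 < σ) (t : ℕ) :
    0 ≤ invRate K ε σ (t + 1) - invRate K ε σ t ∧
    invRate K ε σ (t + 1) - invRate K ε σ t
      ≤ σ ^ (1 / ε) * (((t + 1 : ℕ) : ℝ) + 1) ^ (1 / ε - 1) := by
  have h3 := one_sub_inv_pos h1
  set n : ℝ := ((t + 1 : ℕ) : ℝ) + 1 with hn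
  have hn2 : (2 : ℝ) ≤ n := by rw [hn]; push_cast; have : (0 : ℝ) ≤ t := by positivity
                               linarith
  have ht : (t : ℝ) + 1 = n - 1 := by rw [hn]; push_cast; ring
  have hs : 0 < σ ^ (1 / ε) := by positivity
  unfold invRate
  rw [← hn, ht, ← mul_sub]
  set u := 8 * ε * (K : ℝ) ^ ((ε - 1) / ε) / (ε - 1)
  have hmono : (n - 1) ^ (1 / ε) ≤ n ^ (1 / ε) :=
    Real.rpow_le_rpow (by linarith) (by linarith) (by positivity)
  have hdiff : n ^ (1 / ε) - (n - 1) ^ (1 / ε) ≤ n ^ (1 / ε - 1) := by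
    have hx0 : 0 < 1 - 1 / n := by
      rw [sub_pos, div_lt_one (by linarith)]; linarith
    have hx1 : 1 - 1 / n ≤ 1 := by
      have : 0 < 1 / n := by positivity
      linarith
    have h4 := Real.rpow_le_rpow_of_exponent_ge hx0 hx1 (show 1 / ε ≤ 1 by linarith)
    rw [Real.rpow_one] at h4
    have h5 : n - 1 = n * (1 - 1 / n) := by field_simp
    rw [h5, Real.mul_rpow (by linarith) hx0.le, Real.rpow_sub_one (by linarith)]
    have h6 : 0 < n ^ (1 / ε) := by positivity
    have h7 := mul_le_mul_of_nonneg_left h4 h6.le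
    have h8 : n ^ (1 / ε) * (1 - 1 / n) = n ^ (1 / ε) - n ^ (1 / ε) / n := by ring
    linarith
  refine ⟨mul_nonneg hs.le (sub_nonneg.mpr (max_le_max_left _ hmono)), ?_⟩
  refine mul_le_mul_of_nonneg_left ?_ hs.le
  have : max u (n ^ (1 / ε)) ≤ max u ((n - 1) ^ (1 / ε)) + (n ^ (1 / ε) - (n - 1) ^ (1 / ε)) :=
    max_le (by have := le_max_left u ((n - 1) ^ (1 / ε)); linarith)
      (by have := le_max_right u ((n - 1) ^ (1 / ε)); linarith)
  linarith

/-- Since `qStar q ≤ 1`, its negative power is at least one and can be dropped; with the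
time-dependent branch of the rate the powers of `σ` cancel. -/
theorem exploration_le (h1 : 1 < ε) (hσ : 0 < σ) (hi : InteriorPoint q m) :
    exploration (1 / ε) ε σ t q m
      ≤ K * (8 * ε / (ε - 1)) ^ (ε / (ε - 1)) * ((t : ℝ) + 1) ^ (-(1 / (ε - 1))) := by
  have h3 := one_sub_inv_pos h1
  have hd : 0 < ε - 1 := by linarith
  have hε : 0 < ε := by linarith
  have hn : (0 : ℝ) < (t : ℝ) + 1 := by positivity
  have hq := qStar_pos hi.two_le hi.mem hi.argmax hi.pos
  have hq1 : 1 ≤ qStar q ^ (1 / ε - 1) :=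
    Real.one_le_rpow_of_pos_of_le_one_of_nonpos hq
      ((qStar_le_half hi.mem hi.argmax).trans (by norm_num)) (by linarith)
  have hle : (1 - 1 / ε) / 8 * (σ ^ (1 / ε) * ((t : ℝ) + 1) ^ (1 / ε))
      ≤ (1 - 1 / ε) * qStar q ^ (1 / ε - 1) * invRate K ε σ t / 8 := by
    have h4 : σ ^ (1 / ε) * ((t : ℝ) + 1) ^ (1 / ε) ≤ invRate K ε σ t := by
      unfold invRate
      gcongr
      exact le_max_right _ _
    have h5 : 1 * (σ ^ (1 / ε) * ((t : ℝ) + 1) ^ (1 / ε))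
        ≤ qStar q ^ (1 / ε - 1) * invRate K ε σ t := by gcongr
    have := mul_le_mul_of_nonneg_left h5 h3.le
    linarith
  have e1 : ((1 - 1 / ε) / 8) = (8 * ε / (ε - 1))⁻¹ := by
    have : ε - 1 ≠ 0 := by linarith
    field_simp
  have hpos : 0 < 8 * ε / (ε - 1) := by positivity
  have a0 : ε / (1 - ε) = -(ε / (ε - 1)) := by rw [← neg_sub ε 1, div_neg]
  have a1 : 1 / ε * (ε / (1 - ε)) = -(1 / (ε - 1)) := by
    rw [a0]; field_simp
  rw [exploration_eq hi.mem hi.argmax]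
  calc σ ^ (1 / (ε - 1)) * K *
        ((1 - 1 / ε) * qStar q ^ (1 / ε - 1) * invRate K ε σ t / 8) ^ (ε / (1 - ε))
      ≤ σ ^ (1 / (ε - 1)) * K *
        ((1 - 1 / ε) / 8 * (σ ^ (1 / ε) * ((t : ℝ) + 1) ^ (1 / ε))) ^ (ε / (1 - ε)) := by
        refine mul_le_mul_of_nonneg_left ?_ (by positivity)
        refine Real.rpow_le_rpow_of_nonpos (by positivity) hle ?_
        rw [a0, neg_nonpos]; positivity
    _ = (σ ^ (1 / (ε - 1)) * σ ^ (-(1 / (ε - 1)))) * K *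
        ((8 * ε / (ε - 1)) ^ (ε / (ε - 1)) * ((t : ℝ) + 1) ^ (-(1 / (ε - 1)))) := by
        rw [Real.mul_rpow (by positivity) (by positivity),
          Real.mul_rpow (by positivity) (by positivity), ← Real.rpow_mul hσ.le,
          ← Real.rpow_mul hn.le, a1, e1, Real.inv_rpow hpos.le, ← Real.rpow_neg hpos.le, a0, neg_neg]
        ring
    _ = _ := by
        rw [← Real.rpow_add hσ, add_neg_cancel, Real.rpow_zero]; ring

end

/-! ### Sums over rounds -/

theorem sum_rpow_sub_one_le {α : ℝ} (h0 : 0 < α) (h1 : α ≤ 1) (T : ℕ) :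
    ∑ t ∈ Finset.range T, ((t : ℝ) + 1) ^ (α - 1) ≤ 1 / α * (T : ℝ) ^ α := by
  induction T with
  | zero => simp [Real.zero_rpow h0.ne']
  | succ n ih =>
    rw [Finset.sum_range_succ]
    have h := rpow_tangent_le (x := n) (y := (n : ℝ) + 1) h0.le h1 (by positivity) (by positivity)
    have h2 : ((n : ℝ) + 1) ^ (α - 1) ≤ 1 / α * (((n : ℝ) + 1) ^ α - (n : ℝ) ^ α) := by
      rw [one_div_mul_eq_div, le_div_iff₀ h0]; linarith
    push_cast
    linarith

theorem sum_inv_le_log (n : ℕ) :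
    ∑ t ∈ Finset.range n, (((t + 1 : ℕ) : ℝ) + 1)⁻¹ ≤ Real.log ((n : ℝ) + 1) := by
  induction n with
  | zero => simp
  | succ n ih =>
    rw [Finset.sum_range_succ]
    have hp : (0 : ℝ) < (n : ℝ) + 1 := by positivity
    have hp' : (0 : ℝ) < (n : ℝ) + 2 := by positivity
    have h := Real.one_sub_inv_le_log_of_pos (show 0 < ((n : ℝ) + 2) / (n + 1) by positivity)
    rw [Real.log_div hp'.ne' hp.ne'] at h
    have e : 1 - (((n : ℝ) + 2) / (n + 1))⁻¹ = ((n : ℝ) + 2)⁻¹ := by field_simp; ring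
    push_cast at ih ⊢
    rw [show (n : ℝ) + 1 + 1 = n + 2 by ring]
    linarith

theorem sum_inv_le_three_log {T : ℕ} (hT : 2 ≤ T) :
    ∑ t ∈ Finset.range T, ((t : ℝ) + 1)⁻¹ ≤ 3 * Real.log T := by
  obtain ⟨n, rfl⟩ : ∃ n, T = n + 1 := ⟨T - 1, by omega⟩
  rw [Finset.sum_range_succ']
  have h := sum_inv_le_log n
  have h2 : Real.log 2 ≤ Real.log ((n : ℝ) + 1) := by
    refine Real.log_le_log (by norm_num) ?_
    have : (2 : ℝ) ≤ ((n + 1 : ℕ) : ℝ) := by exact_mod_cast hT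
    push_cast at this
    exact this
  have := Real.log_two_gt_d9
  push_cast at h ⊢
  norm_num
  linarith

theorem sum_rpow_neg_le {c : ℝ} (hc : 0 < c) (n : ℕ) :
    ∑ t ∈ Finset.range n, (((t + 1 : ℕ) : ℝ) + 1) ^ (-(c + 1)) ≤ 1 / c := by
  suffices h : ∑ t ∈ Finset.range n, (((t + 1 : ℕ) : ℝ) + 1) ^ (-(c + 1))
      ≤ 1 / c * (1 - ((n : ℝ) + 1) ^ (-c)) by
    refine h.trans ?_
    have : 0 ≤ ((n : ℝ) + 1) ^ (-c) := by positivity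
    have h2 : 0 < 1 / c := by positivity
    nlinarith
  induction n with
  | zero => simp
  | succ n ih =>
    rw [Finset.sum_range_succ]
    have hp : (0 : ℝ) < (n : ℝ) + 1 := by positivity
    set N : ℝ := (n : ℝ) + 2 with hN
    have hNp : 0 < N := by positivity
    have e1 : (((n + 1 : ℕ) : ℝ) + 1) = N := by rw [hN]; push_cast; ring
    rw [e1]
    -- Convexity estimate behind the telescoping: each summand is at most `1/c` times the decrement
    -- of the power `-c`.
    have hratio : 1 + c / N ≤ (((n : ℝ) + 1) / N) ^ (-c) := by
      have hr : 0 < ((n : ℝ) + 1) / N := by positivity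
      rw [Real.rpow_def_of_pos hr]
      have hlog : Real.log (((n : ℝ) + 1) / N) ≤ -(1 / N) := by
        have := Real.log_le_sub_one_of_pos hr
        have e : ((n : ℝ) + 1) / N - 1 = -(1 / N) := by rw [hN]; field_simp; ring
        linarith
      have h2 : c / N ≤ Real.log (((n : ℝ) + 1) / N) * -c := by
        have := mul_le_mul_of_nonneg_right hlog hc.le
        have e : -(1 / N) * c = -(c / N) := by ring
        linarith
      have := Real.add_one_le_exp (c / N)
      have := Real.exp_le_exp.mpr h2
      linarith
    have hstep : N ^ (-(c + 1)) ≤ 1 / c * (((n : ℝ) + 1) ^ (-c) - N ^ (-c)) := by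
      rw [Real.div_rpow hp.le hNp.le, le_div_iff₀ (by positivity)] at hratio
      have e : N ^ (-(c + 1)) = N ^ (-c) / N := by
        rw [neg_add, ← sub_eq_add_neg, Real.rpow_sub_one hNp.ne']
      rw [e, one_div_mul_eq_div, le_div_iff₀ hc]
      have : (1 + c / N) * N ^ (-c) = N ^ (-c) + N ^ (-c) / N * c := by ring
      linarith
    linarith

theorem iota_nonneg {ε : ℝ} (h1 : 1 < ε) (h2 : ε ≤ 2) (T : ℕ) : 0 ≤ iota ε T := by
  unfold iota
  split_ifs with h
  · exact Real.log_natCast_nonneg T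
  · have : 0 < 2 - ε := sub_pos.mpr (lt_of_le_of_ne h2 h)
    have : 0 < ε - 1 := by linarith
    positivity

/-- The first round is paid for by the cap `1/2`; the rest is a harmonic sum if `ε = 2` and a
convergent series of exponent `1/(ε-1) > 1` otherwise. The constant `256 = 16 ^ 2` is needed only at
`ε = 2`, where `iota` is a bare logarithm. -/
theorem sum_exploration_le {ε : ℝ} (h1 : 1 < ε) (h2 : ε ≤ 2) (K T : ℕ) {γ : ℕ → ℝ}
    (hγ0 : ∀ t < T, γ t ≤ 1 / 2)
    (hγ : ∀ t < T, γ t ≤ K * (8 * ε / (ε - 1)) ^ (ε / (ε - 1)) * ((t : ℝ) + 1) ^ (-(1 / (ε - 1)))) :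
    ∑ t ∈ Finset.range T, γ t ≤ 1 / 2 + 256 * (K * iota ε T) := by
  have hd : 0 < ε - 1 := by linarith
  have hi := iota_nonneg h1 h2 T
  rcases T with _ | n
  · simp only [Finset.range_zero, Finset.sum_empty]; positivity
  rw [Finset.sum_range_succ']
  have h0 := hγ0 0 (by omega)
  set M : ℝ := (8 * ε / (ε - 1)) ^ (ε / (ε - 1)) with hM
  have hM0 : 0 < M := by positivity
  have hs : ∑ t ∈ Finset.range n, γ (t + 1)
      ≤ K * M * ∑ t ∈ Finset.range n, (((t + 1 : ℕ) : ℝ) + 1) ^ (-(1 / (ε - 1))) := by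
    rw [Finset.mul_sum]
    exact Finset.sum_le_sum fun t ht => hγ (t + 1) (by have := Finset.mem_range.mp ht; omega)
  have hle : K * M * ∑ t ∈ Finset.range n, (((t + 1 : ℕ) : ℝ) + 1) ^ (-(1 / (ε - 1)))
      ≤ 256 * (K * iota ε (n + 1)) := by
    rcases eq_or_ne ε 2 with rfl | hne
    · have hM' : M = 256 := by rw [hM]; norm_num
      have e : ∀ t : ℕ, (((t + 1 : ℕ) : ℝ) + 1) ^ (-(1 / ((2 : ℝ) - 1)))
          = (((t + 1 : ℕ) : ℝ) + 1)⁻¹ := by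
        intro t
        rw [← Real.rpow_neg_one]; norm_num
      simp only [e]
      have := sum_inv_le_log n
      rw [hM', iota, if_pos rfl]
      push_cast at this ⊢
      have h3 := mul_le_mul_of_nonneg_left this (show (0 : ℝ) ≤ K * 256 by positivity)
      linarith
    · have hlt : 0 < 2 - ε := sub_pos.mpr (lt_of_le_of_ne h2 hne)
      have hc : 0 < (2 - ε) / (ε - 1) := by positivity
      have h3 := sum_rpow_neg_le hc n
      have e : (2 - ε) / (ε - 1) + 1 = 1 / (ε - 1) := by field_simp; ring
      rw [e, one_div_div] at h3
      rw [iota, if_neg hne, ← hM]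
      have h4 := mul_le_mul_of_nonneg_left h3 (show 0 ≤ K * M by positivity)
      have h5 : 0 ≤ K * M * ((ε - 1) / (2 - ε)) := by positivity
      linarith
  linarith

/-! ### Runs of the algorithm -/

/-- `q` and `m` are the iterates of the algorithm run by `π`, with their most likely arms. -/
def IsRun (ε σ : ℝ) (T : ℕ) (π : Policy K) (q : (t : ℕ) → (Fin t → Obs K) → Fin K → ℝ)
    (m : (t : ℕ) → (Fin t → Obs K) → Fin K) : Prop :=
  ∀ t < T, ∀ h : Fin t → Obs K,
    q t h ∈ stdSimplex ℝ (Fin K) ∧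
    IsMinOn (ftrlObjective (1 / ε) ε σ q m t h) (stdSimplex ℝ (Fin K)) (q t h) ∧
    (∀ a, q t h a ≤ q t h (m t h)) ∧
    ∀ a, π.kernel t h {a} = ENNReal.ofReal (samplingDist (1 / ε) ε σ t (q t h) (m t h) a)

/-- The cumulative shifted estimates along a run. -/
def runLoss (ε σ : ℝ) (q : (t : ℕ) → (Fin t → Obs K) → Fin K → ℝ)
    (m : (t : ℕ) → (Fin t → Obs K) → Fin K) (t : ℕ) (h : Fin t → Obs K) (a : Fin K) : ℝ :=
  ∑ s : Fin t,
    shiftedEstimate ε σ s (q s (restrictObs h s)) (m s (restrictObs h s)) (h s) a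

section
variable {ε σ : ℝ} {T : ℕ} {π : Policy K} {q : (t : ℕ) → (Fin t → Obs K) → Fin K → ℝ}
  {m : (t : ℕ) → (Fin t → Obs K) → Fin K}

theorem IsRun.isMinOn (hr : IsRun ε σ T π q m) {t : ℕ} (ht : t < T) (h : Fin t → Obs K) :
    IsMinOn (linObjective (1 / ε) (invRate K ε σ t) (runLoss ε σ q m t h))
      (stdSimplex ℝ (Fin K)) (q t h) :=
  (hr t ht h).2.1

theorem one_div_lt_one (h1 : 1 < ε) : 1 / ε < 1 := by linarith [one_sub_inv_pos h1]

theorem IsRun.interior (hr : IsRun ε σ T π q m) (hK : 2 ≤ K) (h1 : 1 < ε) (hσ : 0 < σ) {t : ℕ}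
    (ht : t < T) (h : Fin t → Obs K) : InteriorPoint (q t h) (m t h) where
  two_le := hK
  mem := (hr t ht h).1
  argmax := (hr t ht h).2.2.1
  pos := minimizer_pos (by positivity) (one_div_lt_one h1) (invRate_pos hσ t) (hr t ht h).1
    (hr.isMinOn ht h)

theorem measurable_shiftedEstimate {Y : Type*} [MeasurableSpace Y] {p : Y → Fin K → ℝ}
    {k : Y → Fin K} (hp : Measurable p) (hpm : ∀ y, p y ∈ stdSimplex ℝ (Fin K))
    (hk : ∀ y a, p y a ≤ p y (k y)) (t : ℕ) (a : Fin K) {o : Y → Obs K} (ho : Measurable o) :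
    Measurable fun y => shiftedEstimate ε σ t (p y) (k y) (o y) a :=
  (measurable_clippedEstimate hp hpm hk t a ho).sub (measurable_bonus hp hpm hk t a)

/-- A run provides the iterates without any measurability. Uniqueness of the minimizer identifies
them with the continuous map `ftrlMap` of the past estimates. The choice `m` of a largest arm may be
non-measurable, since exploration depends on it only through `qStar`. -/
theorem IsRun.measurable (hr : IsRun ε σ T π q m) (hK : 2 ≤ K) (h1 : 1 < ε) (hσ : 0 < σ) {t : ℕ}
    (ht : t < T) : Measurable (q t) := by
  induction t using Nat.strong_induction_on with
  | _ t ih =>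
    have h0 : 0 < 1 / ε := by positivity
    have hK1 : 1 ≤ K := by omega
    have hL : Measurable (runLoss ε σ q m t) := by
      refine measurable_pi_lambda _ fun a => Finset.measurable_sum _ fun s _ => ?_
      have hs : (s : ℕ) < T := lt_trans s.isLt ht
      have hres : Measurable fun h : Fin t → Obs K => restrictObs h s :=
        measurable_pi_lambda _ fun i => measurable_pi_apply _
      exact measurable_shiftedEstimate ((ih s s.isLt hs).comp hres) (fun h => (hr s hs _).1)
        (fun h => (hr s hs _).2.2.1) s a (measurable_pi_apply s)
    have : q t = fun h => ftrlMap hK1 (invRate K ε σ t) h0 (runLoss ε σ q m t h) := by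
      funext h
      obtain ⟨e1, e2⟩ := (exists_min hK1 (invRate K ε σ t) h0 (runLoss ε σ q m t h)).choose_spec
      exact min_unique h0 (one_div_lt_one h1) (invRate_pos hσ t) _ _ _ (hr t ht h).1 e1
        (hr.isMinOn ht h) e2
    rw [this]
    exact (continuous_ftrlMap hK1 h0 (one_div_lt_one h1) (invRate_pos hσ t)).measurable.comp hL

/-- Bounded thresholds in earlier rounds bound the cumulative estimates, hence keep the iterate away
from zero, hence bound the next threshold. Only integrability needs this, so the size of `M` is
irrelevant. -/
theorem IsRun.exists_clipLevel_le (hr : IsRun ε σ T π q m) (hK : 2 ≤ K) (h1 : 1 < ε) (hσ : 0 < σ)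
    {t : ℕ} (ht : t < T) : ∃ M, ∀ h a, clipLevel (1 / ε) ε σ t (q t h) a ≤ M := by
  induction t using Nat.strong_induction_on with
  | _ t ih =>
    have h0 : 0 < 1 / ε := by positivity
    have hK1 : 1 ≤ K := by omega
    have hs : ∀ s : Fin t, ∃ M, ∀ h a, clipLevel (1 / ε) ε σ s (q s h) a ≤ M :=
      fun s => ih s s.isLt (lt_trans s.isLt ht)
    choose M hM using hs
    have hL : ∀ h a, |runLoss ε σ q m t h a| ≤ ∑ s, 2 * M s := by
      intro h a
      refine (Finset.abs_sum_le_sum_abs _ _).trans (Finset.sum_le_sum fun s _ => ?_)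
      refine (abs_shiftedEstimate_le h1 hσ (hr.interior hK h1 hσ (lt_trans s.isLt ht) _) _ a).trans ?_
      have := hM s (restrictObs h s) a
      linarith
    set R := 2 * (∑ s, 2 * M s) / invRate K ε σ t + (1 / (K : ℝ)) ^ (1 / ε - 1)
    have hq : ∀ h a, q t h a ^ (1 / ε - 1) ≤ R := fun h a =>
      minimizer_rpow_le h0 (one_div_lt_one h1) (invRate_pos hσ t) (hr t ht h).1 (hr.isMinOn ht h)
        (hL h) hK1 a
    refine ⟨(1 - 1 / ε) * R * invRate K ε σ t / 8, fun h a => ?_⟩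
    have hi := hr.interior hK h1 hσ ht h
    have hmin : min (q t h a) (qStar (q t h)) ^ (1 / ε - 1) ≤ R := by
      rcases eq_or_ne a (m t h) with rfl | ha
      · rw [min_qStar_argmax hi.mem hi.argmax]
        obtain ⟨b, hb⟩ := exists_ne_of_two_le hK (m t h)
        exact (Real.rpow_le_rpow_of_nonpos (hi.pos b) (le_qStar_of_ne hi.mem hi.argmax hb)
          (by linarith [one_div_lt_one h1])).trans (hq h b)
      · rw [min_qStar_of_ne hi.mem hi.argmax ha]
        exact hq h a
    unfold clipLevel
    have := one_sub_inv_pos h1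
    have := invRate_pos (K := K) (ε := ε) hσ t
    gcongr

/-- The first `t` entries of a sequence of observations. -/
def obsPrefix (o : ℕ → Obs K) (t : ℕ) : Fin t → Obs K := fun i => o i

/-- The regret of the algorithm on the shifted estimates along a sequence of observations. -/
theorem IsRun.regret_shifted_le (hr : IsRun ε σ T π q m) (hK : 2 ≤ K) (h1 : 1 < ε) (h2 : ε ≤ 2)
    (hσ : 0 < σ) (o : ℕ → Obs K) (a₀ : Fin K) :
    ∑ t ∈ Finset.range T,
        (∑ a, shiftedEstimate ε σ t (q t (obsPrefix o t)) (m t (obsPrefix o t)) (o t) a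
            * q t (obsPrefix o t) a
          - shiftedEstimate ε σ t (q t (obsPrefix o t)) (m t (obsPrefix o t)) (o t) a₀)
      ≤ kappa K ε σ + ∑ t ∈ Finset.range T,
        (2 * (σ ^ (1 / ε) * ((t : ℝ) + 1) ^ (1 / ε - 1)) * suboptPower ε (q t (obsPrefix o t)) a₀
          + stabilityTerm ε σ t (q t (obsPrefix o t)) (m t (obsPrefix o t)) (o t)) := by
  have hK1 : 1 ≤ K := by omega
  rcases T with _ | n
  · have := (le_kappa hK1 h1 hσ).2
    have : 0 < σ ^ (1 / ε) := by positivity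
    simp only [Finset.range_zero, Finset.sum_empty, add_zero]
    linarith
  have hmain := ftrl_regret (α := 1 / ε) (by positivity) (one_div_lt_one h1) hK1
    (β := invRate K ε σ) (fun t => invRate_pos hσ t)
    (g := fun t => shiftedEstimate ε σ t (q t (obsPrefix o t)) (m t (obsPrefix o t)) (o t))
    (q := fun t => q t (obsPrefix o t))
    (S := fun t => stabilityTerm ε σ t (q t (obsPrefix o t)) (m t (obsPrefix o t)) (o t)) n
    (fun t ht => (hr t (by omega) _).1)
    (fun t ht => by
      have := hr.isMinOn (show t < n + 1 by omega) (obsPrefix o t)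
      have e : runLoss ε σ q m t (obsPrefix o t) = fun a => ∑ s ∈ Finset.range t,
          shiftedEstimate ε σ s (q s (obsPrefix o s)) (m s (obsPrefix o s)) (o s) a := by
        funext a
        rw [Finset.sum_range]
        rfl
      rwa [e] at this)
    (fun t ht x hx => stability_round h1 h2 hσ (hr.interior hK h1 hσ (by omega) _) _ hx) a₀
  refine hmain.trans ?_
  rw [Finset.sum_add_distrib, ← add_assoc]
  refine add_le_add (add_le_add (initial_penalty_le hK1 h1 hσ (hr 0 (by omega) _).1) ?_) le_rfl
  -- The increment of the rate from `t` to `t + 1` is charged to the iterate of round `t + 1`, so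
  -- the term of round `0` on the right is spare and nonnegative.
  rw [Finset.sum_range_succ']
  have hnn : ∀ t < n + 1, 0 ≤ suboptPower ε (q t (obsPrefix o t)) a₀ := fun t ht =>
    suboptPower_nonneg (hr t ht _).1 a₀
  refine le_add_of_le_of_nonneg (Finset.sum_le_sum fun t ht => ?_) ?_
  · have ht' : t + 1 < n + 1 := by have := Finset.mem_range.mp ht; omega
    obtain ⟨b0, b1⟩ := invRate_succ_sub (K := K) h1 hσ t
    have h3 := neg_tsallis_le h1 h2 (hr (t + 1) ht' (obsPrefix o (t + 1))).1 a₀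
    have h4 := hnn (t + 1) ht'
    calc (invRate K ε σ (t + 1) - invRate K ε σ t) * -tsallis (1 / ε) (q (t + 1) (obsPrefix o (t + 1)))
        ≤ (σ ^ (1 / ε) * (((t + 1 : ℕ) : ℝ) + 1) ^ (1 / ε - 1))
          * (2 * suboptPower ε (q (t + 1) (obsPrefix o (t + 1))) a₀) := by
          refine (mul_le_mul_of_nonneg_left h3 b0).trans ?_
          exact mul_le_mul_of_nonneg_right b1 (by positivity)
      _ = _ := by ring
  · have := hnn 0 (by omega)
    positivity

end

/-! ### The law of a round given the past -/

section
variable {Z : Type u} [MeasurableSpace Z] {env : Environment Z K} {π : Policy K}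

instance isMarkovKernel_stepKernel (env : Environment Z K) (π : Policy K) (t : ℕ) :
    IsMarkovKernel (stepKernel env π t) := by
  unfold stepKernel; infer_instance

theorem stepKernel_apply (t : ℕ) (h : Fin t → Round Z K) :
    stepKernel env π t h = (env.kernel t h).prod (π.kernel t (observed t h)) := by
  rw [stepKernel, Kernel.prod_apply, Kernel.comap_apply]

/-- The history before round `t` together with round `t`. -/
def prefixRound {t T : ℕ} (ht : t < T) (H : Fin T → Round Z K) :
    (Fin t → Round Z K) × Round Z K :=
  (fun i => H (Fin.castLE ht.le i), H ⟨t, ht⟩)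

theorem measurable_prefixRound {t T : ℕ} (ht : t < T) :
    Measurable (prefixRound (Z := Z) (K := K) ht) :=
  (measurable_pi_lambda _ fun _ => measurable_pi_apply _).prodMk (measurable_pi_apply _)

theorem measurable_snocRound (t : ℕ) : Measurable fun x : (Fin t → Round Z K) × Round Z K =>
    (Fin.snoc (α := fun _ => Round Z K) x.1 x.2 : Fin (t + 1) → Round Z K) := by
  refine measurable_pi_lambda _ fun i => ?_
  refine Fin.lastCases ?_ (fun j => ?_) i
  · simpa using measurable_snd
  · simp only [Fin.snoc_castSucc]
    exact (measurable_pi_apply j).comp measurable_fst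

/-- Rounds after `t` are drawn by Markov kernels and integrate out, so expectations under the
`T`-round law reduce to a past of length `t` followed by one conditional step. -/
theorem map_prefixRound_law {t T : ℕ} (ht : t < T) :
    (law env π T).map (prefixRound ht) = law env π t ⊗ₘ stepKernel env π t := by
  induction T, ht using Nat.le_induction with
  | base =>
    rw [law, Measure.map_map (measurable_prefixRound _) (measurable_snocRound t)]
    have : (prefixRound (Nat.lt_succ_self t) ∘ fun x : (Fin t → Round Z K) × Round Z K =>
        (Fin.snoc (α := fun _ => Round Z K) x.1 x.2 : Fin (t + 1) → Round Z K)) = id := by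
      funext x
      refine Prod.ext (funext fun i => ?_) ?_
      · exact Fin.snoc_castSucc (α := fun _ => Round Z K) _ _ i
      · exact Fin.snoc_last (α := fun _ => Round Z K) _ _
    exact (congrArg (fun f => Measure.map f _) this).trans Measure.map_id
  | succ T hT ih =>
    have hT' : t < T := hT
    rw [law, Measure.map_map (measurable_prefixRound _) (measurable_snocRound T)]
    have : (prefixRound (show t < T + 1 by omega) ∘ fun x : (Fin T → Round Z K) × Round Z K =>
        (Fin.snoc (α := fun _ => Round Z K) x.1 x.2 : Fin (T + 1) → Round Z K))
        = prefixRound hT' ∘ Prod.fst := by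
      funext x
      refine Prod.ext (funext fun i => ?_) ?_
      · exact Fin.snoc_castSucc (α := fun _ => Round Z K) _ _ (Fin.castLE hT'.le i)
      · exact Fin.snoc_castSucc (α := fun _ => Round Z K) _ _ (⟨t, hT'⟩ : Fin T)
    refine (congrArg (fun f => Measure.map f _) this).trans ?_
    rw [← Measure.map_map (measurable_prefixRound hT') measurable_fst]
    change Measure.map _ (law env π T ⊗ₘ stepKernel env π T).fst = _
    rw [Measure.fst_compProd]
    exact ih

theorem integral_prefixRound {t T : ℕ} (ht : t < T)
    {f : (Fin t → Round Z K) × Round Z K → ℝ}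
    (hf : Integrable f (law env π t ⊗ₘ stepKernel env π t)) :
    Integrable (fun H => f (prefixRound ht H)) (law env π T) ∧
    ∫ H, f (prefixRound ht H) ∂(law env π T)
      = ∫ h, ∫ r, f (h, r) ∂(stepKernel env π t h) ∂(law env π t) := by
  have hf' := hf
  rw [← map_prefixRound_law ht] at hf
  refine ⟨(integrable_map_measure hf.1 (measurable_prefixRound ht).aemeasurable).mp hf, ?_⟩
  rw [← integral_map (measurable_prefixRound ht).aemeasurable hf.1, map_prefixRound_law ht,
    Measure.integral_compProd hf']

/-! ### Moments -/

theorem integrable_rpow_of_moment {μ : Measure (Z × (Fin K → ℝ))} {ε σ : ℝ} (hσ : 0 < σ)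
    {a : Fin K} (h : ∫⁻ x, ENNReal.ofReal (|x.2 a| ^ ε) ∂μ ≤ ENNReal.ofReal σ) :
    Integrable (fun x => |x.2 a| ^ ε) μ ∧ ∫ x, |x.2 a| ^ ε ∂μ ≤ σ := by
  have hm : Measurable fun x : Z × (Fin K → ℝ) => |x.2 a| ^ ε := by fun_prop
  have hnn : 0 ≤ᵐ[μ] fun x : Z × (Fin K → ℝ) => |x.2 a| ^ ε :=
    Filter.Eventually.of_forall fun x => Real.rpow_nonneg (abs_nonneg _) _
  refine ⟨⟨hm.aestronglyMeasurable, ?_⟩, ?_⟩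
  · rw [hasFiniteIntegral_iff_ofReal hnn]
    exact h.trans_lt ENNReal.ofReal_lt_top
  · rw [integral_eq_lintegral_of_nonneg_ae hnn hm.aestronglyMeasurable]
    exact ENNReal.toReal_le_of_le_ofReal hσ.le h

theorem integrable_loss {T : ℕ} {ε σ : ℝ} (h1 : 1 < ε)
    (hht : HeavyTailed env T ε σ) {t : ℕ} (ht : t < T) (a : Fin K) :
    Integrable (fun x : (Fin t → Round Z K) × Round Z K => x.2.1.2 a)
      (law env π t ⊗ₘ stepKernel env π t) := by
  have hm : Measurable fun x : (Fin t → Round Z K) × Round Z K => x.2.1.2 a := by fun_prop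
  refine ⟨hm.aestronglyMeasurable, ?_⟩
  rw [hasFiniteIntegral_iff_enorm, Measure.lintegral_compProd hm.enorm]
  have hb : ∀ h : Fin t → Round Z K, ∫⁻ r, ‖r.1.2 a‖ₑ ∂(stepKernel env π t h)
      ≤ 1 + ENNReal.ofReal σ := by
    intro h
    have hm2 : Measurable fun r : Round Z K => ‖r.1.2 a‖ₑ := by fun_prop
    rw [stepKernel_apply, lintegral_prod _ hm2.aemeasurable]
    simp only [lintegral_const, measure_univ, mul_one]
    calc ∫⁻ x, ‖x.2 a‖ₑ ∂(env.kernel t h)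
        ≤ ∫⁻ x, (1 + ENNReal.ofReal (|x.2 a| ^ ε)) ∂(env.kernel t h) := by
          refine lintegral_mono fun x => ?_
          have h3 := abs_le_rpow_mul h1 one_pos (x.2 a)
          rw [Real.one_rpow, one_mul, div_one] at h3
          rw [← ofReal_norm, Real.norm_eq_abs, ← ENNReal.ofReal_one,
            ← ENNReal.ofReal_add zero_le_one (Real.rpow_nonneg (abs_nonneg _) _)]
          exact ENNReal.ofReal_le_ofReal h3
      _ = 1 + ∫⁻ x, ENNReal.ofReal (|x.2 a| ^ ε) ∂(env.kernel t h) := by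
          rw [lintegral_add_left measurable_const]; simp
      _ ≤ 1 + ENNReal.ofReal σ := by gcongr; exact hht t ht h a
  calc ∫⁻ h, ∫⁻ r, ‖r.1.2 a‖ₑ ∂(stepKernel env π t h) ∂(law env π t)
      ≤ ∫⁻ _h, (1 + ENNReal.ofReal σ) ∂(law env π t) := lintegral_mono hb
    _ = 1 + ENNReal.ofReal σ := by simp
    _ < ⊤ := by simp

theorem measurable_observation : Measurable fun r : Round Z K => ((r.2, r.1.2 r.2) : Obs K) := by
  refine measurable_snd.prodMk ?_
  refine measurable_from_prod_countable_left fun a => ?_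
  exact (measurable_pi_apply a).comp measurable_snd

theorem integrable_played_loss {T : ℕ} {ε σ : ℝ} (h1 : 1 < ε)
    (hht : HeavyTailed env T ε σ) {t : ℕ} (ht : t < T) :
    Integrable (fun x : (Fin t → Round Z K) × Round Z K => x.2.1.2 x.2.2)
      (law env π t ⊗ₘ stepKernel env π t) := by
  have hs : Integrable (fun x : (Fin t → Round Z K) × Round Z K => ∑ a, |x.2.1.2 a|)
      (law env π t ⊗ₘ stepKernel env π t) :=
    integrable_finsetSum _ fun a _ => (integrable_loss h1 hht ht a).abs
  refine hs.mono' (measurable_observation.snd.comp measurable_snd).aestronglyMeasurable ?_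
  refine Filter.Eventually.of_forall fun x => ?_
  exact Finset.single_le_sum (f := fun a => |x.2.1.2 a|) (fun a _ => abs_nonneg _)
    (Finset.mem_univ x.2.2)

end

/-! ### Expected regret against a fixed arm -/

section
variable {Z : Type u} [MeasurableSpace Z] {env : Environment Z K} {ε σ : ℝ} {T : ℕ} {π : Policy K}
  {q : (t : ℕ) → (Fin t → Obs K) → Fin K → ℝ} {m : (t : ℕ) → (Fin t → Obs K) → Fin K}

/-- Affine dependence on the moment, with the nonnegative slope of `armBound_slope_nonneg`, lets the
expectation pass inside and replaces the normalized moment by its bound 1. -/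
theorem armBound_affine (t : ℕ) (p : Fin K → ℝ) (k a₀ b : Fin K) (v : ℝ) :
    armBound ε σ t p k a₀ b v
      = armBound ε σ t p k a₀ b 0
        + (armBound ε σ t p k a₀ b 1 - armBound ε σ t p k a₀ b 0) * v := by
  unfold armBound; ring

theorem armBound_slope_nonneg (h1 : 1 < ε) (hσ : 0 < σ) {t : ℕ} {p : Fin K → ℝ} {k : Fin K}
    (hi : InteriorPoint p k) (a₀ b : Fin K) :
    0 ≤ armBound ε σ t p k a₀ b 1 - armBound ε σ t p k a₀ b 0 := by
  have h3 := (exploration_bounds (t := t) h1 hσ hi).1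
  have h4 := bonus_nonneg (t := t) h1 hσ hi b
  have h5 := min_qStar_pos hi b
  have h6 := hi.pos b
  have e : armBound ε σ t p k a₀ b 1 - armBound ε σ t p k a₀ b 0
      = exploration (1 / ε) ε σ t p k * (1 / K + p b) * σ ^ (1 / ε)
        + |p b - vertex a₀ b| * bonus (1 / ε) ε σ t p k b
        + min (p b) (qStar p) * bonus (1 / ε) ε σ t p k b := by
    unfold armBound; ring
  rw [e]
  positivity

/-- The conditional expectation of `roundGap` given the past. -/
theorem integral_roundGap_le (h1 : 1 < ε) (h2 : ε ≤ 2) (hσ : 0 < σ)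
    {μ : Measure (Z × (Fin K → ℝ))} [IsProbabilityMeasure μ] {ν : Measure (Fin K)}
    [IsProbabilityMeasure ν]
    (hμ : ∀ a, ∫⁻ x, ENNReal.ofReal (|x.2 a| ^ ε) ∂μ ≤ ENNReal.ofReal σ)
    {t : ℕ} {p : Fin K → ℝ} {k : Fin K} (hi : InteriorPoint p k)
    (hν : ∀ a, ν {a} = ENNReal.ofReal (samplingDist (1 / ε) ε σ t p k a)) (a₀ : Fin K)
    (hInt : Integrable (fun r : Round Z K => roundGap ε σ t p k a₀ r.1.2 r.2) (μ.prod ν)) :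
    ∫ r, roundGap ε σ t p k a₀ r.1.2 r.2 ∂(μ.prod ν) ≤ ∑ b, armBound ε σ t p k a₀ b 1 := by
  rw [integral_prod _ hInt]
  have hsum : ∀ x : Z × (Fin K → ℝ), ∫ a, roundGap ε σ t p k a₀ x.2 a ∂ν
      = ∑ a, samplingDist (1 / ε) ε σ t p k a * roundGap ε σ t p k a₀ x.2 a := by
    intro x
    rw [integral_fintype Integrable.of_finite]
    refine Finset.sum_congr rfl fun a _ => ?_
    rw [Measure.real, hν, ENNReal.toReal_ofReal (samplingDist_pos h1 hσ hi a).le, smul_eq_mul]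
  have hV : ∀ b, Integrable (fun x : Z × (Fin K → ℝ) =>
      armBound ε σ t p k a₀ b (|x.2 b| ^ ε / σ)) μ := by
    intro b
    simp only [fun x : Z × (Fin K → ℝ) =>
      armBound_affine (ε := ε) (σ := σ) t p k a₀ b (|x.2 b| ^ ε / σ)]
    exact (integrable_const _).add
      (((integrable_rpow_of_moment hσ (hμ b)).1.div_const σ).const_mul _)
  calc ∫ x, ∫ a, roundGap ε σ t p k a₀ x.2 a ∂ν ∂μ
      ≤ ∫ x, ∑ b, armBound ε σ t p k a₀ b (|x.2 b| ^ ε / σ) ∂μ := by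
        refine integral_mono hInt.integral_prod_left (integrable_finsetSum _ fun b _ => hV b)
          fun x => ?_
        dsimp only
        rw [hsum x]
        exact sum_samplingDist_mul_roundGap_le h1 h2 hσ hi a₀ x.2
    _ = ∑ b, ∫ x, armBound ε σ t p k a₀ b (|x.2 b| ^ ε / σ) ∂μ :=
        integral_finsetSum _ fun b _ => hV b
    _ ≤ ∑ b, armBound ε σ t p k a₀ b 1 := by
        refine Finset.sum_le_sum fun b _ => ?_
        obtain ⟨e1, e2⟩ := integrable_rpow_of_moment hσ (hμ b)
        simp only [fun x : Z × (Fin K → ℝ) =>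
          armBound_affine (ε := ε) (σ := σ) t p k a₀ b (|x.2 b| ^ ε / σ)]
        rw [integral_add (integrable_const _) ((e1.div_const σ).const_mul _), integral_const_mul,
          integral_div]
        simp only [integral_const, probReal_univ, one_smul]
        have h3 : (∫ x : Z × (Fin K → ℝ), |x.2 b| ^ ε ∂μ) / σ ≤ 1 := (div_le_one hσ).mpr e2
        have h4 := mul_le_mul_of_nonneg_left h3 (armBound_slope_nonneg (t := t) h1 hσ hi a₀ b)
        linarith

/-- `roundGap` along a run, as a function of the history and the current round. -/
def runGap (ε σ : ℝ) (q : (t : ℕ) → (Fin t → Obs K) → Fin K → ℝ)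
    (m : (t : ℕ) → (Fin t → Obs K) → Fin K) (a₀ : Fin K) (t : ℕ)
    (x : (Fin t → Round Z K) × Round Z K) : ℝ :=
  roundGap ε σ t (q t (observed t x.1)) (m t (observed t x.1)) a₀ x.2.1.2 x.2.2

theorem IsRun.integrable_runGap (hr : IsRun ε σ T π q m) (hK : 2 ≤ K) (h1 : 1 < ε)
    (hσ : 0 < σ) (hht : HeavyTailed env T ε σ) {t : ℕ} (ht : t < T) (a₀ : Fin K) :
    Integrable (runGap ε σ q m a₀ t) (law env π t ⊗ₘ stepKernel env π t) := by
  obtain ⟨M, hM⟩ := hr.exists_clipLevel_le hK h1 hσ ht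
  have hi : ∀ x : (Fin t → Round Z K) × Round Z K,
      InteriorPoint (q t (observed t x.1)) (m t (observed t x.1)) :=
    fun x => hr.interior hK h1 hσ ht _
  have hqm : Measurable fun x : (Fin t → Round Z K) × Round Z K => q t (observed t x.1) :=
    (hr.measurable hK h1 hσ ht).comp ((measurable_observed t).comp measurable_fst)
  set g : (Fin t → Round Z K) × Round Z K → Fin K → ℝ := fun x =>
    shiftedEstimate ε σ t (q t (observed t x.1)) (m t (observed t x.1))
      (x.2.2, x.2.1.2 x.2.2) with hg
  have hgm : ∀ b, Measurable fun x => g x b := fun b =>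
    measurable_shiftedEstimate hqm (fun x => (hi x).mem) (fun x => (hi x).argmax) t b
      (measurable_observation.comp measurable_snd)
  have hgb : ∀ x b, |g x b| ≤ 2 * M := fun x b =>
    (abs_shiftedEstimate_le h1 hσ (hi x) _ b).trans (by linarith [hM (observed t x.1) b])
  have hgi : ∀ b, Integrable (fun x => g x b) (law env π t ⊗ₘ stepKernel env π t) := fun b =>
    Integrable.of_bound (hgm b).aestronglyMeasurable (2 * M) (Filter.Eventually.of_forall fun x =>
      hgb x b)
  have hgq : ∀ b, Integrable (fun x => g x b * q t (observed t x.1) b)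
      (law env π t ⊗ₘ stepKernel env π t) := fun b => by
    refine Integrable.of_bound
      ((hgm b).mul ((measurable_pi_apply b).comp hqm)).aestronglyMeasurable (2 * M)
      (Filter.Eventually.of_forall fun x => ?_)
    rw [Real.norm_eq_abs, abs_mul, abs_of_pos ((hi x).pos b)]
    have := simplex_le_one (hi x).mem b
    have := (hi x).pos b
    have := abs_nonneg (g x b)
    nlinarith [hgb x b]
  have hst : ∀ b, Integrable (fun x => g x b ^ 2
      * min (q t (observed t x.1) b) (qStar (q t (observed t x.1))) ^ (2 - 1 / ε))
      (law env π t ⊗ₘ stepKernel env π t) := fun b => by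
    have hwm : Measurable fun x : (Fin t → Round Z K) × Round Z K =>
        min (q t (observed t x.1) b) (qStar (q t (observed t x.1))) ^ (2 - 1 / ε) :=
      ((((measurable_pi_apply b).comp hqm).min (measurable_qStar hqm)).pow_const _)
    refine Integrable.of_bound (((hgm b).pow_const 2).mul hwm).aestronglyMeasurable ((2 * M) ^ 2)
      (Filter.Eventually.of_forall fun x => ?_)
    have hw0 := min_qStar_pos (hi x) b
    have hw1 : min (q t (observed t x.1) b) (qStar (q t (observed t x.1))) ^ (2 - 1 / ε) ≤ 1 :=
      Real.rpow_le_one hw0.le ((min_le_left _ _).trans (simplex_le_one (hi x).mem b))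
        (by linarith [one_div_lt_one h1])
    rw [Real.norm_eq_abs, abs_of_nonneg (by positivity)]
    have hsq : g x b ^ 2 ≤ (2 * M) ^ 2 := sq_le_sq' (abs_le.mp (hgb x b)).1 (abs_le.mp (hgb x b)).2
    nlinarith [sq_nonneg (g x b)]
  exact (((integrable_played_loss h1 hht ht).sub (integrable_loss h1 hht ht a₀)).sub
    ((integrable_finsetSum _ fun b _ => hgq b).sub (hgi a₀))).add
    ((integrable_finsetSum _ fun b _ => hst b).const_mul _)

theorem IsRun.integrable_suboptPower (hr : IsRun ε σ T π q m) (hK : 2 ≤ K) (h1 : 1 < ε)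
    (hσ : 0 < σ) {t : ℕ} (ht : t < T) (a₀ : Fin K) :
    Integrable (fun h => suboptPower ε (q t (observed t h)) a₀) (law env π t) := by
  have hqm : Measurable fun h : Fin t → Round Z K => q t (observed t h) :=
    (hr.measurable hK h1 hσ ht).comp (measurable_observed t)
  refine Integrable.of_bound (Measurable.aestronglyMeasurable ?_) ((K : ℝ) ^ ((ε - 1) / ε))
    (Filter.Eventually.of_forall fun h => ?_)
  · exact Finset.measurable_sum _ fun b _ => ((measurable_pi_apply b).comp hqm).pow_const _
  · have := (hr t ht (observed t h)).1
    rw [Real.norm_of_nonneg (suboptPower_nonneg this a₀)]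
    exact suboptPower_le (by omega) h1 this a₀

/-- The contribution of one round to the expected regret. -/
theorem IsRun.integral_round_le (hr : IsRun ε σ T π q m) (hK : 2 ≤ K) (h1 : 1 < ε) (h2 : ε ≤ 2)
    (hσ : 0 < σ) (hht : HeavyTailed env T ε σ) {t : ℕ} (ht : t < T) (a₀ : Fin K) :
    Integrable (fun x => 2 * (σ ^ (1 / ε) * ((t : ℝ) + 1) ^ (1 / ε - 1))
        * suboptPower ε (q t (observed t x.1)) a₀ + runGap ε σ q m a₀ t x)
      (law env π t ⊗ₘ stepKernel env π t) ∧
    ∫ h, ∫ r, (2 * (σ ^ (1 / ε) * ((t : ℝ) + 1) ^ (1 / ε - 1))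
        * suboptPower ε (q t (observed t h)) a₀ + runGap ε σ q m a₀ t (h, r))
        ∂(stepKernel env π t h) ∂(law env π t)
      ≤ 4 * σ ^ (1 / ε) * min (1 / 2)
          (K * (8 * ε / (ε - 1)) ^ (ε / (ε - 1)) * ((t : ℝ) + 1) ^ (-(1 / (ε - 1))))
        + 514 * (σ ^ (1 / ε) * ((t : ℝ) + 1) ^ (1 / ε - 1))
          * ∫ h, suboptPower ε (q t (observed t h)) a₀ ∂(law env π t) := by
  set c : ℝ := σ ^ (1 / ε) * ((t : ℝ) + 1) ^ (1 / ε - 1) with hc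
  have hQ := hr.integrable_suboptPower (env := env) hK h1 hσ ht a₀
  have hg := hr.integrable_runGap hK h1 hσ hht ht a₀
  have hQ' : Integrable (fun x : (Fin t → Round Z K) × Round Z K =>
      2 * c * suboptPower ε (q t (observed t x.1)) a₀) (law env π t ⊗ₘ stepKernel env π t) := by
    refine Integrable.const_mul ?_ _
    have hmp : (law env π t ⊗ₘ stepKernel env π t).map Prod.fst = law env π t :=
      Measure.fst_compProd _ _
    rw [← hmp] at hQ
    exact (integrable_map_measure hQ.1 measurable_fst.aemeasurable).mp hQ
  have hF := hQ'.add hg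
  refine ⟨hF, ?_⟩
  -- A deterministic bound on the exploration strength, valid for every history, so exploration
  -- contributes a number in each round.
  set γ : ℝ := min (1 / 2)
    (K * (8 * ε / (ε - 1)) ^ (ε / (ε - 1)) * ((t : ℝ) + 1) ^ (-(1 / (ε - 1)))) with hγ
  rw [← integral_const_mul]
  have hconst : (4 * σ ^ (1 / ε) * γ) = ∫ _h, 4 * σ ^ (1 / ε) * γ ∂(law env π t) := by simp
  rw [hconst, ← integral_add (integrable_const _) (hQ.const_mul _)]
  have hae := ((Measure.integrable_compProd_iff hg.1).mp hg).1
  have hF' := hF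
  rw [Measure.compProd] at hF'
  have hinner := hF'.integral_compProd
  simp only [Kernel.prodMkLeft_apply, Kernel.const_apply] at hinner
  refine integral_mono_ae hinner ((integrable_const _).add (hQ.const_mul _)) ?_
  filter_upwards [hae] with h hh
  have hi := hr.interior hK h1 hσ ht (observed t h)
  rw [integral_add (integrable_const _) hh]
  simp only [integral_const, probReal_univ, one_smul]
  have hgap : ∫ r, runGap ε σ q m a₀ t (h, r) ∂(stepKernel env π t h)
      ≤ ∑ b, armBound ε σ t (q t (observed t h)) (m t (observed t h)) a₀ b 1 := by
    rw [stepKernel_apply] at hh ⊢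
    exact integral_roundGap_le h1 h2 hσ (hht t ht h) hi (hr t ht _).2.2.2 a₀ hh
  have hsum := sum_armBound_one_le (t := t) h1 h2 hσ hi a₀
  have hex : exploration (1 / ε) ε σ t (q t (observed t h)) (m t (observed t h)) ≤ γ :=
    le_min (exploration_bounds h1 hσ hi).2 (exploration_le h1 hσ hi)
  have := mul_le_mul_of_nonneg_left hex (show 0 ≤ 4 * σ ^ (1 / ε) by positivity)
  linarith

/-- Expected regret of the algorithm against a fixed arm. -/
theorem IsRun.expected_regret_le (hr : IsRun ε σ T π q m) (hK : 2 ≤ K) (h1 : 1 < ε) (h2 : ε ≤ 2)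
    (hσ : 0 < σ) (hht : HeavyTailed env T ε σ) (a₀ : Fin K) :
    ∫ h, (∑ t, (h t).1.2 (h t).2 - ∑ t, (h t).1.2 a₀) ∂(law env π T)
      ≤ 2 * kappa K ε σ + 1024 * (σ ^ (1 / ε) * K * iota ε T)
        + 514 * (σ ^ (1 / ε) * ∑ t ∈ Finset.range T, ((t : ℝ) + 1) ^ (1 / ε - 1)
          * ∫ h, suboptPower ε (q t (observed t h)) a₀ ∂(law env π t)) := by
  set F : (t : ℕ) → (Fin t → Round Z K) × Round Z K → ℝ := fun t x =>
    2 * (σ ^ (1 / ε) * ((t : ℝ) + 1) ^ (1 / ε - 1))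
      * suboptPower ε (q t (observed t x.1)) a₀ + runGap ε σ q m a₀ t x with hF
  have hpath : ∀ H : Fin T → Round Z K, ∑ t, (H t).1.2 (H t).2 - ∑ t, (H t).1.2 a₀
      ≤ kappa K ε σ + ∑ t : Fin T, F t (prefixRound t.isLt H) := by
    intro H
    -- The pathwise bound expects an infinite sequence; the default value beyond `T` is never read.
    set o : ℕ → Obs K := fun i =>
      if h : i < T then observed T H ⟨i, h⟩ else (a₀, 0) with ho
    have hpre : ∀ t : Fin T, obsPrefix o t = observed t (prefixRound t.isLt H).1 := by
      intro t
      funext i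
      have : (i : ℕ) < T := lt_trans i.isLt t.isLt
      simp only [obsPrefix, ho, dif_pos this]
      rfl
    have hcur : ∀ t : Fin T, o t = ((H t).2, (H t).1.2 (H t).2) := by
      intro t
      simp only [ho, dif_pos t.isLt]
      rfl
    have hreg := hr.regret_shifted_le hK h1 h2 hσ o a₀
    rw [Finset.sum_range, Finset.sum_range] at hreg
    have e : ∑ t : Fin T, F t (prefixRound t.isLt H)
        = ∑ t : Fin T, (2 * (σ ^ (1 / ε) * ((t : ℕ) + 1 : ℝ) ^ (1 / ε - 1))
              * suboptPower ε (q t (obsPrefix o t)) a₀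
            + stabilityTerm ε σ t (q t (obsPrefix o t)) (m t (obsPrefix o t)) (o t))
          + (∑ t, (H t).1.2 (H t).2 - ∑ t, (H t).1.2 a₀)
          - ∑ t : Fin T,
            (∑ a, shiftedEstimate ε σ t (q t (obsPrefix o t)) (m t (obsPrefix o t)) (o t) a
              * q t (obsPrefix o t) a
            - shiftedEstimate ε σ t (q t (obsPrefix o t)) (m t (obsPrefix o t)) (o t) a₀) := by
      rw [← Finset.sum_sub_distrib, ← Finset.sum_add_distrib, ← Finset.sum_sub_distrib]
      refine Finset.sum_congr rfl fun t _ => ?_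
      rw [hpre, hcur]
      simp only [hF, runGap, roundGap, prefixRound, Fin.eta]
      ring
    linarith
  have hround := fun t : Fin T => hr.integral_round_le hK h1 h2 hσ hht t.isLt a₀
  have hInt := fun t : Fin T => integral_prefixRound t.isLt (hround t).1
  have hlhs : Integrable (fun H : Fin T → Round Z K =>
      ∑ t, (H t).1.2 (H t).2 - ∑ t, (H t).1.2 a₀) (law env π T) :=
    (integrable_finsetSum _ fun t _ =>
      (integral_prefixRound t.isLt (integrable_played_loss h1 hht t.isLt)).1).sub
    (integrable_finsetSum _ fun t _ =>
      (integral_prefixRound t.isLt (integrable_loss h1 hht t.isLt a₀)).1)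
  have hrhs : Integrable (fun H : Fin T → Round Z K => ∑ t : Fin T, F t (prefixRound t.isLt H))
      (law env π T) := integrable_finsetSum _ fun t _ => (hInt t).1
  have hmono := integral_mono hlhs ((integrable_const (kappa K ε σ)).add hrhs) hpath
  refine hmono.trans ?_
  rw [integral_add' (integrable_const _) hrhs, integral_finsetSum _ fun t _ => (hInt t).1]
  simp only [integral_const, probReal_univ, one_smul]
  have hle := Finset.sum_le_sum fun (t : Fin T) (_ : t ∈ Finset.univ) =>
    (hInt t).2.trans_le (hround t).2
  rw [Finset.sum_add_distrib, ← Finset.mul_sum] at hle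
  -- Multiplied by `4 * σ ^ (1/ε)`, the `1/2` becomes `2 * σ ^ (1/ε)`, absorbed in a second `kappa`,
  -- and `256` becomes `1024`. The `514` is `512` from the arm bounds plus `2` from the penalty.
  have hexp := sum_exploration_le h1 h2 K T
    (γ := fun t => min (1 / 2)
      (K * (8 * ε / (ε - 1)) ^ (ε / (ε - 1)) * ((t : ℝ) + 1) ^ (-(1 / (ε - 1)))))
    (fun t _ => min_le_left _ _) (fun t _ => min_le_right _ _)
  rw [Finset.sum_range] at hexp
  have hs : 0 < σ ^ (1 / ε) := by positivity
  have hexp' := mul_le_mul_of_nonneg_left hexp (show 0 ≤ 4 * σ ^ (1 / ε) by positivity)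
  have hk := (le_kappa (K := K) (by omega) h1 hσ).2
  have e : ∑ t : Fin T, 514 * (σ ^ (1 / ε) * ((t : ℕ) + 1 : ℝ) ^ (1 / ε - 1))
        * ∫ h, suboptPower ε (q t (observed t h)) a₀ ∂(law env π t)
      = 514 * (σ ^ (1 / ε) * ∑ t ∈ Finset.range T, ((t : ℝ) + 1) ^ (1 / ε - 1)
          * ∫ h, suboptPower ε (q t (observed t h)) a₀ ∂(law env π t)) := by
    rw [Finset.sum_range, Finset.mul_sum, Finset.mul_sum]
    exact Finset.sum_congr rfl fun t _ => by ring
  rw [e] at hle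
  refine (add_le_add le_rfl hle).trans ?_
  linarith

end

/-! ### Optimizing the self-bounding inequality -/

/-- Weighted AM-GM with weights `1/ε` and `1 - 1/ε`; the powers of `η` and `d` cancel in the
product. Keeping `η` free makes the bound linear in `y`, so it can be summed over arms and rounds
and integrated before `η` is optimized. -/
theorem young_subopt {ε η n d y : ℝ} (h1 : 1 < ε) (hη : 0 < η) (hn : 0 < n) (hd : 0 < d)
    (hy : 0 ≤ y) :
    n ^ (1 / ε - 1) * y ^ (1 / ε)
      ≤ 1 / ε * (η * (d * y)) + (1 - 1 / ε) * (η ^ (-(1 / (ε - 1))) * (n⁻¹ * d ^ (1 / (1 - ε)))) := by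
  have hc := one_sub_inv_pos h1
  have hε : 0 < ε := by linarith
  have h := Real.geom_mean_le_arith_mean2_weighted (w₁ := 1 / ε) (w₂ := 1 - 1 / ε)
    (p₁ := η * (d * y)) (p₂ := η ^ (-(1 / (ε - 1))) * (n⁻¹ * d ^ (1 / (1 - ε))))
    (by positivity) hc.le (by positivity) (by positivity) (by ring)
  refine le_trans (le_of_eq ?_) h
  have hne : ε - 1 ≠ 0 := by linarith
  have hne' : 1 - ε ≠ 0 := by linarith
  have e1 : -(1 / (ε - 1)) * (1 - 1 / ε) = -(1 / ε) := by field_simp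
  have e2 : 1 / (1 - ε) * (1 - 1 / ε) = -(1 / ε) := by field_simp; ring
  rw [Real.mul_rpow hη.le (by positivity), Real.mul_rpow hd.le hy,
    Real.mul_rpow (by positivity) (by positivity), Real.mul_rpow (by positivity) (by positivity),
    ← Real.rpow_mul hη.le, ← Real.rpow_mul hd.le, e1, e2, Real.inv_rpow hn.le,
    ← Real.rpow_neg hn.le, neg_sub, Real.rpow_neg hη.le, Real.rpow_neg hd.le]
  have : 0 < η ^ (1 / ε) := by positivity
  have : 0 < d ^ (1 / ε) := by positivity
  field_simp

theorem le_of_forall_young {ε X A N : ℝ} (h1 : 1 < ε) (hA : 0 < A) (hN : 0 < N)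
    (h : ∀ η : ℝ, 0 < η → X ≤ 1 / ε * (η * A) + (1 - 1 / ε) * (η ^ (-(1 / (ε - 1))) * N)) :
    X ≤ A ^ (1 / ε) * N ^ (1 - 1 / ε) := by
  have hNA : 0 < N / A := by positivity
  have hne : ε - 1 ≠ 0 := by linarith
  have hε : 0 < ε := by linarith
  refine (h ((N / A) ^ (1 - 1 / ε)) (by positivity)).trans (le_of_eq ?_)
  have e : (1 - 1 / ε) * -(1 / (ε - 1)) = -(1 / ε) := by field_simp
  rw [← Real.rpow_mul hNA.le, e, Real.div_rpow hN.le hA.le, Real.div_rpow hN.le hA.le,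
    Real.rpow_neg hN.le, Real.rpow_neg hA.le, Real.rpow_sub hN, Real.rpow_sub hA,
    Real.rpow_one, Real.rpow_one]
  have : 0 < A ^ (1 / ε) := by positivity
  have : 0 < N ^ (1 / ε) := by positivity
  field_simp
  ring

/-- Young's inequality scaled so that the coefficient of `R` is at most one half. The power
`ε/(ε-1)` of `B` is where a constant depending on `ε` becomes unavoidable in this argument. -/
theorem absorb_rpow {ε R B : ℝ} (h1 : 1 < ε) (hR : 0 ≤ R) (hB : 0 ≤ B) :
    B * R ^ (1 / ε) ≤ R / 2 + 2 ^ (1 / (ε - 1)) * B ^ (ε / (ε - 1)) := by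
  have hc := one_sub_inv_pos h1
  have hε : 0 < ε := by linarith
  have hd : 0 < ε - 1 := by linarith
  have h := Real.geom_mean_le_arith_mean2_weighted (w₁ := 1 / ε) (w₂ := 1 - 1 / ε)
    (p₁ := R / 2) (p₂ := 2 ^ (1 / (ε - 1)) * B ^ (ε / (ε - 1)))
    (by positivity) hc.le (by positivity) (by positivity) (by ring)
  have e1 : 1 / (ε - 1) * (1 - 1 / ε) = 1 / ε := by field_simp
  have e2 : ε / (ε - 1) * (1 - 1 / ε) = 1 := by field_simp
  rw [Real.div_rpow hR (by norm_num), Real.mul_rpow (by positivity) (by positivity),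
    ← Real.rpow_mul (by norm_num), ← Real.rpow_mul hB, e1, e2, Real.rpow_one] at h
  have h2 : (0 : ℝ) < 2 ^ (1 / ε) := by positivity
  have e3 : R ^ (1 / ε) / 2 ^ (1 / ε) * (2 ^ (1 / ε) * B) = B * R ^ (1 / ε) := by field_simp
  rw [e3] at h
  refine h.trans ?_
  have h3 : 1 / ε ≤ 1 := by linarith
  have h4 : 0 ≤ 2 ^ (1 / (ε - 1)) * B ^ (ε / (ε - 1)) := by positivity
  have h5 : 0 < 1 / ε := by positivity
  nlinarith

theorem self_bounding_solve {ε σ R C L S E : ℝ} (h1 : 1 < ε) (h2 : ε ≤ 2) (hσ : 0 < σ)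
    (hR : 0 < R) (hC : 0 ≤ C) (hL : 0 < L) (hS : 0 < S)
    (h : R ≤ E + 514 * (σ ^ (1 / ε) * ((2 * (R + C)) ^ (1 / ε) * (3 * L * S) ^ (1 - 1 / ε)))) :
    R ≤ 2 * 2 ^ (1 / (ε - 1)) * 3084 ^ (ε / (ε - 1))
          * ((2 * σ / ε) ^ (1 / (ε - 1)) * (S ^ ((ε - 1) / ε)) ^ (ε / (ε - 1)) * L)
        + 6168 * (S ^ ((ε - 1) / ε) * L ^ (1 - 1 / ε) * (2 * σ / ε) ^ (1 / ε) * C ^ (1 / ε))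
        + 2 * E := by
  have hc := one_sub_inv_pos h1
  have hε : 0 < ε := by linarith
  have hd : 0 < ε - 1 := by linarith
  have hα : 0 < 1 / ε := by positivity
  have eexp : (ε - 1) / ε = 1 - 1 / ε := by field_simp
  rw [eexp]
  set ω : ℝ := S ^ (1 - 1 / ε) with hω
  have hω0 : 0 < ω := by positivity
  -- Here `3084 = 514 * 2 * 3`. Only the product with `R ^ (1/ε)` is absorbed, so the term in `C`
  -- keeps the absolute constant, doubled to `6168` when `R / 2` moves to the left.
  set B : ℝ := 3084 * (σ ^ (1 / ε) * L ^ (1 - 1 / ε) * ω) with hB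
  have hB0 : 0 < B := by positivity
  have a1 : (2 * (R + C)) ^ (1 / ε) ≤ 2 * (R ^ (1 / ε) + C ^ (1 / ε)) := by
    rw [Real.mul_rpow (by norm_num) (by positivity)]
    have e1 : (2 : ℝ) ^ (1 / ε) ≤ 2 := by
      have := Real.rpow_le_rpow_of_exponent_le (x := 2) (by norm_num) (show 1 / ε ≤ 1 by linarith)
      rwa [Real.rpow_one] at this
    have e2 := Real.rpow_add_le_add_rpow hR.le hC hα.le (by linarith : 1 / ε ≤ 1)
    gcongr
  have a2 : (3 * L * S) ^ (1 - 1 / ε) ≤ 3 * (L ^ (1 - 1 / ε) * ω) := by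
    rw [Real.mul_rpow (by positivity) hS.le, Real.mul_rpow (by norm_num) hL.le, mul_assoc]
    have e1 : (3 : ℝ) ^ (1 - 1 / ε) ≤ 3 := by
      have := Real.rpow_le_rpow_of_exponent_le (x := 3) (by norm_num)
        (show 1 - 1 / ε ≤ 1 by linarith)
      rwa [Real.rpow_one] at this
    gcongr
  have a3 : R ≤ E + (B * R ^ (1 / ε) + B * C ^ (1 / ε)) := by
    refine h.trans ?_
    have e : B * R ^ (1 / ε) + B * C ^ (1 / ε) = 514 * (σ ^ (1 / ε)
        * (2 * (R ^ (1 / ε) + C ^ (1 / ε)) * (3 * (L ^ (1 - 1 / ε) * ω)))) := by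
      rw [hB]; ring
    rw [e]
    gcongr
  have a4 := absorb_rpow h1 hR.le hB0.le
  have hσle : σ ≤ 2 * σ / ε := by
    rw [le_div_iff₀ hε]; nlinarith
  have a5 : B ^ (ε / (ε - 1)) ≤ 3084 ^ (ε / (ε - 1))
      * ((2 * σ / ε) ^ (1 / (ε - 1)) * ω ^ (ε / (ε - 1)) * L) := by
    have e1 : 1 / ε * (ε / (ε - 1)) = 1 / (ε - 1) := by field_simp
    have e2 : (1 - 1 / ε) * (ε / (ε - 1)) = 1 := by field_simp
    rw [hB, Real.mul_rpow (by norm_num) (by positivity), Real.mul_rpow (by positivity) hω0.le,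
      Real.mul_rpow (by positivity) (by positivity), ← Real.rpow_mul hσ.le, ← Real.rpow_mul hL.le,
      e1, e2, Real.rpow_one]
    refine mul_le_mul_of_nonneg_left ?_ (by positivity)
    calc σ ^ (1 / (ε - 1)) * L * ω ^ (ε / (ε - 1))
        ≤ (2 * σ / ε) ^ (1 / (ε - 1)) * L * ω ^ (ε / (ε - 1)) := by gcongr
      _ = _ := by ring
  have a6 : B * C ^ (1 / ε)
      ≤ 3084 * (ω * L ^ (1 - 1 / ε) * (2 * σ / ε) ^ (1 / ε) * C ^ (1 / ε)) := by
    calc B * C ^ (1 / ε) ≤ 3084 * ((2 * σ / ε) ^ (1 / ε) * L ^ (1 - 1 / ε) * ω) * C ^ (1 / ε) := by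
          rw [hB]; gcongr
      _ = _ := by ring
  have a7 := mul_le_mul_of_nonneg_left a5 (show (0 : ℝ) ≤ 2 ^ (1 / (ε - 1)) by positivity)
  linarith

/-! ### The two regret bounds -/

section
variable {Z : Type u} [MeasurableSpace Z] {env : Environment Z K} {ε σ : ℝ} {T : ℕ} {π : Policy K}
  {q : (t : ℕ) → (Fin t → Obs K) → Fin K → ℝ} {m : (t : ℕ) → (Fin t → Obs K) → Fin K}

theorem regret_of_one_arm (env : Environment Z 1) (π : Policy 1) (T : ℕ) :
    regret env π T = 0 := by
  unfold regret
  have : ∀ (a : Fin 1) (h : Fin T → Round Z 1),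
      ∑ t, (h t).1.2 (h t).2 - ∑ t, (h t).1.2 a = 0 := by
    intro a h
    rw [sub_eq_zero]
    exact Finset.sum_congr rfl fun t _ => by rw [Subsingleton.elim (h t).2 a]
  simp [this]

theorem kappa_nonneg (hK : 1 ≤ K) (h1 : 1 < ε) (hσ : 0 < σ) : 0 ≤ kappa K ε σ := by
  have := (le_kappa hK h1 hσ).2
  have : 0 < σ ^ (1 / ε) := by positivity
  linarith

theorem IsRun.regret_le (hr : IsRun ε σ T π q m) (hK : 2 ≤ K) (h1 : 1 < ε) (h2 : ε ≤ 2)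
    (hσ : 0 < σ) (hht : HeavyTailed env T ε σ) :
    regret env π T ≤ 1028 * (σ ^ (1 / ε) * (K : ℝ) ^ ((ε - 1) / ε) * (T : ℝ) ^ (1 / ε)
      + σ ^ (1 / ε) * K * iota ε T + kappa K ε σ) := by
  have hK1 : 1 ≤ K := by omega
  have : Nonempty (Fin K) := ⟨⟨0, hK1⟩⟩
  refine ciSup_le fun a₀ => (hr.expected_regret_le hK h1 h2 hσ hht a₀).trans ?_
  have hsum : ∑ t ∈ Finset.range T, ((t : ℝ) + 1) ^ (1 / ε - 1)
      * ∫ h, suboptPower ε (q t (observed t h)) a₀ ∂(law env π t)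
      ≤ (2 * (T : ℝ) ^ (1 / ε)) * (K : ℝ) ^ ((ε - 1) / ε) := by
    calc _ ≤ ∑ t ∈ Finset.range T, ((t : ℝ) + 1) ^ (1 / ε - 1) * (K : ℝ) ^ ((ε - 1) / ε) := by
          refine Finset.sum_le_sum fun t ht => ?_
          have ht' := Finset.mem_range.mp ht
          refine mul_le_mul_of_nonneg_left ?_ (by positivity)
          have := integral_mono (hr.integrable_suboptPower (env := env) hK h1 hσ ht' a₀)
            (integrable_const ((K : ℝ) ^ ((ε - 1) / ε)))
            (fun h => suboptPower_le hK1 h1 (hr t ht' (observed t h)).1 a₀)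
          simpa using this
      _ = (∑ t ∈ Finset.range T, ((t : ℝ) + 1) ^ (1 / ε - 1)) * (K : ℝ) ^ ((ε - 1) / ε) := by
          rw [Finset.sum_mul]
      _ ≤ _ := by
          gcongr
          refine (sum_rpow_sub_one_le (by positivity) (one_div_lt_one h1).le T).trans ?_
          rw [one_div_one_div]
          gcongr
  have h3 := mul_le_mul_of_nonneg_left hsum (show 0 ≤ σ ^ (1 / ε) by positivity)
  have h4 := kappa_nonneg hK1 h1 hσ
  have h5 : 0 ≤ σ ^ (1 / ε) * K * iota ε T := by
    have := iota_nonneg h1 h2 T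
    positivity
  linarith

/-- An optimal arm attains the maximum in the regret; integrability of the losses is what allows the
expectations to be split and compared. -/
theorem regret_le_of_isOptimalArm (h1 : 1 < ε) (hht : HeavyTailed env T ε σ)
    {a₀ : Fin K} (hopt : IsOptimalArm env π T a₀) :
    regret env π T
      ≤ ∫ h, (∑ t, (h t).1.2 (h t).2 - ∑ t, (h t).1.2 a₀) ∂(law env π T) := by
  have : Nonempty (Fin K) := ⟨a₀⟩
  have hplay : Integrable (fun H : Fin T → Round Z K => ∑ t, (H t).1.2 (H t).2) (law env π T) :=
    integrable_finsetSum _ fun t _ =>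
      (integral_prefixRound t.isLt (integrable_played_loss h1 hht t.isLt)).1
  have harm : ∀ a, Integrable (fun H : Fin T → Round Z K => ∑ t, (H t).1.2 a) (law env π T) :=
    fun a => integrable_finsetSum _ fun t _ =>
      (integral_prefixRound t.isLt (integrable_loss h1 hht t.isLt a)).1
  refine ciSup_le fun a => ?_
  rw [integral_sub hplay (harm a), integral_sub hplay (harm a₀)]
  exact sub_le_sub_left (hopt a) _

/-- The expected gap of the FTRL iterates is controlled by that of the played arms. -/
theorem IsRun.sum_integral_gap_le (hr : IsRun ε σ T π q m) (hK : 2 ≤ K) (h1 : 1 < ε)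
    (hσ : 0 < σ) {Δ : Fin K → ℝ} (hΔ : ∀ a, 0 ≤ Δ a) (a₀ : Fin K) :
    (∀ t < T, Integrable (fun h => ∑ a ∈ Finset.univ.erase a₀, Δ a * q t (observed t h) a)
      (law env π t)) ∧
    ∑ t ∈ Finset.range T, ∫ h, ∑ a ∈ Finset.univ.erase a₀, Δ a * q t (observed t h) a ∂(law env π t)
      ≤ 2 * ∫ h, ∑ t, Δ (h t).2 ∂(law env π T) := by
  have hInt : ∀ t < T, Integrable
      (fun h => ∑ a ∈ Finset.univ.erase a₀, Δ a * q t (observed t h) a) (law env π t) := by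
    intro t ht
    have hqm : Measurable fun h : Fin t → Round Z K => q t (observed t h) :=
      (hr.measurable hK h1 hσ ht).comp (measurable_observed t)
    refine integrable_finsetSum _ fun a _ => Integrable.const_mul ?_ _
    refine Integrable.of_bound ((measurable_pi_apply a).comp hqm).aestronglyMeasurable 1
      (Filter.Eventually.of_forall fun h => ?_)
    have := (hr t ht (observed t h)).1
    rw [Real.norm_of_nonneg (this.1 a)]
    exact simplex_le_one this a
  refine ⟨hInt, ?_⟩
  have hplay : ∀ t, Integrable (fun x : (Fin t → Round Z K) × Round Z K => Δ x.2.2)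
      (law env π t ⊗ₘ stepKernel env π t) := by
    intro t
    refine Integrable.of_bound (Measurable.aestronglyMeasurable ?_) (∑ a, Δ a)
      (Filter.Eventually.of_forall fun x => ?_)
    · exact (measurable_of_countable Δ).comp (measurable_snd.comp measurable_snd)
    · rw [Real.norm_of_nonneg (hΔ _)]
      exact Finset.single_le_sum (fun a _ => hΔ a) (Finset.mem_univ x.2.2)
  have hI := fun t : Fin T => integral_prefixRound t.isLt (hplay t)
  have e : ∫ h, ∑ t, Δ (h t).2 ∂(law env π T)
      = ∑ t : Fin T, ∫ h, ∫ r, Δ r.2 ∂(stepKernel env π t h) ∂(law env π t) := by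
    refine (integral_finsetSum Finset.univ fun t _ => (hI t).1).trans ?_
    exact Finset.sum_congr rfl fun t _ => (hI t).2
  rw [e, Finset.sum_range, Finset.mul_sum]
  refine Finset.sum_le_sum fun t _ => ?_
  have hF' := hplay t
  rw [Measure.compProd] at hF'
  have hinner := hF'.integral_compProd
  simp only [Kernel.prodMkLeft_apply, Kernel.const_apply] at hinner
  rw [← integral_const_mul]
  refine integral_mono (hInt t t.isLt) (hinner.const_mul 2) fun h => ?_
  have hi := hr.interior hK h1 hσ t.isLt (observed t h)
  have hval : ∫ r, Δ r.2 ∂(stepKernel env π t h)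
      = ∑ a, samplingDist (1 / ε) ε σ t (q t (observed t h)) (m t (observed t h)) a * Δ a := by
    have hsnd : (stepKernel env π t h).map Prod.snd = π.kernel t (observed t h) := by
      rw [stepKernel_apply]
      exact Measure.snd_prod
    rw [← integral_map (φ := Prod.snd) (f := Δ) measurable_snd.aemeasurable
      (measurable_of_countable Δ).aestronglyMeasurable, hsnd,
      integral_fintype Integrable.of_finite]
    refine Finset.sum_congr rfl fun a _ => ?_
    rw [Measure.real, (hr t t.isLt _).2.2.2 a, ENNReal.toReal_ofReal (samplingDist_pos h1 hσ hi a).le,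
      smul_eq_mul]
  dsimp only
  rw [hval, Finset.mul_sum]
  -- The gap of `a₀` is only nonnegative, so its term is discarded; `p ≥ q / 2` gives the factor 2.
  refine (Finset.sum_le_sum_of_subset_of_nonneg (Finset.erase_subset _ _) fun a _ _ =>
    mul_nonneg (hΔ a) (hi.pos a).le).trans (Finset.sum_le_sum fun a _ => ?_)
  have := mul_le_mul_of_nonneg_left (half_le_samplingDist (t := t) h1 hσ hi a) (hΔ a)
  linarith

/-- A Hölder inequality over rounds, histories and arms, obtained as Young with free `η` followed by
`le_of_forall_young`. The gap part is at most `2 * W`; the weights `1/(t+1)` sum to at most `3 * log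
T`. -/
theorem IsRun.sum_suboptPower_le (hr : IsRun ε σ T π q m) (hK : 2 ≤ K) (h1 : 1 < ε)
    (hσ : 0 < σ) (hT : 2 ≤ T) {Δ : Fin K → ℝ} (hΔ : ∀ a, 0 ≤ Δ a) {a₀ : Fin K}
    (hpos : ∀ a, a ≠ a₀ → 0 < Δ a) {W : ℝ} (hW : 0 < W)
    (hgap : ∫ h, ∑ t, Δ (h t).2 ∂(law env π T) ≤ W) :
    ∑ t ∈ Finset.range T, ((t : ℝ) + 1) ^ (1 / ε - 1)
        * ∫ h, suboptPower ε (q t (observed t h)) a₀ ∂(law env π t)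
      ≤ (2 * W) ^ (1 / ε)
        * (3 * Real.log T * ∑ a ∈ Finset.univ.erase a₀, Δ a ^ (1 / (1 - ε))) ^ (1 - 1 / ε) := by
  obtain ⟨hInt, hle⟩ := hr.sum_integral_gap_le (env := env) hK h1 hσ hΔ a₀
  have hc := one_sub_inv_pos h1
  set S : ℝ := ∑ a ∈ Finset.univ.erase a₀, Δ a ^ (1 / (1 - ε)) with hS
  have hS0 : 0 < S := by
    obtain ⟨a, ha⟩ := exists_ne_of_two_le hK a₀
    exact Finset.sum_pos (fun b hb => Real.rpow_pos_of_pos (hpos b (Finset.mem_erase.mp hb).1) _)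
      ⟨a, Finset.mem_erase.mpr ⟨ha, Finset.mem_univ a⟩⟩
  have hlog : 0 < Real.log T := Real.log_pos (by exact_mod_cast (by omega : 1 < T))
  refine le_of_forall_young h1 (by positivity) (by positivity) fun η hη => ?_
  have hη' : 0 < η ^ (-(1 / (ε - 1))) := by positivity
  have hterm : ∀ t ∈ Finset.range T, ((t : ℝ) + 1) ^ (1 / ε - 1)
        * ∫ h, suboptPower ε (q t (observed t h)) a₀ ∂(law env π t)
      ≤ 1 / ε * η * ∫ h, ∑ a ∈ Finset.univ.erase a₀, Δ a * q t (observed t h) a ∂(law env π t)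
        + (1 - 1 / ε) * (η ^ (-(1 / (ε - 1))) * S) * ((t : ℝ) + 1)⁻¹ := by
    intro t ht
    have ht' := Finset.mem_range.mp ht
    have hcst : (1 - 1 / ε) * (η ^ (-(1 / (ε - 1))) * S) * ((t : ℝ) + 1)⁻¹
        = ∫ _h, (1 - 1 / ε) * (η ^ (-(1 / (ε - 1))) * S) * ((t : ℝ) + 1)⁻¹ ∂(law env π t) := by
      simp
    rw [hcst, ← integral_const_mul, ← integral_const_mul,
      ← integral_add ((hInt t ht').const_mul _) (integrable_const _)]
    refine integral_mono ((hr.integrable_suboptPower hK h1 hσ ht' a₀).const_mul _)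
      (((hInt t ht').const_mul _).add (integrable_const _)) fun h => ?_
    have hi := hr.interior hK h1 hσ ht' (observed t h)
    dsimp only
    rw [suboptPower, hS, Finset.mul_sum, Finset.mul_sum, Finset.mul_sum, Finset.mul_sum,
      Finset.sum_mul]
    rw [← Finset.sum_add_distrib]
    refine Finset.sum_le_sum fun a ha => ?_
    have := young_subopt (n := (t : ℝ) + 1) h1 hη (by positivity)
      (hpos a (Finset.mem_erase.mp ha).1) (hi.pos a).le
    refine this.trans (le_of_eq ?_)
    ring
  refine (Finset.sum_le_sum hterm).trans ?_
  rw [Finset.sum_add_distrib, ← Finset.mul_sum, ← Finset.mul_sum]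
  have b1 : 1 / ε * η * ∑ t ∈ Finset.range T,
      ∫ h, ∑ a ∈ Finset.univ.erase a₀, Δ a * q t (observed t h) a ∂(law env π t)
      ≤ 1 / ε * η * (2 * W) := by
    refine mul_le_mul_of_nonneg_left ?_ (by positivity)
    linarith
  have b2 : (1 - 1 / ε) * (η ^ (-(1 / (ε - 1))) * S) * ∑ t ∈ Finset.range T, ((t : ℝ) + 1)⁻¹
      ≤ (1 - 1 / ε) * (η ^ (-(1 / (ε - 1))) * S) * (3 * Real.log T) :=
    mul_le_mul_of_nonneg_left (sum_inv_le_three_log hT) (by positivity)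
  refine (add_le_add b1 b2).trans (le_of_eq ?_)
  ring

end

end

end HTBandit

/-! ### Assembly of the two regimes -/

theorem theorem1 :
    ∃ c : ℝ, 0 < c ∧
      -- adversarial regime
      (∀ (ε σ : ℝ) (K T : ℕ) (Z : Type u) [MeasurableSpace Z]
          (env : HTBandit.Environment Z K) (π : HTBandit.Policy K),
        1 < ε → ε ≤ 2 → 0 < σ → 1 ≤ K →
        HTBandit.HeavyTailed env T ε σ →
        HTBandit.IsBonusFTRL (1 / ε) ε σ T π →
        HTBandit.regret env π T ≤
          c * (σ ^ (1 / ε) * (K : ℝ) ^ ((ε - 1) / ε) * (T : ℝ) ^ (1 / ε)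
            + σ ^ (1 / ε) * K * HTBandit.iota ε T
            + HTBandit.kappa K ε σ)) ∧
      -- adversarial regime with a self-bounding constraint
      (∀ ε : ℝ, 1 < ε → ε ≤ 2 → ∃ c' : ℝ, 0 < c' ∧
        ∀ (σ : ℝ) (K T : ℕ) (Z : Type u) [MeasurableSpace Z]
          (env : HTBandit.Environment Z K) (π : HTBandit.Policy K)
          (Δ : Fin K → ℝ) (C : ℝ) (a₀ : Fin K),
        0 < σ →
        HTBandit.HeavyTailed env T ε σ →
        HTBandit.IsBonusFTRL (1 / ε) ε σ T π →
        0 ≤ C → (∀ a, 0 ≤ Δ a) →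
        HTBandit.SelfBounding env Δ C T →
        HTBandit.IsOptimalArm env π T a₀ → (∀ a, a ≠ a₀ → 0 < Δ a) →
        HTBandit.regret env π T ≤
          c' * ((2 * σ / ε) ^ (1 / (ε - 1)) * HTBandit.omegaGap ε Δ a₀ ^ (ε / (ε - 1))
              * Real.log T)
          + c * (HTBandit.omegaGap ε Δ a₀ * Real.log T ^ (1 - 1 / ε)
                * (2 * σ / ε) ^ (1 / ε) * C ^ (1 / ε)
            + σ ^ (1 / ε) * K * HTBandit.iota ε T
            + HTBandit.kappa K ε σ)) := by
  refine ⟨10000, by norm_num, ?_, ?_⟩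
  · intro ε σ K T Z _ env π h1 h2 hσ hK hht hrun
    have hι := HTBandit.iota_nonneg h1 h2 T
    have hκ := HTBandit.kappa_nonneg hK h1 hσ
    have hnn : 0 ≤ σ ^ (1 / ε) * (K : ℝ) ^ ((ε - 1) / ε) * (T : ℝ) ^ (1 / ε)
        + σ ^ (1 / ε) * K * HTBandit.iota ε T + HTBandit.kappa K ε σ := by positivity
    rcases hK.eq_or_lt with rfl | hK2
    · rw [HTBandit.regret_of_one_arm]
      positivity
    · obtain ⟨q, m, hr⟩ := hrun
      have := HTBandit.IsRun.regret_le (env := env) hr hK2 h1 h2 hσ hht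
      linarith
  · intro ε h1 h2
    refine ⟨2 * 2 ^ (1 / (ε - 1)) * 3084 ^ (ε / (ε - 1)), by positivity, ?_⟩
    intro σ K T Z _ env π Δ C a₀ hσ hht hrun hC hΔ hself hopt hpos
    have hε : 0 < ε := by linarith
    have hK : 1 ≤ K := by have := a₀.isLt; omega
    have hι := HTBandit.iota_nonneg h1 h2 T
    have hκ := HTBandit.kappa_nonneg hK h1 hσ
    have hω : 0 ≤ HTBandit.omegaGap ε Δ a₀ :=
      Real.rpow_nonneg (Finset.sum_nonneg fun a _ => Real.rpow_nonneg (hΔ a) _) _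
    have hlog := Real.log_natCast_nonneg T
    have hιK : 0 ≤ σ ^ (1 / ε) * K * HTBandit.iota ε T := by positivity
    have hfirst : 0 ≤ 2 * 2 ^ (1 / (ε - 1)) * 3084 ^ (ε / (ε - 1)) *
        ((2 * σ / ε) ^ (1 / (ε - 1)) * HTBandit.omegaGap ε Δ a₀ ^ (ε / (ε - 1))
          * Real.log T) := by positivity
    have hsecond : 0 ≤ HTBandit.omegaGap ε Δ a₀ * Real.log T ^ (1 - 1 / ε)
        * (2 * σ / ε) ^ (1 / ε) * C ^ (1 / ε) := by positivity
    -- Solving the self-bounding inequality needs positive regret; otherwise the nonnegative right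
    -- side already suffices.
    rcases le_or_gt (HTBandit.regret env π T) 0 with hneg | hR
    · linarith
    rcases hK.eq_or_lt with rfl | hK2
    · rw [HTBandit.regret_of_one_arm] at hR
      exact absurd hR (lt_irrefl _)
    obtain ⟨q, m, hr⟩ := hrun
    -- For `T ≤ 1` the logarithm vanishes and with it the leading term, so the adversarial bound is
    -- used; there `T ^ (1/ε) ≤ 1` and its main term is below `kappa`.
    rcases lt_or_ge T 2 with hT | hT
    · have := HTBandit.IsRun.regret_le (env := env) hr hK2 h1 h2 hσ hht
      have hT1 : (T : ℝ) ^ (1 / ε) ≤ 1 := by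
        refine Real.rpow_le_one (by positivity) ?_ (by positivity)
        exact_mod_cast (by omega : T ≤ 1)
      have h3 := (HTBandit.le_kappa hK h1 hσ).1
      have h4 : σ ^ (1 / ε) * (K : ℝ) ^ ((ε - 1) / ε) * (T : ℝ) ^ (1 / ε)
          ≤ σ ^ (1 / ε) * (K : ℝ) ^ ((ε - 1) / ε) :=
        mul_le_of_le_one_right (by positivity) hT1
      linarith
    -- The constraint is applied to the algorithm itself, which bounds its expected gap by `W =
    -- regret + C`.
    · have hgap := hself π
      have hW : 0 < HTBandit.regret env π T + C := by linarith
      have hpow := HTBandit.IsRun.sum_suboptPower_le (env := env) hr hK2 h1 hσ hT hΔ hpos hW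
        (by linarith)
      have hreg := (HTBandit.regret_le_of_isOptimalArm h1 hht hopt).trans
        (HTBandit.IsRun.expected_regret_le hr hK2 h1 h2 hσ hht a₀)
      have hS0 : 0 < ∑ a ∈ Finset.univ.erase a₀, Δ a ^ (1 / (1 - ε)) := by
        obtain ⟨a, ha⟩ := HTBandit.exists_ne_of_two_le hK2 a₀
        exact Finset.sum_pos
          (fun b hb => Real.rpow_pos_of_pos (hpos b (Finset.mem_erase.mp hb).1) _)
          ⟨a, Finset.mem_erase.mpr ⟨ha, Finset.mem_univ a⟩⟩
      have hL0 : 0 < Real.log T := Real.log_pos (by exact_mod_cast (by omega : 1 < T))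
      have hmul := mul_le_mul_of_nonneg_left hpow (show 0 ≤ σ ^ (1 / ε) by positivity)
      have hfin := HTBandit.self_bounding_solve (R := HTBandit.regret env π T) (C := C)
        (L := Real.log T) (S := ∑ a ∈ Finset.univ.erase a₀, Δ a ^ (1 / (1 - ε)))
        (E := 2 * HTBandit.kappa K ε σ + 1024 * (σ ^ (1 / ε) * K * HTBandit.iota ε T))
        h1 h2 hσ hR hC hL0 hS0 (by linarith)
      change HTBandit.regret env π T ≤ 2 * 2 ^ (1 / (ε - 1)) * 3084 ^ (ε / (ε - 1))
          * ((2 * σ / ε) ^ (1 / (ε - 1)) * HTBandit.omegaGap ε Δ a₀ ^ (ε / (ε - 1)) * Real.log T)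
        + 6168 * (HTBandit.omegaGap ε Δ a₀ * Real.log T ^ (1 - 1 / ε) * (2 * σ / ε) ^ (1 / ε)
          * C ^ (1 / ε)) + _ at hfin
      linarith
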